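/- **Theorem 6 (Asymptotics for short maturity barrier option).** Let $\mu\in\mathbb R$, $\sigma>0$ and $B>0$ be constants. There are constants $C>0$ and $T_0>0$, depending only on $\mu,\sigma,B$, such that the following holds. Let $0<S<B$, and let $X$ be a geometric Brownian motion, i.e. a continuous adapted solution of the stochastic differential equation $$dX_t=\mu X_t\,dt+\sigma X_t\,dW_t,\qquad X_0=S\ \text{a.s.},$$ on a filtered probability space with a standard one-dimensional Brownian motion $W$. Let $0<T\le T_0$ and let $\Psi:C[0,T]\to\mathbb R$ be Lipschitz continuous with respect to the supremum norm, with Lipschitz constant $L$. Put $$P(B,T):=\mathbb P\Big(\max_{0\le t\le T}X_t\ge B\Big).$$ Then the payoff $\Psi(\{X_t\}_{0\le t\le T})\,\mathbf 1_{\{\max_{0\le t\le T}X_t\ge B\}}$ is integrable, and its expectation, the fair price of the up-and-in barrier option, satisfies $$\mathbb E\Big[\Psi(\{X_t\}_{0\le t\le T})\,\mathbf 1_{\{\max_{0\le t\le T}X_t\ge B\}}\Big]=P(B,T)\Big[\Psi\big(\{S(B/S)^{t/T}\}_{0\le t\le T}\big)+r\Big]\quad\text{for some } r\in\mathbb R \text{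 with } |r|\le C\,L\,\sqrt T .$$ In particular, for payoffs $\Psi=\Psi_T$ with a common Lipschitz constant, $r=O(\sqrt T)$ as $T\to0^+$. -/

import Mathlib

open MeasureTheory ProbabilityTheory
open scoped NNReal ENNReal

/-- `W` is a standard one-dimensional Brownian motion with respect to the filtration `F`:
it is a Brownian motion (Gaussian finite-dimensional laws with covariance `min s t`, almost surely
continuous paths, started at `0`), it is adapted to `F`, and its increments after time `s` are
independent of `F s`. -/
structure IsBrownianWithFiltration {Ω : Type*} {mΩ : MeasurableSpace Ω}
    (F : Filtration ℝ≥0 mΩ) (W : ℝ≥0 → Ω → ℝ) (P : Measure Ω) : Prop where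
  isBrownian : IsBrownianReal W P
  adapted : ∀ t, Measurable[F t] (W t)
  indep_increments : ∀ s t, s ≤ t →
    Indep (MeasurableSpace.comap (fun ω => W t ω - W s ω) inferInstance) (F s) P

/-- The left-endpoint sum `∑_{i < n} H_{p i} (W_{p (i+1)} - W_{p i})`. -/
def itoSum {Ω : Type*} (H W : ℝ≥0 → Ω → ℝ) (n : ℕ) (p : ℕ → ℝ≥0) (ω : Ω) : ℝ :=
  ∑ i ∈ Finset.range n, H (p i) ω * (W (p (i + 1)) ω - W (p i) ω)

/-- `Z` is (a version of) the Itô integral `∫₀ᵗ H dW` of an adapted integrand `H` with continuous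
paths: the left-endpoint sums over the partitions `0 = p 0 ≤ p 1 ≤ ⋯ ≤ p n = t` converge to `Z` in
probability as the mesh tends to zero. -/
def IsItoIntegral {Ω : Type*} {mΩ : MeasurableSpace Ω} (P : Measure Ω)
    (H W : ℝ≥0 → Ω → ℝ) (t : ℝ≥0) (Z : Ω → ℝ) : Prop :=
  ∀ ε : ℝ, 0 < ε → ∃ δ : ℝ, 0 < δ ∧
    ∀ (n : ℕ) (p : ℕ → ℝ≥0), Monotone p → p 0 = 0 → p n = t →
      (∀ i < n, (p (i + 1) : ℝ) - (p i : ℝ) < δ) →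
      P {ω | ε ≤ |itoSum H W n p ω - Z ω|} ≤ ENNReal.ofReal ε

/-- `X` is a solution, on the filtered probability space `(Ω, F, P)` with `F`-Brownian motion `W`,
of the stochastic differential equation `dX = μ X dt + σ X dW`, `X₀ = S` almost surely:
`X` is adapted with almost surely continuous paths, and for each `t`, almost surely,
`X t = X 0 + ∫₀ᵗ μ X_s ds + ∫₀ᵗ σ X_s dW_s`. -/
structure IsGBMSolution {Ω : Type*} {mΩ : MeasurableSpace Ω} (P : Measure Ω)
    (F : Filtration ℝ≥0 mΩ) (W : ℝ≥0 → Ω → ℝ) (μ σ S : ℝ) (X : ℝ≥0 → Ω → ℝ) : Prop where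
  brownian : IsBrownianWithFiltration F W P
  adapted : ∀ t, Measurable[F t] (X t)
  cont : ∀ᵐ ω ∂P, Continuous (fun t => X t ω)
  init : ∀ᵐ ω ∂P, X 0 ω = S
  sde : ∃ I : ℝ≥0 → Ω → ℝ,
    (∀ t, IsItoIntegral P (fun s ω => σ * X s ω) W t (I t)) ∧
    ∀ t : ℝ≥0, ∀ᵐ ω ∂P,
      X t ω = X 0 ω + (∫ s in (0 : ℝ)..(t : ℝ), μ * X s.toNNReal ω) + I t ω

/-- The path `{x_t}_{0 ≤ t ≤ T}` as an element of `C[0,T]`; the value `0` is used only for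
functions that are not continuous on `[0,T]`. -/
noncomputable def pathOn (T : ℝ≥0) (x : ℝ≥0 → ℝ) : C(Set.Icc (0 : ℝ≥0) T, ℝ) :=
  open Classical in
  if h : Continuous (fun t : Set.Icc (0 : ℝ≥0) T => x t) then ⟨fun t => x t, h⟩ else 0

/-- The exponential curve `t ↦ S (B/S)^{t/T}` in `C[0,T]`. -/
noncomputable def exponentialCurve (S B : ℝ) (hS : 0 < S) (hB : 0 < B) (T : ℝ≥0) :
    C(Set.Icc (0 : ℝ≥0) T, ℝ) where
  toFun t := S * (B / S) ^ (((t : ℝ≥0) : ℝ) / (T : ℝ))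
  continuous_toFun := by
    have h := Real.continuous_const_rpow (div_pos hB hS).ne'
    fun_prop

/-- The event `{max_{0 ≤ t ≤ T} X_t ≥ B}`. -/
def barrierEvent {Ω : Type*} (X : ℝ≥0 → Ω → ℝ) (B : ℝ) (T : ℝ≥0) : Set Ω :=
  {ω | B ≤ ⨆ t : Set.Icc (0 : ℝ≥0) T, X t ω}

/-- The payoff `Ψ({X_t}_{0 ≤ t ≤ T}) · 1{max_{0 ≤ t ≤ T} X_t ≥ B}` of the up-and-in option. -/
noncomputable def barrierPayoff {Ω : Type*} (X : ℝ≥0 → Ω → ℝ) (B : ℝ) (T : ℝ≥0)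
    (Ψ : C(Set.Icc (0 : ℝ≥0) T, ℝ) → ℝ) : Ω → ℝ :=
  (barrierEvent X B T).indicator (fun ω => Ψ (pathOn T (fun t => X t ω)))

/-! Write `ν = μ - σ²/2`. Almost surely `X t = S exp (σ W t + ν t)` for all `t`
(`ae_forall_eq_exp`). With `τ = √T` and the rescaled Brownian motion `V s = W (T s) / τ`, this reads
`log (X (T s) / S) = σ τ Y s`, where `Y s = V s + θ s` and the drift `θ = ν τ / σ` stays bounded for
`T ≤ 1`. Hitting `B` before `T` means that `Y` reaches `y = log (B/S) / (σ τ)` before time `1`, and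
the exponential curve becomes the line `y s`. It therefore suffices that, given that `Y` reaches
`y`, the deviation `sup |Y s - y s|` has exponential moments bounded uniformly in `y > 0`
(`lintegral_lineDeviationSup_le`). Then `X` is within order `τ` of the curve in conditional mean,
and the Lipschitz property gives the bound on `r`.

The moment bound is proved on grids (`lintegral_lineDeviation_le`). At the first passage the future
is independent of the past and adds a factor with bounded mean. The deviation up to the first
passage depends on the past only, and from there the walk ends above `y` with conditional
probability bounded below; so its integral is at most a constant times an integral over `{y ≤ Y 1}`
(`driftWalk_reflection_le`). On that event `Y s - y s` is a Brownian bridge plus `s` times the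
overshoot `Y 1 - y`. The bridge is independent of `V 1`, and the overshoot of a Gaussian above a
level has conditional exponential moments bounded uniformly in the level
(`lintegral_exp_Ici_gaussianReal_le`). Fatou's lemma then leads to continuous time.

The exponential formula is derived directly from the convergence of left-endpoint sums. The defect
of `X` in the Euler scheme tends to zero in probability, and `X` minus this defect, multiplied by
`exp (-σ W - ν t)`, telescopes (`eulerDefect_telescope`). On an event where all quantities are
bounded, the sums that arise have vanishing second moments, so `X t exp (-σ W t - ν t) = S` almost
surely (`measure_deviation_le`). -/

/-! ### Discrete stochastic integrals: isometry and maximal inequality. -/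

section DiscreteMartingale

/-- The step data of a discrete stochastic integral: `G i` is bounded and known at time `i`, while
`ξ i` is square integrable, known at time `i + 1` and independent of the past. -/
structure IsMartingaleTransform {Ω : Type*} {mΩ : MeasurableSpace Ω} (P : Measure Ω)
    (𝓖 : ℕ → MeasurableSpace Ω) (G ξ : ℕ → Ω → ℝ) (c : ℝ) : Prop where
  mono : Monotone 𝓖
  le : ∀ i, 𝓖 i ≤ mΩ
  meas : ∀ i, Measurable[𝓖 i] (G i)
  bdd : ∀ i ω, |G i ω| ≤ c
  noise_meas : ∀ i, Measurable[𝓖 (i + 1)] (ξ i)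
  noise_memLp : ∀ i, MemLp (ξ i) 2 P
  noise_indep : ∀ i, Indep (MeasurableSpace.comap (ξ i) inferInstance) (𝓖 i) P

namespace IsMartingaleTransform

variable {Ω : Type*} {mΩ : MeasurableSpace Ω} {P : Measure Ω}
  {𝓖 : ℕ → MeasurableSpace Ω} {G ξ : ℕ → Ω → ℝ} {c : ℝ}

theorem measurable_sum (h : IsMartingaleTransform P 𝓖 G ξ c) (n : ℕ) :
    Measurable[𝓖 n] (fun ω => ∑ i ∈ Finset.range n, G i ω * ξ i ω) := by
  refine Finset.measurable_fun_sum _ fun i hi => ?_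
  have hi : i < n := Finset.mem_range.1 hi
  exact Measurable.mul ((h.meas i).mono (h.mono hi.le) le_rfl)
    ((h.noise_meas i).mono (h.mono hi) le_rfl)

theorem integral_mul_noise (h : IsMartingaleTransform P 𝓖 G ξ c) {i : ℕ} {f : Ω → ℝ}
    (hf : Measurable[𝓖 i] f) {φ : ℝ → ℝ} (hφ : Measurable φ) :
    ∫ ω, f ω * φ (ξ i ω) ∂P = (∫ ω, f ω ∂P) * ∫ ω, φ (ξ i ω) ∂P := by
  have hi : IndepFun f (fun ω => φ (ξ i ω)) P := by
    have h1 : IndepFun f (ξ i) P := by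
      rw [IndepFun_iff_Indep]
      exact indep_of_indep_of_le_left (h.noise_indep i).symm hf.comap_le
    exact h1.comp measurable_id hφ
  exact hi.integral_mul_eq_mul_integral (hf.mono (h.le i) le_rfl).aestronglyMeasurable
    (hφ.comp ((h.noise_meas i).mono (h.le _) le_rfl)).aestronglyMeasurable

variable [IsProbabilityMeasure P]

theorem memLp_coeff (h : IsMartingaleTransform P 𝓖 G ξ c) (i : ℕ) (p : ℝ≥0∞) :
    MemLp (G i) p P :=
  MemLp.of_bound ((h.meas i).mono (h.le i) le_rfl).aestronglyMeasurable c
    (ae_of_all _ fun ω => h.bdd i ω)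

theorem memLp_mul (h : IsMartingaleTransform P 𝓖 G ξ c) (i : ℕ) :
    MemLp (fun ω => G i ω * ξ i ω) 2 P :=
  (h.noise_memLp i).mul (h.memLp_coeff i ∞)

theorem memLp_sum (h : IsMartingaleTransform P 𝓖 G ξ c) (n : ℕ) :
    MemLp (fun ω => ∑ i ∈ Finset.range n, G i ω * ξ i ω) 2 P :=
  memLp_finsetSum _ fun i _ => h.memLp_mul i

/-- The Itô isometry for discrete stochastic integrals. -/
theorem integral_sum_sq (h : IsMartingaleTransform P 𝓖 G ξ c) (h0 : ∀ i, ∫ ω, ξ i ω ∂P = 0)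
    (n : ℕ) :
    ∫ ω, (∑ i ∈ Finset.range n, G i ω * ξ i ω) ^ 2 ∂P =
      ∑ i ∈ Finset.range n, (∫ ω, G i ω ^ 2 ∂P) * ∫ ω, ξ i ω ^ 2 ∂P := by
  induction n with
  | zero => simp
  | succ n ih =>
    rw [Finset.sum_range_succ, ← ih]
    have hS := h.memLp_sum n
    set S : Ω → ℝ := fun ω => ∑ i ∈ Finset.range n, G i ω * ξ i ω with hSdef
    have e : ∀ ω, (∑ i ∈ Finset.range (n + 1), G i ω * ξ i ω) ^ 2 =
        S ω ^ 2 + (2 * (S ω * G n ω * ξ n ω) + G n ω ^ 2 * ξ n ω ^ 2) := by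
      intro ω; rw [Finset.sum_range_succ, hSdef]; ring
    have i1 : Integrable (fun ω => S ω ^ 2) P := hS.integrable_sq
    have i2 : Integrable (fun ω => S ω * G n ω * ξ n ω) P := by
      simp_rw [mul_assoc]
      exact hS.integrable_mul (h.memLp_mul n)
    have i3 : Integrable (fun ω => G n ω ^ 2 * ξ n ω ^ 2) P := by
      simp_rw [← mul_pow]
      exact (h.memLp_mul n).integrable_sq
    simp_rw [e]
    have i4 : Integrable (fun ω => 2 * (S ω * G n ω * ξ n ω) + G n ω ^ 2 * ξ n ω ^ 2) P :=
      (i2.const_mul 2).add i3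
    rw [integral_add i1 i4, integral_add (i2.const_mul 2) i3, integral_const_mul]
    -- The cross term vanishes: `S * G n` is known at time `n`, and `ξ n` is centred and independent
    -- of that past.
    have m1 : ∫ ω, S ω * G n ω * ξ n ω ∂P = 0 := by
      have := h.integral_mul_noise (i := n) (f := fun ω => S ω * G n ω) (φ := id)
        ((h.measurable_sum n).mul (h.meas n)) measurable_id
      simpa [h0] using this
    have m2 := h.integral_mul_noise (i := n) (f := fun ω => G n ω ^ 2) (φ := fun x => x ^ 2)
      ((h.meas n).pow_const 2) (by fun_prop)
    rw [m1, m2]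
    ring

/-- A second moment bound for a discrete stochastic integral whose noise need not be centred. -/
theorem integral_sum_sq_le (h : IsMartingaleTransform P 𝓖 G ξ c) {γ m v : ℝ} (n : ℕ)
    (hγ : ∀ i < n, ∫ ω, G i ω ^ 2 ∂P ≤ γ) (hγ0 : 0 ≤ γ) (hm : ∀ i, |∫ ω, ξ i ω ∂P| ≤ m)
    (hv : ∀ i, ∫ ω, ξ i ω ^ 2 ∂P ≤ v) :
    ∫ ω, (∑ i ∈ Finset.range n, G i ω * ξ i ω) ^ 2 ∂P ≤ 2 * γ * (n * v + n ^ 2 * m ^ 2) := by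
  -- Split the noise into its centred part and its mean `e i`. The isometry handles the first sum
  -- and Cauchy–Schwarz the second; the factor `2` comes from `(a + b)² ≤ 2a² + 2b²`.
  set e : ℕ → ℝ := fun i => ∫ ω, ξ i ω ∂P with he
  have hm0 : 0 ≤ m := (abs_nonneg _).trans (hm 0)
  have h' : IsMartingaleTransform P 𝓖 G (fun i ω => ξ i ω - e i) c :=
    { h with
      noise_meas := fun i => (h.noise_meas i).sub_const _
      noise_memLp := fun i => (h.noise_memLp i).sub (memLp_const _)
      noise_indep := fun i => by
        refine indep_of_indep_of_le_left (h.noise_indep i) ?_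
        have : (fun ω => ξ i ω - e i) = (fun x => x - e i) ∘ ξ i := rfl
        rw [this, ← MeasurableSpace.comap_comp]
        exact MeasurableSpace.comap_mono (by fun_prop : Measurable fun x : ℝ => x - e i).comap_le }
  have hξ : ∀ i, Integrable (ξ i) P := fun i => (h.noise_memLp i).integrable (by norm_num)
  have hG2 : ∀ i, Integrable (fun ω => G i ω ^ 2) P := fun i => (h.memLp_coeff i 2).integrable_sq
  have h0 : ∀ i, ∫ ω, (ξ i ω - e i) ∂P = 0 := fun i => by
    rw [integral_sub (hξ i) (integrable_const _)]; simp [he]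
  have hvar : ∀ i, ∫ ω, (ξ i ω - e i) ^ 2 ∂P ≤ v := fun i => by
    have hi := (h.noise_memLp i).integrable_sq
    have : ∫ ω, (ξ i ω - e i) ^ 2 ∂P = ∫ ω, ξ i ω ^ 2 ∂P - e i ^ 2 := by
      have e1 : ∀ ω, (ξ i ω - e i) ^ 2 = ξ i ω ^ 2 - (2 * e i * ξ i ω - e i ^ 2) := fun ω => by ring
      simp_rw [e1]
      have i4 : Integrable (fun ω => 2 * e i * ξ i ω - e i ^ 2) P :=
        ((hξ i).const_mul _).sub (integrable_const _)
      rw [integral_sub hi i4, integral_sub ((hξ i).const_mul _) (integrable_const _), integral_const_mul]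
      simp [he]; ring
    nlinarith [hv i, sq_nonneg (e i)]
  have A := h'.integral_sum_sq h0 n
  have A' : ∫ ω, (∑ i ∈ Finset.range n, G i ω * (ξ i ω - e i)) ^ 2 ∂P ≤ n * (γ * v) := by
    rw [A]
    calc _ ≤ ∑ i ∈ Finset.range n, γ * v := Finset.sum_le_sum fun i hi =>
          mul_le_mul (hγ i (Finset.mem_range.1 hi)) (hvar i)
            (integral_nonneg fun ω => sq_nonneg _) hγ0
      _ = _ := by simp
  have iB : Integrable (fun ω => ∑ i ∈ Finset.range n, G i ω ^ 2) P :=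
    integrable_finsetSum _ fun i _ => hG2 i
  have B : ∀ ω, (∑ i ∈ Finset.range n, G i ω * e i) ^ 2 ≤
      n * m ^ 2 * ∑ i ∈ Finset.range n, G i ω ^ 2 := fun ω => by
    calc _ ≤ (∑ i ∈ Finset.range n, G i ω ^ 2) * ∑ i ∈ Finset.range n, e i ^ 2 :=
          Finset.sum_mul_sq_le_sq_mul_sq _ _ _
      _ ≤ (∑ i ∈ Finset.range n, G i ω ^ 2) * ∑ i ∈ Finset.range n, m ^ 2 := by
          refine mul_le_mul_of_nonneg_left (Finset.sum_le_sum fun i _ => ?_)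
            (Finset.sum_nonneg fun i _ => sq_nonneg _)
          rw [← sq_abs]; exact pow_le_pow_left₀ (abs_nonneg _) (hm i) 2
      _ = _ := by simp; ring
  have B' : ∫ ω, (n * m ^ 2 * ∑ i ∈ Finset.range n, G i ω ^ 2) ∂P ≤ n * m ^ 2 * (n * γ) := by
    rw [integral_const_mul, integral_finsetSum _ fun i _ => hG2 i]
    refine mul_le_mul_of_nonneg_left ?_ (by positivity)
    calc _ ≤ ∑ i ∈ Finset.range n, γ := Finset.sum_le_sum fun i hi => hγ i (Finset.mem_range.1 hi)
      _ = _ := by simp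
  have iA := (h'.memLp_sum n).integrable_sq
  calc _ ≤ ∫ ω, (2 * (∑ i ∈ Finset.range n, G i ω * (ξ i ω - e i)) ^ 2 +
          2 * (n * m ^ 2 * ∑ i ∈ Finset.range n, G i ω ^ 2)) ∂P := by
        refine integral_mono (h.memLp_sum n).integrable_sq
          ((iA.const_mul 2).add ((iB.const_mul _).const_mul 2)) fun ω => ?_
        have e2 : ∑ i ∈ Finset.range n, G i ω * ξ i ω =
            ∑ i ∈ Finset.range n, G i ω * (ξ i ω - e i) + ∑ i ∈ Finset.range n, G i ω * e i := by
          rw [← Finset.sum_add_distrib]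
          exact Finset.sum_congr rfl fun i _ => by ring
        have := B ω
        simp only [e2]
        nlinarith [sq_nonneg (∑ i ∈ Finset.range n, G i ω * (ξ i ω - e i) -
          ∑ i ∈ Finset.range n, G i ω * e i)]
    _ ≤ 2 * (n * (γ * v)) + 2 * (n * m ^ 2 * (n * γ)) := by
        rw [integral_add (iA.const_mul 2) ((iB.const_mul _).const_mul 2), integral_const_mul,
          integral_const_mul 2]
        linarith
    _ = _ := by ring

/-- Kolmogorov's maximal inequality for discrete stochastic integrals. -/
theorem measure_exists_sum_gt_le (h : IsMartingaleTransform P 𝓖 G ξ c)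
    (h0 : ∀ i, ∫ ω, ξ i ω ∂P = 0) {v : ℝ} (hv : ∀ i, ∫ ω, ξ i ω ^ 2 ∂P ≤ v) {K : ℝ} (hK : 0 < K)
    (n : ℕ) :
    P.real {ω | ∃ i ≤ n, K < |∑ j ∈ Finset.range i, G j ω * ξ j ω|} ≤ n * (c ^ 2 * v) / K ^ 2 := by
  classical
  set M : ℕ → Ω → ℝ := fun i ω => ∑ j ∈ Finset.range i, G j ω * ξ j ω with hM
  set A : ℕ → Set Ω := fun j => {ω | ∀ i ≤ j, |M i ω| ≤ K} with hA
  have hAm : ∀ j, MeasurableSet[𝓖 j] (A j) := fun j => by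
    have : A j = ⋂ i, ⋂ (_ : i ≤ j), {ω | |M i ω| ≤ K} := by ext; simp [hA]
    rw [this]
    refine MeasurableSet.iInter fun i => MeasurableSet.iInter fun hi => ?_
    have hm : Measurable[𝓖 j] (fun ω => |M i ω|) :=
      measurable_norm.comp ((h.measurable_sum i).mono (h.mono hi) le_rfl)
    exact hm measurableSet_Iic
  have h' : IsMartingaleTransform P 𝓖 (fun j => (A j).indicator (G j)) ξ c :=
    { h with
      meas := fun i => (h.meas i).indicator (hAm i)
      bdd := fun i ω => by
        by_cases hω : ω ∈ A i
        · simpa [hω] using h.bdd i ω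
        · simpa [hω] using (abs_nonneg _).trans (h.bdd i ω) }
  -- The integral stopped at the first crossing: `A j` switches the coefficients off once a partial
  -- sum has exceeded `K`. Hence `Z` is the value at the crossing, and Chebyshev's inequality for
  -- `Z` controls the whole maximum.
  set Z : Ω → ℝ := fun ω => ∑ j ∈ Finset.range n, (A j).indicator (G j) ω * ξ j ω with hZ
  have hZ2 : ∫ ω, Z ω ^ 2 ∂P ≤ n * (c ^ 2 * v) := by
    rw [hZ, h'.integral_sum_sq h0 n]
    calc _ ≤ ∑ i ∈ Finset.range n, c ^ 2 * v := Finset.sum_le_sum fun i _ => by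
          refine mul_le_mul ?_ (hv i) (integral_nonneg fun ω => sq_nonneg _) (sq_nonneg _)
          calc _ ≤ ∫ ω, c ^ 2 ∂P := by
                refine integral_mono (h'.memLp_coeff i 2).integrable_sq (integrable_const _)
                  fun ω => ?_
                simp only
                rw [← sq_abs]
                exact pow_le_pow_left₀ (abs_nonneg _) (h'.bdd i ω) 2
            _ = _ := by simp
      _ = _ := by simp
  have hsub : {ω | ∃ i ≤ n, K < |M i ω|} ⊆ {ω | K ^ 2 ≤ Z ω ^ 2} := by
    intro ω hω
    have hω' : ∃ i, i ≤ n ∧ K < |M i ω| := hω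
    set i₀ := Nat.find hω' with hi₀
    obtain ⟨h1, h2⟩ := Nat.find_spec hω'
    have hmin : ∀ i < i₀, |M i ω| ≤ K := fun i hi => by
      have := Nat.find_min hω' hi
      simp only [not_and, not_lt] at this
      exact this (hi.le.trans h1)
    have hZM : Z ω = M i₀ ω := by
      rw [hZ, hM]
      simp only
      rw [← Finset.sum_range_add_sum_Ico _ h1]
      have e1 : ∑ j ∈ Finset.Ico i₀ n, (A j).indicator (G j) ω * ξ j ω = 0 := by
        refine Finset.sum_eq_zero fun j hj => ?_
        have : ω ∉ A j := fun hc => absurd (hc i₀ (Finset.mem_Ico.1 hj).1) (not_le.2 h2)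
        simp [this]
      rw [e1, add_zero]
      refine Finset.sum_congr rfl fun j hj => ?_
      have : ω ∈ A j := fun i hi => hmin i (hi.trans_lt (Finset.mem_range.1 hj))
      simp [this]
    show K ^ 2 ≤ Z ω ^ 2
    rw [hZM, ← sq_abs (M i₀ ω)]
    exact pow_le_pow_left₀ hK.le h2.le 2
  calc _ ≤ P.real {ω | K ^ 2 ≤ Z ω ^ 2} := measureReal_mono hsub
    _ ≤ (∫ ω, Z ω ^ 2 ∂P) / K ^ 2 := by
        rw [le_div_iff₀ (by positivity), mul_comm]
        exact mul_meas_ge_le_integral_of_nonneg (ae_of_all _ fun ω => sq_nonneg _)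
          (h'.memLp_sum n).integrable_sq _
    _ ≤ _ := by gcongr

end IsMartingaleTransform

end DiscreteMartingale

/-! ### Gaussian moments of a single time step. -/

theorem Real.abs_exp_sub_one_le_abs_mul_exp_abs (v : ℝ) :
    |Real.exp v - 1| ≤ |v| * Real.exp |v| := by
  have h1 := Real.add_one_le_exp v
  have h2 := Real.add_one_le_exp (-v)
  -- Multiply `1 - v ≤ exp (-v)` by `exp v`.
  have h3 : Real.exp v - 1 ≤ v * Real.exp v := by
    have : Real.exp (-v) * Real.exp v = 1 := by rw [← Real.exp_add]; simp
    nlinarith [Real.exp_pos v]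
  rcases le_total 0 v with hv | hv
  · rw [abs_of_nonneg hv, abs_of_nonneg (by linarith)]; exact h3
  · have : Real.exp v ≤ 1 := Real.exp_le_one_iff.2 hv
    rw [abs_of_nonpos hv, abs_of_nonpos (by linarith)]
    have : 1 ≤ Real.exp (-v) := Real.one_le_exp (by linarith)
    nlinarith

theorem Real.abs_exp_sub_one_sub_le_sq_mul_exp_abs (v : ℝ) :
    |Real.exp v - 1 - v| ≤ v ^ 2 * Real.exp |v| := by
  have h1 := Real.add_one_le_exp v
  have h3 : Real.exp v - 1 ≤ v * Real.exp v := by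
    have h2 := Real.add_one_le_exp (-v)
    have : Real.exp (-v) * Real.exp v = 1 := by rw [← Real.exp_add]; simp
    nlinarith [Real.exp_pos v]
  rw [abs_of_nonneg (by linarith)]
  calc Real.exp v - 1 - v ≤ v * (Real.exp v - 1) := by linarith
    _ ≤ |v * (Real.exp v - 1)| := le_abs_self _
    _ = |v| * |Real.exp v - 1| := abs_mul _ _
    _ ≤ |v| * (|v| * Real.exp |v|) := by
        gcongr; exact Real.abs_exp_sub_one_le_abs_mul_exp_abs v
    _ = _ := by rw [← sq_abs v]; ring

theorem Real.sq_le_two_mul_exp {q : ℝ} (hq : 0 ≤ q) : q ^ 2 ≤ 2 * Real.exp q := by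
  linarith [Real.quadratic_le_exp_of_nonneg hq]

theorem integrable_exp_mul_abs_gaussianReal (a m : ℝ) (v : ℝ≥0) :
    Integrable (fun x => Real.exp (a * |x|)) (gaussianReal m v) :=
  integrable_exp_mul_abs (X := fun x => x) (integrable_exp_mul_gaussianReal a)
    (integrable_exp_mul_gaussianReal (-a))

/-- Reduces every variance to the standard Gaussian, so that powers of `v` can be extracted from
bounds that are otherwise uniform in `v`. -/
theorem gaussianReal_zero_eq_map_sqrt (v : ℝ≥0) :
    gaussianReal 0 v = (gaussianReal 0 1).map (√(v : ℝ) * ·) := by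
  rw [gaussianReal_map_const_mul]
  congr 1
  · simp
  · ext; simp

theorem integral_gaussianReal_exp (a : ℝ) (v : ℝ≥0) :
    ∫ x, Real.exp (a * x) ∂gaussianReal 0 v = Real.exp (v * a ^ 2 / 2) := by
  have := congrFun (mgf_fun_id_gaussianReal (μ := 0) (v := v)) a
  simpa [mgf] using this

/-- The derivative of the moment generating function, computed under the integral and from its
closed form. -/
theorem integral_gaussianReal_mul_exp (a : ℝ) (v : ℝ≥0) :
    ∫ x, x * Real.exp (a * x) ∂gaussianReal 0 v = v * a * Real.exp (v * a ^ 2 / 2) := by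
  have h1 := hasDerivAt_mgf (X := id) (μ := gaussianReal 0 v) (t := a) (by simp)
  rw [mgf_id_gaussianReal] at h1
  have h2 : HasDerivAt (fun t : ℝ => Real.exp (0 * t + v * t ^ 2 / 2))
      (Real.exp (0 * a + v * a ^ 2 / 2) * (v * a)) a := by
    have : HasDerivAt (fun t : ℝ => 0 * t + v * t ^ 2 / 2) (v * a) a := by
      have := (((hasDerivAt_pow 2 a).const_mul (v : ℝ)).div_const 2)
      simp only [zero_mul, zero_add]
      convert! this using 1
      push_cast; ring
    exact this.exp
  have h3 := h1.unique h2
  simp only [id] at h3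
  rw [h3]; ring_nf

theorem integrable_mul_exp_gaussianReal (a : ℝ) (v : ℝ≥0) :
    Integrable (fun x => x * Real.exp (a * x)) (gaussianReal 0 v) := by
  have := integrable_pow_mul_exp_of_mem_interior_integrableExpSet
    (X := id) (μ := gaussianReal 0 v) (v := a) (by simp) 1
  simpa using this

/-- A function of a centred Gaussian of variance `v` that is bounded by a multiple of
`exp (b |z|)` in terms of the standardised variable `z`. -/
theorem memLp_and_integral_sq_le_of_abs_le_exp {f : ℝ → ℝ} (hf : Measurable f) {v : ℝ≥0}
    {A b : ℝ} (h : ∀ z, |f (√(v : ℝ) * z)| ≤ A * Real.exp (b * |z|)) :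
    MemLp f 2 (gaussianReal 0 v) ∧
      ∫ x, f x ^ 2 ∂gaussianReal 0 v ≤
        A ^ 2 * ∫ z, Real.exp (2 * b * |z|) ∂gaussianReal 0 1 := by
  have hmap := gaussianReal_zero_eq_map_sqrt v
  have hfz : Measurable fun z : ℝ => f (√(v : ℝ) * z) := by fun_prop
  have hsq : ∀ z : ℝ, f (√(v : ℝ) * z) ^ 2 ≤ A ^ 2 * Real.exp (2 * b * |z|) := fun z => by
    have := pow_le_pow_left₀ (abs_nonneg _) (h z) 2
    rw [sq_abs, mul_pow, ← Real.exp_nat_mul] at this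
    rwa [Nat.cast_ofNat, ← mul_assoc 2 b] at this
  have hint := (integrable_exp_mul_abs_gaussianReal (2 * b) 0 1).const_mul (A ^ 2)
  have hint' : Integrable (fun z : ℝ => f (√(v : ℝ) * z) ^ 2) (gaussianReal 0 1) :=
    hint.mono' (hfz.pow_const 2).aestronglyMeasurable
      (ae_of_all _ fun z => by rw [Real.norm_of_nonneg (sq_nonneg _)]; exact hsq z)
  constructor
  · rw [memLp_two_iff_integrable_sq hf.aestronglyMeasurable, hmap,
      integrable_map_measure (hf.pow_const 2).aestronglyMeasurable (by fun_prop)]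
    exact hint'
  · rw [hmap, integral_map (by fun_prop) (hf.pow_const 2).aestronglyMeasurable,
      ← integral_const_mul]
    exact integral_mono hint' hint hsq

/-- Moments of one step of the inverse geometric Brownian motion and of its product with one Euler
step, up to the orders that matter for the quadratic variation. -/
theorem exists_gaussian_step_bounds (μ σ : ℝ) :
    ∃ c : ℝ, 0 ≤ c ∧ ∀ v : ℝ≥0, v ≤ 1 →
      (MemLp (fun x : ℝ => Real.exp (-σ * x - (μ - σ ^ 2 / 2) * v) - 1) 2 (gaussianReal 0 v) ∧
      |∫ x, (Real.exp (-σ * x - (μ - σ ^ 2 / 2) * v) - 1) ∂gaussianReal 0 v| ≤ c * v ∧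
      ∫ x, (Real.exp (-σ * x - (μ - σ ^ 2 / 2) * v) - 1) ^ 2 ∂gaussianReal 0 v ≤ c * v) ∧
      (MemLp (fun x : ℝ => (1 + μ * v + σ * x) * Real.exp (-σ * x - (μ - σ ^ 2 / 2) * v) - 1) 2
        (gaussianReal 0 v) ∧
      |∫ x, ((1 + μ * v + σ * x) * Real.exp (-σ * x - (μ - σ ^ 2 / 2) * v) - 1)
        ∂gaussianReal 0 v| ≤ c * v ^ 2 ∧
      ∫ x, ((1 + μ * v + σ * x) * Real.exp (-σ * x - (μ - σ ^ 2 / 2) * v) - 1) ^ 2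
        ∂gaussianReal 0 v ≤ c * v ^ 2) := by
  set ν := μ - σ ^ 2 / 2 with hν
  set w := |σ ^ 2 - μ| with hw
  set J := ∫ z, Real.exp (2 * (3 * |σ|) * |z|) ∂gaussianReal 0 1 with hJ
  have hJ0 : 0 ≤ J := integral_nonneg fun z => (Real.exp_pos _).le
  set A := (σ ^ 2 / 2 + 2) * Real.exp (3 * |ν|) with hA
  have hA0 : 0 ≤ A := by positivity
  have hw0 : 0 ≤ w := abs_nonneg _
  -- The three summands serve, in this order, both second moments, the mean of the first variable
  -- and the mean of the second.
  refine ⟨A ^ 2 * J + w * Real.exp w + w ^ 2 * Real.exp (2 * w), by positivity, fun v hv1 => ?_⟩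
  have hv0 : (0 : ℝ) ≤ v := v.2
  have hv1' : (v : ℝ) ≤ 1 := by exact_mod_cast hv1
  set s := √(v : ℝ) with hs
  have hs0 : 0 ≤ s := Real.sqrt_nonneg _
  have hss : s ^ 2 = v := Real.sq_sqrt hv0
  have hs1 : s ≤ 1 := Real.sqrt_le_one.2 hv1'
  have hvs : (v : ℝ) ≤ s := by nlinarith
  -- With `q = |σ| |z| + |ν|`, the log-increment is at most `s q`, since `v ≤ s ≤ 1`; every factor
  -- `s = √v` gained here counts towards the order in `v`.
  have key : ∀ z : ℝ, ∃ q : ℝ, 0 ≤ q ∧ |σ * (s * z) + ν * v| ≤ s * q ∧ s * q ≤ q ∧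
      Real.exp (3 * q) = Real.exp (3 * |ν|) * Real.exp (3 * |σ| * |z|) := fun z => by
    refine ⟨|σ| * |z| + |ν|, by positivity, ?_, ?_, ?_⟩
    · calc _ ≤ |σ * (s * z)| + |ν * v| := abs_add_le _ _
        _ = s * (|σ| * |z|) + |ν| * v := by
            rw [abs_mul, abs_mul, abs_mul, abs_of_nonneg hs0, abs_of_nonneg hv0]; ring
        _ ≤ s * (|σ| * |z|) + |ν| * s := by gcongr
        _ = _ := by ring
    · have : 0 ≤ |σ| * |z| + |ν| := by positivity
      nlinarith
    · rw [← Real.exp_add]; ring_nf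
  have hexp3 : ∀ q : ℝ, 0 ≤ q → q ^ 2 * Real.exp q * Real.exp q ≤ 2 * Real.exp (3 * q) :=
    fun q hq => by
      have e : Real.exp (3 * q) = Real.exp q * Real.exp q * Real.exp q := by
        rw [← Real.exp_add, ← Real.exp_add]; ring_nf
      rw [e]
      have := Real.sq_le_two_mul_exp hq
      have h2 := Real.exp_pos q
      nlinarith [mul_pos h2 h2]
  have b1 : ∀ z : ℝ, |Real.exp (-σ * (s * z) - ν * v) - 1| ≤
      (s * A) * Real.exp (3 * |σ| * |z|) := fun z => by
    obtain ⟨q, hq0, hq1, hq2, hq3⟩ := key z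
    have e1 : |(-σ * (s * z) - ν * v)| ≤ s * q := by
      rw [← abs_neg]; convert hq1 using 2; ring
    calc _ ≤ (s * q) * Real.exp (s * q) := by
          refine (Real.abs_exp_sub_one_le_abs_mul_exp_abs _).trans ?_
          gcongr
      _ ≤ (s * q) * Real.exp q := by gcongr
      _ = s * (q * Real.exp q) := by ring
      _ ≤ s * ((σ ^ 2 / 2 + 2) * Real.exp (3 * q)) := by
          gcongr ?_ * ?_
          have h1 : q ≤ Real.exp q := by linarith [Real.add_one_le_exp q]
          have e : Real.exp (3 * q) = Real.exp q * Real.exp q * Real.exp q := by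
            rw [← Real.exp_add, ← Real.exp_add]; ring_nf
          have h2 : 1 ≤ Real.exp q := Real.one_le_exp hq0
          have h3 : Real.exp q * Real.exp q ≤ Real.exp (3 * q) := by
            rw [e]; nlinarith [mul_pos (Real.exp_pos q) (Real.exp_pos q)]
          nlinarith [sq_nonneg σ, Real.exp_pos (3 * q)]
      _ = _ := by rw [hq3, hA]; ring
  have b2 : ∀ z : ℝ, |(1 + μ * v + σ * (s * z)) * Real.exp (-σ * (s * z) - ν * v) - 1| ≤
      (v * A) * Real.exp (3 * |σ| * |z|) := fun z => by
    obtain ⟨q, hq0, hq1, hq2, hq3⟩ := key z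
    set y := σ * (s * z) + ν * v with hy
    have e0 : -σ * (s * z) - ν * v = -y := by rw [hy]; ring
    -- In terms of the log-increment `y` the Euler factor is `1 + y + σ² v / 2`. What remains is `σ²
    -- v / 2` against the second-order remainder of `exp y`, so the product is of order `v`
    -- pointwise and its square of order `v²`.
    have e1 : (1 + μ * v + σ * (s * z)) * Real.exp (-y) - 1 =
        Real.exp (-y) * (σ ^ 2 / 2 * v - (Real.exp y - 1 - y)) := by
      have : Real.exp (-y) * Real.exp y = 1 := by rw [← Real.exp_add]; simp
      have e2 : 1 + μ * v + σ * (s * z) = 1 + y + σ ^ 2 / 2 * v := by rw [hy, hν]; ring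
      rw [e2]; linear_combination this
    rw [e0, e1, abs_mul, Real.abs_exp]
    calc _ ≤ Real.exp q * (σ ^ 2 / 2 * v + (s * q) ^ 2 * Real.exp q) := by
          gcongr ?_ * ?_
          · exact Real.exp_le_exp.2 ((neg_le_abs y).trans (hq1.trans hq2))
          · calc _ ≤ |σ ^ 2 / 2 * v| + |Real.exp y - 1 - y| := abs_sub _ _
              _ ≤ σ ^ 2 / 2 * v + (s * q) ^ 2 * Real.exp q := by
                rw [abs_of_nonneg (by positivity : 0 ≤ σ ^ 2 / 2 * (v : ℝ))]
                gcongr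
                refine (Real.abs_exp_sub_one_sub_le_sq_mul_exp_abs y).trans ?_
                rw [← sq_abs y]
                have := hq1.trans hq2
                gcongr
      _ = v * (σ ^ 2 / 2 * Real.exp q + q ^ 2 * Real.exp q * Real.exp q) := by
          rw [← hss]; ring
      _ ≤ v * (σ ^ 2 / 2 * Real.exp (3 * q) + 2 * Real.exp (3 * q)) := by
          have := hexp3 q hq0
          gcongr
          linarith
      _ = _ := by rw [hq3, hA]; ring
  obtain ⟨m1, n1⟩ := memLp_and_integral_sq_le_of_abs_le_exp
    (f := fun x : ℝ => Real.exp (-σ * x - ν * v) - 1) (by fun_prop) (v := v) b1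
  obtain ⟨m2, n2⟩ := memLp_and_integral_sq_le_of_abs_le_exp
    (f := fun x : ℝ => (1 + μ * v + σ * x) * Real.exp (-σ * x - ν * v) - 1) (by fun_prop)
    (v := v) b2
  have esub : ∀ x : ℝ, Real.exp (-σ * x - ν * v) = Real.exp (-ν * v) * Real.exp (-σ * x) :=
    fun x => by rw [← Real.exp_add]; ring_nf
  have i0 := integrable_exp_mul_gaussianReal (μ := 0) (v := v) (-σ)
  have i1 := integrable_mul_exp_gaussianReal (-σ) v
  set y := (σ ^ 2 - μ) * v with hy
  have hyw : |y| ≤ w * v := by rw [hy, abs_mul, abs_of_nonneg hv0]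
  have hyw' : |y| ≤ w := hyw.trans (mul_le_of_le_one_right hw0 hv1')
  have ey : Real.exp (-ν * v) * Real.exp (v * (-σ) ^ 2 / 2) = Real.exp y := by
    rw [← Real.exp_add, hy, hν]; ring_nf
  have M1 : ∫ x, (Real.exp (-σ * x - ν * v) - 1) ∂gaussianReal 0 v = Real.exp y - 1 := by
    simp_rw [esub]
    rw [integral_sub (i0.const_mul _) (integrable_const _), integral_const_mul,
      integral_gaussianReal_exp, ey]
    simp
  have M2 : ∫ x, ((1 + μ * v + σ * x) * Real.exp (-σ * x - ν * v) - 1) ∂gaussianReal 0 v =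
      Real.exp y * (1 - y) - 1 := by
    have e : ∀ x : ℝ, (1 + μ * v + σ * x) * Real.exp (-σ * x - ν * v) - 1 =
        (1 + μ * v) * Real.exp (-ν * v) * Real.exp (-σ * x) +
          σ * Real.exp (-ν * v) * (x * Real.exp (-σ * x)) - 1 := fun x => by rw [esub]; ring
    simp_rw [e]
    have i2 : Integrable (fun x : ℝ => (1 + μ * v) * Real.exp (-ν * v) * Real.exp (-σ * x) +
          σ * Real.exp (-ν * v) * (x * Real.exp (-σ * x))) (gaussianReal 0 v) :=
      (i0.const_mul _).add (i1.const_mul _)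
    rw [integral_sub i2 (integrable_const _),
      integral_add (i0.const_mul _) (i1.const_mul _), integral_const_mul, integral_const_mul,
      integral_gaussianReal_exp, integral_gaussianReal_mul_exp]
    simp only [integral_const, probReal_univ, smul_eq_mul, one_mul]
    rw [← ey, hy]; ring
  refine ⟨⟨m1, ?_, ?_⟩, m2, ?_, ?_⟩
  · rw [M1]
    calc _ ≤ (w * v) * Real.exp w := by
          refine (Real.abs_exp_sub_one_le_abs_mul_exp_abs _).trans ?_
          gcongr
      _ = w * Real.exp w * v := by ring
      _ ≤ _ := by
          gcongr
          have h1 : 0 ≤ A ^ 2 * J := by positivity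
          have h2 : 0 ≤ w ^ 2 * Real.exp (2 * w) := by positivity
          linarith
  · refine n1.trans ?_
    rw [mul_pow, hss]
    calc _ = A ^ 2 * J * v := by ring
      _ ≤ _ := by
          gcongr
          have h1 : 0 ≤ w * Real.exp w := by positivity
          have h2 : 0 ≤ w ^ 2 * Real.exp (2 * w) := by positivity
          linarith
  · rw [M2]
    -- The mean has no term of first order in `v`. This cancellation is the Itô correction and
    -- depends on the choice `ν = μ - σ² / 2`.
    have e : Real.exp y * (1 - y) - 1 = - (Real.exp y * (Real.exp (-y) - 1 - -y)) := by
      have : Real.exp y * Real.exp (-y) = 1 := by rw [← Real.exp_add]; simp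
      linear_combination this
    rw [e, abs_neg, abs_mul, Real.abs_exp]
    calc _ ≤ Real.exp w * ((w * v) ^ 2 * Real.exp w) := by
          gcongr ?_ * ?_
          · exact Real.exp_le_exp.2 ((le_abs_self y).trans hyw')
          · refine (Real.abs_exp_sub_one_sub_le_sq_mul_exp_abs _).trans ?_
            rw [← sq_abs, abs_neg]
            gcongr
      _ = w ^ 2 * Real.exp (2 * w) * v ^ 2 := by
          rw [show 2 * w = w + w by ring, Real.exp_add]; ring
      _ ≤ _ := by
          gcongr
          have h1 : 0 ≤ A ^ 2 * J := by positivity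
          have h2 : 0 ≤ w * Real.exp w := by positivity
          linarith
  · refine n2.trans ?_
    rw [mul_pow]
    calc _ = A ^ 2 * J * v ^ 2 := by ring
      _ ≤ _ := by
          gcongr
          have h1 : 0 ≤ w * Real.exp w := by positivity
          have h2 : 0 ≤ w ^ 2 * Real.exp (2 * w) := by positivity
          linarith

/-! ### Partitions and Itô sums. -/

/-- The points `s + k (t - s) / n` of the uniform partition of `[s, t]`. -/
noncomputable def unifGrid (s t : ℝ≥0) (n k : ℕ) : ℝ≥0 := s + (k : ℝ≥0) / n * (t - s)

theorem unifGrid_zero (s t : ℝ≥0) (n : ℕ) : unifGrid s t n 0 = s := by simp [unifGrid]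

theorem unifGrid_self {s t : ℝ≥0} (hst : s ≤ t) {n : ℕ} (hn : 0 < n) : unifGrid s t n n = t := by
  have : (n : ℝ≥0) ≠ 0 := by exact_mod_cast hn.ne'
  rw [unifGrid, div_self this, one_mul, add_tsub_cancel_of_le hst]

theorem monotone_unifGrid (s t : ℝ≥0) (n : ℕ) : Monotone (unifGrid s t n) := fun i j hij => by
  unfold unifGrid
  gcongr

theorem coe_unifGrid {s t : ℝ≥0} (hst : s ≤ t) (n k : ℕ) :
    (unifGrid s t n k : ℝ) = s + (k : ℝ) / n * ((t : ℝ) - s) := by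
  simp [unifGrid, NNReal.coe_sub hst]

theorem unifGrid_step {s t : ℝ≥0} (hst : s ≤ t) (n k : ℕ) :
    (unifGrid s t n (k + 1) : ℝ) - unifGrid s t n k = ((t : ℝ) - s) / n := by
  rw [coe_unifGrid hst, coe_unifGrid hst]; push_cast; ring

theorem exists_mesh_lt (a δ : ℝ) (hδ : 0 < δ) : ∃ N : ℕ, 0 < N ∧ ∀ n ≥ N, a / n < δ := by
  obtain ⟨N, hN⟩ := exists_nat_gt (a / δ)
  refine ⟨N + 1, by simp, fun n hn => ?_⟩
  have hn0 : (0 : ℝ) < n := by exact_mod_cast (Nat.succ_pos N).trans_le hn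
  have hN' : (N : ℝ) ≤ n := by exact_mod_cast (Nat.le_succ N).trans hn
  rw [div_lt_iff₀ hn0]
  rw [div_lt_iff₀ hδ] at hN
  nlinarith

/-- The partition that follows `p` for `n` steps and then `q`. -/
def joinPartition (n : ℕ) (p q : ℕ → ℝ≥0) (i : ℕ) : ℝ≥0 := if i < n then p i else q (i - n)

theorem monotone_joinPartition {n : ℕ} {p q : ℕ → ℝ≥0} (hp : Monotone p) (hq : Monotone q)
    (h : p n = q 0) : Monotone (joinPartition n p q) := by
  intro i j hij
  unfold joinPartition
  split_ifs with h1 h2 h2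
  · exact hp hij
  · exact (hp h1.le).trans (h.le.trans (hq (Nat.zero_le _)))
  · omega
  · exact hq (by omega)

theorem joinPartition_of_le {n i : ℕ} {p q : ℕ → ℝ≥0} (h : p n = q 0) (hi : i ≤ n) :
    joinPartition n p q i = p i := by
  unfold joinPartition
  split_ifs with h1
  · rfl
  · obtain rfl : i = n := by omega
    simp [h]

theorem joinPartition_add {n j : ℕ} {p q : ℕ → ℝ≥0} :
    joinPartition n p q (n + j) = q j := by
  simp [joinPartition]

theorem itoSum_joinPartition {Ω : Type*} (H W : ℝ≥0 → Ω → ℝ) {n m : ℕ} {p q : ℕ → ℝ≥0}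
    (h : p n = q 0) (ω : Ω) :
    itoSum H W (n + m) (joinPartition n p q) ω = itoSum H W n p ω + itoSum H W m q ω := by
  unfold itoSum
  rw [Finset.sum_range_add]
  congr 1
  · refine Finset.sum_congr rfl fun i hi => ?_
    have hi := Finset.mem_range.1 hi
    rw [joinPartition_of_le h hi.le, joinPartition_of_le h hi]
  · refine Finset.sum_congr rfl fun j _ => ?_
    rw [add_assoc, joinPartition_add, joinPartition_add]

theorem mesh_joinPartition {n m : ℕ} {p q : ℕ → ℝ≥0} {δ : ℝ} (h : p n = q 0)
    (hp : ∀ i < n, (p (i + 1) : ℝ) - p i < δ) (hq : ∀ i < m, (q (i + 1) : ℝ) - q i < δ) :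
    ∀ i < n + m, (joinPartition n p q (i + 1) : ℝ) - joinPartition n p q i < δ := by
  intro i hi
  rcases lt_or_ge i n with h1 | h1
  · rw [joinPartition_of_le h h1.le, joinPartition_of_le h h1]; exact hp i h1
  · obtain ⟨j, rfl⟩ := Nat.exists_eq_add_of_le h1
    rw [add_assoc, joinPartition_add, joinPartition_add]; exact hq j (by omega)

/-- A mesh that is fine enough for the Itô integral over `[0, t]` is fine enough for the Itô
integral over every `[0, s]` with `s ≤ t`. -/
theorem IsItoIntegral.mesh_uniform {Ω : Type*} {mΩ : MeasurableSpace Ω} {P : Measure Ω}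
    {H W : ℝ≥0 → Ω → ℝ} {s t : ℝ≥0} {Zs Zt : Ω → ℝ} (hst : s ≤ t)
    (hs : IsItoIntegral P H W s Zs) {ε δ : ℝ} (hε : 0 < ε) (hδ : 0 < δ)
    (ht : ∀ (n : ℕ) (p : ℕ → ℝ≥0), Monotone p → p 0 = 0 → p n = t →
      (∀ i < n, (p (i + 1) : ℝ) - (p i : ℝ) < δ) →
      P {ω | ε ≤ |itoSum H W n p ω - Zt ω|} ≤ ENNReal.ofReal ε)
    {n : ℕ} {p : ℕ → ℝ≥0} (hp : Monotone p) (hp0 : p 0 = 0) (hpn : p n = s)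
    (hmesh : ∀ i < n, (p (i + 1) : ℝ) - (p i : ℝ) < δ) :
    P {ω | 3 * ε ≤ |itoSum H W n p ω - Zs ω|} ≤ ENNReal.ofReal (3 * ε) := by
  obtain ⟨δ', hδ', hs⟩ := hs ε hε
  obtain ⟨m, hm0, hm⟩ := exists_mesh_lt ((t : ℝ) - s) δ hδ
  obtain ⟨l, hl0, hl⟩ := exists_mesh_lt ((s : ℝ) - (0 : ℝ≥0)) (min δ δ') (lt_min hδ hδ')
  -- Both the given partition `p` of `[0, s]` and a very fine one `p'` are continued by the same
  -- grid `q` of `[s, t]`. The two continued sums are close to `Zt`, the contribution of `q` cancels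
  -- in their difference, and the sum over `p'` is close to `Zs`. This costs three times `ε`.
  set q := unifGrid s t m
  set p' := unifGrid 0 s l
  have hq : ∀ i < m, (q (i + 1) : ℝ) - q i < δ := fun i _ => by
    rw [unifGrid_step hst]; exact hm m le_rfl
  have hp' : ∀ i < l, (p' (i + 1) : ℝ) - p' i < min δ δ' := fun i _ => by
    rw [unifGrid_step zero_le]; exact hl l le_rfl
  have e1 : p n = q 0 := by rw [hpn]; exact (unifGrid_zero _ _ _).symm
  have e3 : p' l = s := unifGrid_self zero_le hl0
  have e2 : p' l = q 0 := by rw [e3]; exact (unifGrid_zero _ _ _).symm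
  have hqm : q m = t := unifGrid_self hst hm0
  have j0 : ∀ {k : ℕ} {u : ℕ → ℝ≥0}, u k = q 0 → u 0 = 0 → joinPartition k u q 0 = 0 :=
    fun h h0 => by rw [joinPartition_of_le h (Nat.zero_le _), h0]
  have A := ht (n + m) (joinPartition n p q) (monotone_joinPartition hp (monotone_unifGrid _ _ _) e1)
    (j0 e1 hp0) (by rw [joinPartition_add, hqm]) (mesh_joinPartition e1 hmesh hq)
  have B := ht (l + m) (joinPartition l p' q)
    (monotone_joinPartition (monotone_unifGrid _ _ _) (monotone_unifGrid _ _ _) e2)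
    (j0 e2 (unifGrid_zero _ _ _)) (by rw [joinPartition_add, hqm])
    (mesh_joinPartition e2 (fun i hi => (hp' i hi).trans_le (min_le_left _ _)) hq)
  have C := hs l p' (monotone_unifGrid _ _ _) (unifGrid_zero _ _ _) e3
    (fun i hi => (hp' i hi).trans_le (min_le_right _ _))
  simp only [itoSum_joinPartition H W e1] at A
  simp only [itoSum_joinPartition H W e2] at B
  calc _ ≤ P ({ω | ε ≤ |itoSum H W n p ω + itoSum H W m q ω - Zt ω|} ∪
        {ω | ε ≤ |itoSum H W l p' ω + itoSum H W m q ω - Zt ω|} ∪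
        {ω | ε ≤ |itoSum H W l p' ω - Zs ω|}) := by
        refine measure_mono fun ω hω => ?_
        simp only [Set.mem_union, Set.mem_ofPred_eq] at hω ⊢
        by_contra! hc
        obtain ⟨⟨h1, h2⟩, h3⟩ := hc
        rw [abs_lt] at h1 h2 h3
        have : |itoSum H W n p ω - Zs ω| < 3 * ε := by
          rw [abs_lt]; constructor <;> linarith
        linarith
    _ ≤ ENNReal.ofReal ε + ENNReal.ofReal ε + ENNReal.ofReal ε :=
        (measure_union_le _ _).trans (add_le_add ((measure_union_le _ _).trans (add_le_add A B)) C)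
    _ = _ := by
        rw [← ENNReal.ofReal_add hε.le hε.le, ← ENNReal.ofReal_add (by positivity) hε.le]
        congr 1; ring

/-! ### The Euler defect of a solution tends to zero. -/

/-- Left-endpoint Riemann sums over uniform partitions converge, uniformly in the upper limit. -/
theorem riemannSum_unifGrid_tendsto {x : ℝ≥0 → ℝ} (hx : Continuous x) (t : ℝ≥0) {η : ℝ}
    (hη : 0 < η) :
    ∃ N : ℕ, ∀ n ≥ N, ∀ k ≤ n,
      |(∫ s in (0 : ℝ)..(unifGrid 0 t n k : ℝ), x s.toNNReal) -
        ∑ i ∈ Finset.range k, x (unifGrid 0 t n i) * ((t : ℝ) / n)| ≤ η := by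
  set f : ℝ → ℝ := fun s => x s.toNNReal with hf
  have hfc : Continuous f := hx.comp continuous_real_toNNReal
  have huc := (isCompact_Icc (a := (0 : ℝ)) (b := t)).uniformContinuousOn_of_continuous
    hfc.continuousOn
  have ht1 : (0 : ℝ) < t + 1 := by positivity
  -- Dividing by `t + 1` rather than by `t` covers `t = 0`.
  obtain ⟨δ, hδ, hδ'⟩ := Metric.uniformContinuousOn_iff.1 huc (η / (t + 1)) (by positivity)
  obtain ⟨N, hN0, hN⟩ := exists_mesh_lt t δ hδ
  refine ⟨N, fun n hn k hk => ?_⟩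
  have hn0 : 0 < n := hN0.trans_le hn
  have hn0' : (0 : ℝ) < n := by exact_mod_cast hn0
  set g : ℕ → ℝ := fun i => (unifGrid 0 t n i : ℝ) with hg
  have hstep : ∀ i, g (i + 1) - g i = (t : ℝ) / n := fun i => by
    have := unifGrid_step (zero_le (a := t)) n i
    simpa using this
  have hg0 : g 0 = 0 := by simp [hg, unifGrid_zero]
  have hgn : g n = t := by simp [hg, unifGrid_self (zero_le (a := t)) hn0]
  have hgm : Monotone g := fun i j hij => NNReal.coe_le_coe.2 (monotone_unifGrid 0 t n hij)
  have hsum := intervalIntegral.sum_integral_adjacent_intervals (a := g) (n := k) (f := f)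
    (μ := volume) fun i _ => hfc.intervalIntegrable _ _
  rw [hg0] at hsum
  show |(∫ s in (0 : ℝ)..g k, f s) - _| ≤ η
  rw [← hsum, ← Finset.sum_sub_distrib]
  have hterm : ∀ i ∈ Finset.range k, |(∫ s in g i..g (i + 1), f s) -
      x (unifGrid 0 t n i) * ((t : ℝ) / n)| ≤ η / (t + 1) * ((t : ℝ) / n) := fun i hi => by
    have hik : i < k := Finset.mem_range.1 hi
    have hle : g i ≤ g (i + 1) := hgm (Nat.le_succ i)
    have h0 : 0 ≤ g i := hg0 ▸ hgm (Nat.zero_le i)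
    have h1 : g (i + 1) ≤ t := hgn ▸ hgm (by omega)
    have e1 : x (unifGrid 0 t n i) * ((t : ℝ) / n) = ∫ s in g i..g (i + 1), f (g i) := by
      rw [intervalIntegral.integral_const, hstep, smul_eq_mul, mul_comm]
      simp [hf, hg]
    rw [e1, ← intervalIntegral.integral_sub (hfc.intervalIntegrable _ _)
      (continuous_const.intervalIntegrable _ _)]
    have := intervalIntegral.norm_integral_le_of_norm_le_const (a := g i) (b := g (i + 1))
      (f := fun s => f s - f (g i)) (C := η / (t + 1)) fun s hs => ?_
    · rwa [hstep, abs_of_nonneg (by positivity), Real.norm_eq_abs] at this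
    · rw [Set.uIoc_of_le hle] at hs
      rw [← dist_eq_norm]
      refine (hδ' s ⟨h0.trans hs.1.le, hs.2.trans h1⟩ (g i) ⟨h0, hle.trans h1⟩ ?_).le
      rw [Real.dist_eq, abs_of_nonneg (by linarith [hs.1])]
      have := hN n hn
      linarith [hs.2, hstep i]
  calc _ ≤ ∑ i ∈ Finset.range k, η / (t + 1) * ((t : ℝ) / n) :=
        (Finset.abs_sum_le_sum_abs _ _).trans (Finset.sum_le_sum hterm)
    _ = η / (t + 1) * ((k : ℝ) / n * t) := by simp; ring
    _ ≤ η / (t + 1) * (1 * t) := by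
        gcongr
        rw [div_le_one hn0']; exact_mod_cast hk
    _ ≤ η := by
        rw [div_mul_eq_mul_div, div_le_iff₀ ht1]; nlinarith [t.2]

/-- A process with almost surely continuous paths is almost surely equal to a measurable process
all of whose paths are continuous. -/
theorem exists_continuous_modification {Ω : Type*} {mΩ : MeasurableSpace Ω} {P : Measure Ω}
    {X : ℝ≥0 → Ω → ℝ} (hX : ∀ t, Measurable (X t)) (hc : ∀ᵐ ω ∂P, Continuous fun t => X t ω) :
    ∃ X' : ℝ≥0 → Ω → ℝ, (∀ t, Measurable (X' t)) ∧ (∀ ω, Continuous fun t => X' t ω) ∧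
      ∀ᵐ ω ∂P, ∀ t, X t ω = X' t ω := by
  obtain ⟨G, hG, hGm, hGc⟩ := hc.exists_measurable_mem
  refine ⟨fun t => G.indicator (X t), fun t => (hX t).indicator hGm, fun ω => ?_, ?_⟩
  · by_cases hω : ω ∈ G
    · simpa [hω] using hGc ω hω
    · simpa [hω] using continuous_const
  · filter_upwards [hG] with ω hω t
    simp [hω]

/-- The defect of a process in the Euler scheme of `dX = μ X dt + σ X dW` along the uniform
partition of `[0, t]`. -/
noncomputable def eulerDefect {Ω : Type*} (X W : ℝ≥0 → Ω → ℝ) (μ σ : ℝ) (t : ℝ≥0) (n k : ℕ)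
    (ω : Ω) : ℝ :=
  X (unifGrid 0 t n k) ω - X 0 ω - ∑ i ∈ Finset.range k, X (unifGrid 0 t n i) ω *
    (μ * (t / n) + σ * (W (unifGrid 0 t n (i + 1)) ω - W (unifGrid 0 t n i) ω))

/-- The defect is the error of a Riemann sum for the drift minus the error of an Itô sum. The
definition of the Itô integral allows a mesh depending on the upper limit;
`IsItoIntegral.mesh_uniform` is what makes a single `N` serve all grid times. -/
theorem IsGBMSolution.eulerDefect_small {Ω : Type*} {mΩ : MeasurableSpace Ω} {P : Measure Ω}
    [IsProbabilityMeasure P] {F : Filtration ℝ≥0 mΩ} {W X : ℝ≥0 → Ω → ℝ} {μ σ S : ℝ}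
    (h : IsGBMSolution P F W μ σ S X) (t : ℝ≥0) {ε : ℝ} (hε : 0 < ε) :
    ∃ N : ℕ, ∀ n ≥ N, ∀ k ≤ n,
      P {ω | ε ≤ |eulerDefect X W μ σ t n k ω|} ≤ ENNReal.ofReal ε := by
  obtain ⟨I, hI, hsde⟩ := h.sde
  -- `mesh_uniform` triples `ε / 6` to `ε / 2`; the drift takes the other half.
  obtain ⟨δ, hδ, hIt⟩ := hI t (ε / 6) (by positivity)
  obtain ⟨N₁, hN₁0, hN₁⟩ := exists_mesh_lt t δ hδ
  obtain ⟨X', hX'm, hX'c, hXX'⟩ := exists_continuous_modification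
    (fun t => (h.adapted t).mono (F.le t) le_rfl) h.cont
  set err : ℕ → ℕ → Ω → ℝ := fun n k ω => (∫ s in (0 : ℝ)..(unifGrid 0 t n k : ℝ),
    X' s.toNNReal ω) - ∑ i ∈ Finset.range k, X' (unifGrid 0 t n i) ω * ((t : ℝ) / n) with herr
  have herrm : ∀ n k, Measurable (err n k) := fun n k => by
    have hu : Measurable (Function.uncurry fun (ω : Ω) (s : ℝ) => X' s.toNNReal ω) := by
      have h1 : Measurable (Function.uncurry X') :=
        measurable_uncurry_of_continuous_of_measurable hX'c hX'm
      exact h1.comp ((measurable_real_toNNReal.comp measurable_snd).prodMk measurable_fst)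
    refine Measurable.sub ?_ ?_
    · simp_rw [intervalIntegral.integral_of_le (NNReal.coe_nonneg _)]
      exact hu.stronglyMeasurable.integral_prod_right'.measurable
    · exact Finset.measurable_fun_sum _ fun i _ => (hX'm _).mul_const _
  -- The maximum over all `k ≤ n` tends to zero on every path, hence in probability, so the drift
  -- error is small uniformly in `k`.
  set f : ℕ → Ω → ℝ := fun n ω => (Finset.range (n + 1)).sup' Finset.nonempty_range_add_one
    fun k => |err n k ω| with hf
  have hle : ∀ n ω k, k ≤ n → |err n k ω| ≤ f n ω := fun n ω k hk => by
    exact Finset.le_sup' (fun k => |err n k ω|) (Finset.mem_range.2 (Nat.lt_succ_of_le hk))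
  have hfm : ∀ n, Measurable (f n) := fun n =>
    Finset.measurable_range_sup'' fun k _ => measurable_norm.comp (herrm n k)
  have hf0 : ∀ n ω, 0 ≤ f n ω := fun n ω => (abs_nonneg _).trans (hle n ω 0 (Nat.zero_le _))
  have hft : TendstoInMeasure P f Filter.atTop 0 := by
    refine tendstoInMeasure_of_tendsto_ae (fun n => (hfm n).aestronglyMeasurable)
      (ae_of_all _ fun ω => ?_)
    rw [Metric.tendsto_atTop]
    intro η hη
    obtain ⟨N, hN⟩ := riemannSum_unifGrid_tendsto (hX'c ω) t (half_pos hη)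
    refine ⟨N, fun n hn => ?_⟩
    rw [Pi.zero_apply, Real.dist_eq, sub_zero, abs_of_nonneg (hf0 n ω)]
    refine lt_of_le_of_lt ?_ (half_lt_self hη)
    exact Finset.sup'_le _ _ fun k hk =>
      hN n hn k (Nat.lt_succ_iff.1 (Finset.mem_range.1 hk))
  have hμ1 : 0 < 2 * (|μ| + 1) := by positivity
  have hft' := tendstoInMeasure_iff_norm.1 hft (ε / (2 * (|μ| + 1))) (by positivity)
  obtain ⟨N₂, hN₂⟩ := Filter.eventually_atTop.1 (ENNReal.tendsto_atTop_zero.1 hft'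
    (ENNReal.ofReal (ε / 2)) (by simpa using hε) |> fun ⟨N, hN⟩ => Filter.eventually_atTop.2 ⟨N, hN⟩)
  refine ⟨max N₁ N₂, fun n hn k hk => ?_⟩
  have hnN₁ := (le_max_left _ _).trans hn
  have hn0 : 0 < n := hN₁0.trans_le hnN₁
  set s := unifGrid 0 t n k with hs
  have hst : s ≤ t := by
    have := monotone_unifGrid 0 t n hk
    rwa [unifGrid_self zero_le hn0] at this
  have hito := IsItoIntegral.mesh_uniform hst (hI s) (by positivity) hδ hIt
    (monotone_unifGrid 0 t n) (unifGrid_zero _ _ _) (n := k) rfl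
    (fun i _ => by rw [unifGrid_step zero_le]; simpa using hN₁ n hnN₁)
  have hdr := hN₂ n ((le_max_right _ _).trans hn)
  have hsub : {ω | ε ≤ |eulerDefect X W μ σ t n k ω|} ≤ᵐ[P]
      ({ω | 3 * (ε / 6) ≤ |itoSum (fun s ω => σ * X s ω) W k (unifGrid 0 t n) ω - I s ω|} ∪
        {ω | ε / (2 * (|μ| + 1)) ≤ ‖f n ω - (0 : Ω → ℝ) ω‖} : Set Ω) := by
    filter_upwards [hsde s, hXX'] with ω h1 h2 (h3 : ε ≤ |eulerDefect X W μ σ t n k ω|)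
    show _ ∨ _
    by_contra! hc
    obtain ⟨h4, h5⟩ := hc
    simp only [Set.mem_ofPred_eq, not_le, Pi.zero_apply, sub_zero, Real.norm_eq_abs,
      abs_of_nonneg (hf0 n ω)] at h4 h5
    have e : eulerDefect X W μ σ t n k ω = μ * err n k ω -
        (itoSum (fun s ω => σ * X s ω) W k (unifGrid 0 t n) ω - I s ω) := by
      have e1 : ∑ i ∈ Finset.range k, X (unifGrid 0 t n i) ω *
          (μ * (t / n) + σ * (W (unifGrid 0 t n (i + 1)) ω - W (unifGrid 0 t n i) ω)) =
          μ * ∑ i ∈ Finset.range k, X' (unifGrid 0 t n i) ω * ((t : ℝ) / n) +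
          itoSum (fun s ω => σ * X s ω) W k (unifGrid 0 t n) ω := by
        rw [itoSum, Finset.mul_sum, ← Finset.sum_add_distrib]
        refine Finset.sum_congr rfl fun i _ => ?_
        rw [← h2]; ring
      rw [eulerDefect, e1, ← hs, h1, herr, intervalIntegral.integral_const_mul]
      simp_rw [h2]
      ring
    have h6 : |μ * err n k ω| < ε / 2 := by
      rw [abs_mul]
      have := hle n ω k hk
      rw [lt_div_iff₀ hμ1] at h5
      have h7 := abs_nonneg μ
      nlinarith [abs_nonneg (err n k ω)]
    rw [e] at h3
    have := abs_sub (μ * err n k ω)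
      (itoSum (fun s ω => σ * X s ω) W k (unifGrid 0 t n) ω - I s ω)
    linarith
  calc _ ≤ _ := measure_mono_ae hsub
    _ ≤ ENNReal.ofReal (3 * (ε / 6)) + ENNReal.ofReal (ε / 2) :=
        (measure_union_le _ _).trans (add_le_add hito hdr)
    _ = _ := by
        rw [← ENNReal.ofReal_add (by positivity) (by positivity)]; congr 1; ring

/-! ### Path bounds, Brownian steps and the telescoping identity. -/

section Telescope

/-- For a process with continuous paths, exceeding a level on `[0, t]` is a countable union. -/
theorem measurableSet_exists_lt {Ω : Type*} {mΩ : MeasurableSpace Ω} {X : ℝ≥0 → Ω → ℝ}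
    (hX : ∀ t, Measurable (X t)) (hc : ∀ ω, Continuous fun t => X t ω) (t : ℝ≥0) (a : ℝ) :
    MeasurableSet {ω | ∃ s ≤ t, a < X s ω} := by
  have hne : Nonempty (Set.Icc (0 : ℝ≥0) t) := ⟨⟨0, by simp⟩⟩
  set d := TopologicalSpace.denseSeq (Set.Icc (0 : ℝ≥0) t)
  have : {ω | ∃ s ≤ t, a < X s ω} = ⋃ m, {ω | a < X (d m) ω} := by
    ext ω
    simp only [Set.mem_ofPred_eq, Set.mem_iUnion]
    constructor
    · rintro ⟨s, hs, hsa⟩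
      have ho : IsOpen {u : Set.Icc (0 : ℝ≥0) t | a < X u ω} :=
        isOpen_lt continuous_const ((hc ω).comp continuous_subtype_val)
      obtain ⟨m, hm⟩ := (TopologicalSpace.denseRange_denseSeq _).exists_mem_open ho
        ⟨⟨s, by simp [hs]⟩, hsa⟩
      exact ⟨m, hm⟩
    · rintro ⟨m, hm⟩
      exact ⟨d m, (d m).2.2, hm⟩
  rw [this]
  exact MeasurableSet.iUnion fun m => measurableSet_lt measurable_const (hX _)

/-- A process with continuous paths is bounded on `[0, t]` up to a small probability. -/
theorem exists_bound_of_continuous_paths {Ω : Type*} {mΩ : MeasurableSpace Ω} {P : Measure Ω}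
    [IsProbabilityMeasure P] {X : ℝ≥0 → Ω → ℝ} (hX : ∀ t, Measurable (X t))
    (hc : ∀ᵐ ω ∂P, Continuous fun t => X t ω) (t : ℝ≥0) {ε : ℝ} (hε : 0 < ε) :
    ∃ N₀ : ℕ, ∀ N : ℝ, N₀ ≤ N → P.real {ω | ∃ s ≤ t, N < |X s ω|} ≤ ε := by
  obtain ⟨X', hX'm, hX'c, hXX'⟩ := exists_continuous_modification hX hc
  set R : ℕ → Set Ω := fun N => {ω | ∃ s ≤ t, (N : ℝ) < |X' s ω|} with hR
  have hRm : ∀ N, MeasurableSet (R N) := fun N =>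
    measurableSet_exists_lt (X := fun s ω => |X' s ω|) (fun s => measurable_norm.comp (hX'm s))
      (fun ω => (hX'c ω).abs) t N
  have hanti : Antitone R := fun i j hij ω ⟨s, hs, hlt⟩ =>
    ⟨s, hs, lt_of_le_of_lt (by exact_mod_cast hij) hlt⟩
  have hempty : ⋂ N, R N = ∅ := by
    ext ω
    simp only [Set.mem_iInter, Set.mem_empty_iff_false, iff_false, not_forall]
    obtain ⟨b, hb⟩ := (isCompact_Icc (a := (0 : ℝ≥0)) (b := t)).exists_bound_of_continuousOn
      (hX'c ω).continuousOn
    obtain ⟨N, hN⟩ := exists_nat_ge b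
    refine ⟨N, fun ⟨s, hs, hlt⟩ => ?_⟩
    have := hb s ⟨zero_le, hs⟩
    rw [Real.norm_eq_abs] at this
    linarith
  have hlim := tendsto_measure_iInter_atTop (μ := P) (fun N => (hRm N).nullMeasurableSet) hanti
    ⟨0, measure_ne_top _ _⟩
  rw [hempty, measure_empty] at hlim
  obtain ⟨N₀, hN₀⟩ := ENNReal.tendsto_atTop_zero.1 hlim (ENNReal.ofReal ε) (by simpa using hε)
  refine ⟨N₀, fun N hN => ?_⟩
  refine ENNReal.toReal_le_of_le_ofReal hε.le (le_trans (measure_mono_ae ?_) (hN₀ N₀ le_rfl))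
  filter_upwards [hXX'] with ω hω hωN
  obtain ⟨s, hs, hlt⟩ := hωN
  exact ⟨s, hs, by rw [← hω s]; exact hN.trans_lt hlt⟩

namespace IsBrownianWithFiltration

variable {Ω : Type*} {mΩ : MeasurableSpace Ω} {P : Measure Ω} {F : Filtration ℝ≥0 mΩ}
  {W : ℝ≥0 → Ω → ℝ}

theorem measurable (hW : IsBrownianWithFiltration F W P) (t : ℝ≥0) : Measurable (W t) :=
  (hW.adapted t).mono (F.le t) le_rfl

theorem hasLaw_step (hW : IsBrownianWithFiltration F W P) (t : ℝ≥0) (n k : ℕ) :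
    HasLaw (fun ω => W (unifGrid 0 t n (k + 1)) ω - W (unifGrid 0 t n k) ω)
      (gaussianReal 0 (t / n)) P := by
  have h := hW.isBrownian.hasLaw_sub (unifGrid 0 t n (k + 1)) (unifGrid 0 t n k)
  have e : nndist (unifGrid 0 t n (k + 1)).1 (unifGrid 0 t n k).1 = t / n := by
    ext
    have := unifGrid_step (zero_le (a := t)) n k
    rw [coe_nndist, Real.dist_eq, abs_of_nonneg]
    · simpa using this
    · exact sub_nonneg.2 (NNReal.coe_le_coe.2 (monotone_unifGrid 0 t n (Nat.le_succ k)))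
  rwa [e] at h

theorem isMartingaleTransform (hW : IsBrownianWithFiltration F W P) {t : ℝ≥0} {n : ℕ}
    {G : ℕ → Ω → ℝ} {c : ℝ} (hG : ∀ k, Measurable[F (unifGrid 0 t n k)] (G k))
    (hc : ∀ k ω, |G k ω| ≤ c) {φ : ℝ → ℝ} (hφ : Measurable φ)
    (hφ2 : MemLp φ 2 (gaussianReal 0 (t / n))) :
    IsMartingaleTransform P (fun k => F (unifGrid 0 t n k)) G
      (fun k ω => φ (W (unifGrid 0 t n (k + 1)) ω - W (unifGrid 0 t n k) ω)) c where
  mono i j hij := F.mono (monotone_unifGrid 0 t n hij)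
  le i := F.le _
  meas := hG
  bdd := hc
  noise_meas i := hφ.comp ((hW.adapted _).sub
    ((hW.adapted _).mono (F.mono (monotone_unifGrid 0 t n (Nat.le_succ i))) le_rfl))
  noise_memLp i := by
    have h := hW.hasLaw_step t n i
    rw [← h.map_eq] at hφ2
    exact hφ2.comp_of_map h.aemeasurable
  noise_indep i := by
    refine indep_of_indep_of_le_left (hW.indep_increments _ _
      (monotone_unifGrid 0 t n (Nat.le_succ i))) ?_
    have : (fun ω => φ (W (unifGrid 0 t n (i + 1)) ω - W (unifGrid 0 t n i) ω)) =
      φ ∘ (fun ω => W (unifGrid 0 t n (i + 1)) ω - W (unifGrid 0 t n i) ω) := rfl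
    rw [this, ← MeasurableSpace.comap_comp]
    exact MeasurableSpace.comap_mono hφ.comap_le

theorem integral_step (hW : IsBrownianWithFiltration F W P) (t : ℝ≥0) (n k : ℕ) {φ : ℝ → ℝ}
    (hφ : Measurable φ) :
    ∫ ω, φ (W (unifGrid 0 t n (k + 1)) ω - W (unifGrid 0 t n k) ω) ∂P =
      ∫ x, φ x ∂gaussianReal 0 (t / n) :=
  (hW.hasLaw_step t n k).integral_comp hφ.aestronglyMeasurable

end IsBrownianWithFiltration

theorem eulerDefect_zero {Ω : Type*} (X W : ℝ≥0 → Ω → ℝ) (μ σ : ℝ) (t : ℝ≥0) (n : ℕ) (ω : Ω) :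
    eulerDefect X W μ σ t n 0 ω = 0 := by
  simp [eulerDefect, unifGrid_zero]

theorem measurable_eulerDefect {Ω : Type*} {mΩ : MeasurableSpace Ω} {F : Filtration ℝ≥0 mΩ}
    {X W : ℝ≥0 → Ω → ℝ} (hX : ∀ t, Measurable[F t] (X t)) (hW : ∀ t, Measurable[F t] (W t))
    (μ σ : ℝ) (t : ℝ≥0) (n k : ℕ) :
    Measurable[F (unifGrid 0 t n k)] (eulerDefect X W μ σ t n k) := by
  have hX' : ∀ i ≤ k, Measurable[F (unifGrid 0 t n k)] (X (unifGrid 0 t n i)) := fun i hi =>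
    (hX _).mono (F.mono (monotone_unifGrid 0 t n hi)) le_rfl
  have hW' : ∀ i ≤ k, Measurable[F (unifGrid 0 t n k)] (W (unifGrid 0 t n i)) := fun i hi =>
    (hW _).mono (F.mono (monotone_unifGrid 0 t n hi)) le_rfl
  have h0 := hX' 0 (Nat.zero_le k)
  rw [unifGrid_zero] at h0
  refine ((hX' k le_rfl).sub h0).sub (Finset.measurable_fun_sum _ fun i hi => ?_)
  have hi := Finset.mem_range.1 hi
  exact (hX' i hi.le).mul ((((hW' _ hi).sub (hW' i hi.le)).const_mul σ).const_add _)

/-- The product of the solution, corrected by the Euler defect, with the inverse geometric Brownian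
motion telescopes. -/
theorem eulerDefect_telescope {Ω : Type*} (X W : ℝ≥0 → Ω → ℝ) (μ σ : ℝ) (t : ℝ≥0) (n : ℕ) (ω : Ω) :
    (X (unifGrid 0 t n n) ω - eulerDefect X W μ σ t n n ω) *
        Real.exp (-σ * W (unifGrid 0 t n n) ω - (μ - σ ^ 2 / 2) * unifGrid 0 t n n) =
      X 0 ω * Real.exp (-σ * W 0 ω) +
      ∑ k ∈ Finset.range n, X (unifGrid 0 t n k) ω *
        Real.exp (-σ * W (unifGrid 0 t n k) ω - (μ - σ ^ 2 / 2) * unifGrid 0 t n k) *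
        ((1 + μ * (t / n : ℝ≥0) + σ * (W (unifGrid 0 t n (k + 1)) ω - W (unifGrid 0 t n k) ω)) *
          Real.exp (-σ * (W (unifGrid 0 t n (k + 1)) ω - W (unifGrid 0 t n k) ω) -
            (μ - σ ^ 2 / 2) * (t / n : ℝ≥0)) - 1) -
      ∑ k ∈ Finset.range n, eulerDefect X W μ σ t n k ω *
        Real.exp (-σ * W (unifGrid 0 t n k) ω - (μ - σ ^ 2 / 2) * unifGrid 0 t n k) *
        (Real.exp (-σ * (W (unifGrid 0 t n (k + 1)) ω - W (unifGrid 0 t n k) ω) -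
            (μ - σ ^ 2 / 2) * (t / n : ℝ≥0)) - 1) := by
  -- Without its defect, `X` satisfies an exact recursion whose increment still carries the factor
  -- `X` itself, not `X` minus the defect. This mismatch produces the second sum.
  set Q : ℕ → ℝ := fun k => (X (unifGrid 0 t n k) ω - eulerDefect X W μ σ t n k ω) *
    Real.exp (-σ * W (unifGrid 0 t n k) ω - (μ - σ ^ 2 / 2) * unifGrid 0 t n k) with hQ
  have h0 : Q 0 = X 0 ω * Real.exp (-σ * W 0 ω) := by
    simp [hQ, eulerDefect_zero, unifGrid_zero]
  rw [add_sub_assoc, ← Finset.sum_sub_distrib]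
  show Q n = _
  rw [← h0, ← sub_eq_iff_eq_add', ← Finset.sum_range_sub]
  refine Finset.sum_congr rfl fun k _ => ?_
  have hstep := unifGrid_step (zero_le (a := t)) n k
  have e1 : Real.exp (-σ * W (unifGrid 0 t n (k + 1)) ω -
      (μ - σ ^ 2 / 2) * unifGrid 0 t n (k + 1)) =
      Real.exp (-σ * W (unifGrid 0 t n k) ω - (μ - σ ^ 2 / 2) * unifGrid 0 t n k) *
      Real.exp (-σ * (W (unifGrid 0 t n (k + 1)) ω - W (unifGrid 0 t n k) ω) -
            (μ - σ ^ 2 / 2) * (t / n : ℝ≥0)) := by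
    rw [← Real.exp_add]
    congr 1
    push_cast at hstep ⊢
    linear_combination -(μ - σ ^ 2 / 2) * hstep
  have e2 : X (unifGrid 0 t n (k + 1)) ω - eulerDefect X W μ σ t n (k + 1) ω =
      X (unifGrid 0 t n k) ω - eulerDefect X W μ σ t n k ω + X (unifGrid 0 t n k) ω *
    (μ * (t / n) + σ * (W (unifGrid 0 t n (k + 1)) ω - W (unifGrid 0 t n k) ω)) := by
    simp only [eulerDefect]
    rw [Finset.sum_range_succ]; ring
  simp only [hQ]
  rw [e1, e2]
  push_cast
  ring

end Telescope

/-! ### Localisation and second moments of the telescoped sums. -/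

section Moderate

/-- The paths along the grid stay moderate: the solution, the Brownian motion and the Euler defect
have been bounded up to step `k`. -/
def moderateSet {Ω : Type*} (X W : ℝ≥0 → Ω → ℝ) (μ σ : ℝ) (t : ℝ≥0) (N K : ℝ) (n k : ℕ) : Set Ω :=
  {ω | k ≤ n ∧ ∀ i ≤ k, |X (unifGrid 0 t n i) ω| ≤ N ∧ |W (unifGrid 0 t n i) ω| ≤ N ∧
    |eulerDefect X W μ σ t n i ω| ≤ K}

theorem measurableSet_moderateSet {Ω : Type*} {mΩ : MeasurableSpace Ω} {F : Filtration ℝ≥0 mΩ}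
    {X W : ℝ≥0 → Ω → ℝ} (hX : ∀ t, Measurable[F t] (X t)) (hW : ∀ t, Measurable[F t] (W t))
    (μ σ : ℝ) (t : ℝ≥0) (N K : ℝ) (n k : ℕ) :
    MeasurableSet[F (unifGrid 0 t n k)] (moderateSet X W μ σ t N K n k) := by
  have hm : ∀ {f : Ω → ℝ} {m : MeasurableSpace Ω} (a : ℝ), Measurable[m] f →
      MeasurableSet[m] {ω | |f ω| ≤ a} := fun a hf =>
    (measurable_norm.comp hf) measurableSet_Iic
  have : moderateSet X W μ σ t N K n k = {_ω | k ≤ n} ∩ ⋂ i, ⋂ (_ : i ≤ k),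
      ({ω | |X (unifGrid 0 t n i) ω| ≤ N} ∩ ({ω | |W (unifGrid 0 t n i) ω| ≤ N} ∩
        {ω | |eulerDefect X W μ σ t n i ω| ≤ K})) := by
    ext; simp [moderateSet]
  rw [this]
  refine MeasurableSet.inter (MeasurableSet.const _) (MeasurableSet.iInter fun i =>
    MeasurableSet.iInter fun hi => ?_)
  have hF := F.mono (monotone_unifGrid 0 t n hi)
  exact (hm N ((hX _).mono hF le_rfl)).inter ((hm N ((hW _).mono hF le_rfl)).inter
    (hm K ((measurable_eulerDefect hX hW μ σ t n i).mono hF le_rfl)))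

namespace IsGBMSolution

variable {Ω : Type*} {mΩ : MeasurableSpace Ω} {P : Measure Ω}
  {F : Filtration ℝ≥0 mΩ} {W X : ℝ≥0 → Ω → ℝ} {μ σ S : ℝ}

theorem measurable (h : IsGBMSolution P F W μ σ S X) (t : ℝ≥0) : Measurable (X t) :=
  (h.adapted t).mono (F.le t) le_rfl

theorem abs_exp_le_of_mem_moderateSet {t : ℝ≥0} {N K : ℝ} {n k : ℕ} (hn : 0 < n) {ω : Ω}
    (hω : ω ∈ moderateSet X W μ σ t N K n k) (ν : ℝ) :
    Real.exp (-σ * W (unifGrid 0 t n k) ω - ν * unifGrid 0 t n k) ≤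
      Real.exp (|σ| * N + |ν| * t) := by
  have h1 := (hω.2 k le_rfl).2.1
  have h2 : (unifGrid 0 t n k : ℝ) ≤ t := by
    have := monotone_unifGrid 0 t n hω.1
    rw [unifGrid_self zero_le hn] at this
    exact_mod_cast this
  refine Real.exp_le_exp.2 ?_
  calc _ ≤ |(-σ * W (unifGrid 0 t n k) ω)| + |ν * unifGrid 0 t n k| :=
        (le_abs_self _).trans (abs_sub _ _)
    _ ≤ _ := by
        rw [abs_mul, abs_mul, abs_neg, NNReal.abs_eq]
        gcongr

variable [IsProbabilityMeasure P]

/-- While `X` stays below `N` in absolute value, the terms `X - X 0` contribute at most `2 N` to the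
defect and the drift sum at most `|μ| N t`. The rest is a stochastic integral with bounded
coefficients, kept below `K₁` at all steps at once by the maximal inequality. Neither the bound on
the defect nor the probability depends on `n`. -/
theorem measure_compl_moderateSet_le (h : IsGBMSolution P F W μ σ S X) (t : ℝ≥0) {ε N K₁ : ℝ}
    (hK₁ : 0 < K₁) (hNX : P.real {ω | ∃ s ≤ t, N < |X s ω|} ≤ ε)
    (hNW : P.real {ω | ∃ s ≤ t, N < |W s ω|} ≤ ε) (hN : 0 ≤ N)
    (hK : (|σ| * N) ^ 2 * t / K₁ ^ 2 ≤ ε) {n : ℕ} (hn : 0 < n) :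
    P.real (moderateSet X W μ σ t N (K₁ + 2 * N + |μ| * N * t) n n)ᶜ ≤ 3 * ε := by
  have hn' : (0 : ℝ) < n := by exact_mod_cast hn
  set p := unifGrid 0 t n with hp
  have hpt : ∀ i ≤ n, p i ≤ t := fun i hi => by
    have := monotone_unifGrid 0 t n hi
    rwa [unifGrid_self zero_le hn] at this
  -- The truncated coefficient is bounded, as the maximal inequality requires, and equals `σ X` on
  -- the event considered.
  set G : ℕ → Ω → ℝ := fun k => {ω | |X (p k) ω| ≤ N}.indicator fun ω => σ * X (p k) ω with hG
  have hm : ∀ k, MeasurableSet[F (p k)] {ω | |X (p k) ω| ≤ N} := fun k =>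
    (measurable_norm.comp (h.adapted _)) measurableSet_Iic
  have htr := h.brownian.isMartingaleTransform (t := t) (n := n) (G := G) (c := |σ| * N)
    (fun k => ((h.adapted _).const_mul σ).indicator (hm k)) (fun k ω => by
      by_cases hω : |X (p k) ω| ≤ N
      · rw [hG]
        simp only [Set.indicator, Set.mem_ofPred_eq, hω, if_true]
        rw [abs_mul]; gcongr
      · rw [hG]
        simp only [Set.indicator, Set.mem_ofPred_eq, hω, if_false, abs_zero]
        positivity) (φ := fun x => x) measurable_id
    (by simpa using memLp_id_gaussianReal 2 : MemLp id 2 (gaussianReal 0 (t / n)))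
  have hmean : ∀ i, ∫ ω, (W (unifGrid 0 t n (i + 1)) ω - W (unifGrid 0 t n i) ω) ∂P = 0 :=
    fun i => by
      rw [h.brownian.integral_step t n i (φ := fun x => x) measurable_id]
      exact integral_id_gaussianReal
  have hvar : ∀ i, ∫ ω, (W (unifGrid 0 t n (i + 1)) ω - W (unifGrid 0 t n i) ω) ^ 2 ∂P ≤ t / n :=
    fun i => by
      rw [h.brownian.integral_step t n i (φ := fun x => x ^ 2) (by fun_prop)]
      have h1 := variance_id_gaussianReal (μ := 0) (v := t / n)
      rw [variance_eq_integral (by fun_prop)] at h1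
      simp only [id, integral_id_gaussianReal, sub_zero] at h1
      rw [h1]; simp
  have hmax := htr.measure_exists_sum_gt_le hmean hvar hK₁ n
  have hmax' : (n : ℝ) * ((|σ| * N) ^ 2 * (t / n)) / K₁ ^ 2 ≤ ε := by
    refine le_trans (le_of_eq ?_) hK
    field_simp
  calc _ ≤ P.real ({ω | ∃ s ≤ t, N < |X s ω|} ∪ {ω | ∃ s ≤ t, N < |W s ω|} ∪
        {ω | ∃ i ≤ n, K₁ < |∑ j ∈ Finset.range i, G j ω *
          (W (unifGrid 0 t n (j + 1)) ω - W (unifGrid 0 t n j) ω)|}) := by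
        refine measureReal_mono fun ω hω => ?_
        by_contra hc
        simp only [Set.mem_union, Set.mem_ofPred_eq, not_or, not_exists, not_and, not_lt] at hc
        obtain ⟨⟨hcX, hcW⟩, hcM⟩ := hc
        refine hω ⟨le_rfl, fun i hi => ⟨hcX _ (hpt i hi), hcW _ (hpt i hi), ?_⟩⟩
        have hxi := hcX _ (hpt i hi)
        have hx0 := hcX 0 zero_le
        have hsum : ∑ j ∈ Finset.range i, X (unifGrid 0 t n j) ω *
            (μ * (t / n) + σ * (W (unifGrid 0 t n (j + 1)) ω - W (unifGrid 0 t n j) ω)) =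
            ∑ j ∈ Finset.range i, X (p j) ω * (μ * (t / n)) +
            ∑ j ∈ Finset.range i, G j ω *
              (W (unifGrid 0 t n (j + 1)) ω - W (unifGrid 0 t n j) ω) := by
          rw [← Finset.sum_add_distrib]
          refine Finset.sum_congr rfl fun j hj => ?_
          have hj := Finset.mem_range.1 hj
          have := hcX _ (hpt j (by omega))
          simp only [hG, Set.indicator, Set.mem_ofPred_eq, this, if_true]
          rw [← hp]; ring
        have hd : |∑ j ∈ Finset.range i, X (p j) ω * (μ * (t / n))| ≤ |μ| * N * t := by
          calc _ ≤ ∑ j ∈ Finset.range i, N * (|μ| * (t / n)) := by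
                refine (Finset.abs_sum_le_sum_abs _ _).trans (Finset.sum_le_sum fun j hj => ?_)
                have hj := Finset.mem_range.1 hj
                rw [abs_mul, abs_mul μ, abs_of_nonneg (by positivity : 0 ≤ (t : ℝ) / n)]
                gcongr
                exact hcX _ (hpt j (by omega))
            _ = (i : ℝ) / n * (|μ| * N * t) := by simp; ring
            _ ≤ 1 * (|μ| * N * t) := by
                gcongr
                rw [div_le_one hn']; exact_mod_cast hi
            _ = _ := one_mul _
        have hM := hcM i hi
        rw [eulerDefect, hsum]
        rw [abs_le] at *
        constructor <;> linarith
    _ ≤ ε + ε + ε := by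
        refine (measureReal_union_le _ _).trans (add_le_add ((measureReal_union_le _ _).trans
          (add_le_add hNX hNW)) (hmax.trans hmax'))
    _ = _ := by ring

/-- Second moment of the stochastic sum driven by the solution itself. -/
theorem integral_sq_solution_sum_le (h : IsGBMSolution P F W μ σ S X) {c : ℝ}
    (t : ℝ≥0) {N K : ℝ} (hN : 0 ≤ N) {n : ℕ} (hn : 0 < n) {φ : ℝ → ℝ} (hφ : Measurable φ)
    (hφ2 : MemLp φ 2 (gaussianReal 0 (t / n)))
    (hm : |∫ x, φ x ∂gaussianReal 0 (t / n)| ≤ c * ((t / n : ℝ≥0) : ℝ) ^ 2)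
    (hv : ∫ x, φ x ^ 2 ∂gaussianReal 0 (t / n) ≤ c * ((t / n : ℝ≥0) : ℝ) ^ 2) (ν : ℝ) :
    MemLp (fun ω => ∑ k ∈ Finset.range n, (moderateSet X W μ σ t N K n k).indicator (fun ω =>
        X (unifGrid 0 t n k) ω *
          Real.exp (-σ * W (unifGrid 0 t n k) ω - ν * unifGrid 0 t n k)) ω *
        φ (W (unifGrid 0 t n (k + 1)) ω - W (unifGrid 0 t n k) ω)) 2 P ∧
    ∫ ω, (∑ k ∈ Finset.range n, (moderateSet X W μ σ t N K n k).indicator (fun ω =>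
        X (unifGrid 0 t n k) ω *
          Real.exp (-σ * W (unifGrid 0 t n k) ω - ν * unifGrid 0 t n k)) ω *
        φ (W (unifGrid 0 t n (k + 1)) ω - W (unifGrid 0 t n k) ω)) ^ 2 ∂P ≤
      2 * (N * Real.exp (|σ| * N + |ν| * t)) ^ 2 * (c * t ^ 2 + c ^ 2 * t ^ 4) / n := by
  have hn' : (1 : ℝ) ≤ n := by exact_mod_cast hn
  set M := N * Real.exp (|σ| * N + |ν| * t) with hM
  have hM0 : 0 ≤ M := by positivity
  set G : ℕ → Ω → ℝ := fun k => (moderateSet X W μ σ t N K n k).indicator (fun ω =>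
        X (unifGrid 0 t n k) ω *
          Real.exp (-σ * W (unifGrid 0 t n k) ω - ν * unifGrid 0 t n k)) with hG
  -- For `k > n` the moderate set is empty, so the bound holds at every index, as a martingale
  -- transform demands.
  have hGb : ∀ k ω, |G k ω| ≤ M := fun k ω => by
    by_cases hω : ω ∈ moderateSet X W μ σ t N K n k
    · simp only [hG, hω, Set.indicator_of_mem, abs_mul, Real.abs_exp]
      have := (hω.2 k le_rfl).1
      have h2 := abs_exp_le_of_mem_moderateSet hn hω ν
      rw [hM]
      gcongr
    · simpa only [hG, hω, not_false_eq_true, Set.indicator_of_notMem, abs_zero] using hM0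
  have htr := h.brownian.isMartingaleTransform (t := t) (n := n) (G := G) (c := M)
    (fun k => Measurable.indicator ((h.adapted _).mul (Real.measurable_exp.comp
      (((h.brownian.adapted _).const_mul _).sub_const _)))
      (measurableSet_moderateSet h.adapted h.brownian.adapted μ σ t N K n k)) hGb hφ hφ2
  refine ⟨htr.memLp_sum n, ?_⟩
  -- Moments of order `(t / n)²` give `n v` of order `1 / n` and `n² m²` of order `1 / n²`: the sum
  -- vanishes as the grid is refined.
  have key := htr.integral_sum_sq_le (γ := M ^ 2) (m := c * ((t / n : ℝ≥0) : ℝ) ^ 2)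
    (v := c * ((t / n : ℝ≥0) : ℝ) ^ 2) n (fun i _ => by
      calc _ ≤ ∫ ω, M ^ 2 ∂P := by
            refine integral_mono (htr.memLp_coeff i 2).integrable_sq (integrable_const _)
              fun ω => ?_
            simp only
            rw [← sq_abs]
            exact pow_le_pow_left₀ (abs_nonneg _) (hGb i ω) 2
        _ = _ := by simp) (sq_nonneg _)
    (fun i => by rw [h.brownian.integral_step t n i hφ]; exact hm)
    (fun i => by rw [h.brownian.integral_step t n i (φ := fun x => φ x ^ 2) (hφ.pow_const 2)]
                 exact hv)
  refine key.trans ?_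
  rw [mul_div_assoc]
  refine mul_le_mul_of_nonneg_left ?_ (by positivity)
  push_cast
  rw [add_div]
  refine add_le_add (le_of_eq ?_) ?_
  · field_simp
  · have e : (n : ℝ) ^ 2 * (c * ((t : ℝ) / n) ^ 2) ^ 2 = c ^ 2 * t ^ 4 / n ^ 2 := by field_simp
    rw [e]
    gcongr
    nlinarith

/-- Second moment of the stochastic sum driven by the Euler defect. -/
theorem integral_sq_defect_sum_le (h : IsGBMSolution P F W μ σ S X) {c : ℝ}
    (t : ℝ≥0) {N K ε : ℝ} (hK : 0 ≤ K) (hε : 0 ≤ ε) {n : ℕ} (hn : 0 < n)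
    (hsmall : ∀ k ≤ n, P.real {ω | ε ≤ |eulerDefect X W μ σ t n k ω|} ≤ ε)
    {φ : ℝ → ℝ} (hφ : Measurable φ)
    (hφ2 : MemLp φ 2 (gaussianReal 0 (t / n)))
    (hm : |∫ x, φ x ∂gaussianReal 0 (t / n)| ≤ c * ((t / n : ℝ≥0) : ℝ))
    (hv : ∫ x, φ x ^ 2 ∂gaussianReal 0 (t / n) ≤ c * ((t / n : ℝ≥0) : ℝ)) (ν : ℝ) :
    MemLp (fun ω => ∑ k ∈ Finset.range n, (moderateSet X W μ σ t N K n k).indicator (fun ω =>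
        eulerDefect X W μ σ t n k ω *
          Real.exp (-σ * W (unifGrid 0 t n k) ω - ν * unifGrid 0 t n k)) ω *
        φ (W (unifGrid 0 t n (k + 1)) ω - W (unifGrid 0 t n k) ω)) 2 P ∧
    ∫ ω, (∑ k ∈ Finset.range n, (moderateSet X W μ σ t N K n k).indicator (fun ω =>
        eulerDefect X W μ σ t n k ω *
          Real.exp (-σ * W (unifGrid 0 t n k) ω - ν * unifGrid 0 t n k)) ω *
        φ (W (unifGrid 0 t n (k + 1)) ω - W (unifGrid 0 t n k) ω)) ^ 2 ∂P ≤
      2 * (Real.exp (|σ| * N + |ν| * t) ^ 2 * (ε ^ 2 + K ^ 2 * ε)) * (c * t + c ^ 2 * t ^ 2) := by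
  have hn' : (1 : ℝ) ≤ n := by exact_mod_cast hn
  set M := Real.exp (|σ| * N + |ν| * t) with hM
  have hM0 : 0 ≤ M := by positivity
  set G : ℕ → Ω → ℝ := fun k => (moderateSet X W μ σ t N K n k).indicator (fun ω =>
        eulerDefect X W μ σ t n k ω *
          Real.exp (-σ * W (unifGrid 0 t n k) ω - ν * unifGrid 0 t n k)) with hG
  have hGb' : ∀ k ω, |G k ω| ≤ (moderateSet X W μ σ t N K n k).indicator
      (fun ω => |eulerDefect X W μ σ t n k ω| * M) ω := fun k ω => by
    by_cases hω : ω ∈ moderateSet X W μ σ t N K n k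
    · simp only [hG, hω, Set.indicator_of_mem, abs_mul, Real.abs_exp]
      have h2 := abs_exp_le_of_mem_moderateSet hn hω ν
      gcongr
    · simp only [hG, hω, not_false_eq_true, Set.indicator_of_notMem, abs_zero, le_refl]
  have hGb : ∀ k ω, |G k ω| ≤ K * M := fun k ω => by
    refine (hGb' k ω).trans ?_
    by_cases hω : ω ∈ moderateSet X W μ σ t N K n k
    · simp only [hω, Set.indicator_of_mem]
      have := (hω.2 k le_rfl).2.2
      gcongr
    · simp only [hω, not_false_eq_true, Set.indicator_of_notMem]
      positivity
  have hdm : ∀ k, Measurable[F (unifGrid 0 t n k)] (eulerDefect X W μ σ t n k) :=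
    measurable_eulerDefect h.adapted h.brownian.adapted μ σ t n
  have htr := h.brownian.isMartingaleTransform (t := t) (n := n) (G := G) (c := K * M)
    (fun k => Measurable.indicator ((hdm k).mul (Real.measurable_exp.comp
      (((h.brownian.adapted _).const_mul _).sub_const _)))
      (measurableSet_moderateSet h.adapted h.brownian.adapted μ σ t N K n k)) hGb hφ hφ2
  refine ⟨htr.memLp_sum n, ?_⟩
  -- Here `n v` and `n m` do not tend to zero, so smallness must come from the coefficients. Where
  -- the defect is below `ε` it contributes `ε²`; elsewhere it is at most `K`, on an event of
  -- probability at most `ε`.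
  have hγ : ∀ i < n, ∫ ω, G i ω ^ 2 ∂P ≤ M ^ 2 * (ε ^ 2 + K ^ 2 * ε) := fun i hi => by
    set A := {ω | ε ≤ |eulerDefect X W μ σ t n i ω|} with hA
    have hAm : MeasurableSet A :=
      measurableSet_le measurable_const (measurable_norm.comp ((hdm i).mono (F.le _) le_rfl))
    have hint : Integrable (fun ω => ε ^ 2 + A.indicator (fun _ => K ^ 2) ω) P :=
      (integrable_const _).add ((integrable_const _).indicator hAm)
    calc _ ≤ ∫ ω, M ^ 2 * (ε ^ 2 + A.indicator (fun _ => K ^ 2) ω) ∂P := by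
          refine integral_mono (htr.memLp_coeff i 2).integrable_sq (hint.const_mul _) fun ω => ?_
          simp only
          by_cases hω : ω ∈ A
          · have h1 := pow_le_pow_left₀ (abs_nonneg _) (hGb i ω) 2
            rw [sq_abs] at h1
            rw [Set.indicator_of_mem hω]
            nlinarith [mul_nonneg (sq_nonneg M) (sq_nonneg ε)]
          · have h2 : |G i ω| ≤ ε * M := by
              refine (hGb' i ω).trans ?_
              refine (Set.indicator_le_self' (fun _ _ => by positivity) ω).trans ?_
              have : |eulerDefect X W μ σ t n i ω| < ε := not_le.1 hω
              gcongr
            have h1 := pow_le_pow_left₀ (abs_nonneg _) h2 2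
            rw [sq_abs] at h1
            rw [Set.indicator_of_notMem hω]
            nlinarith
      _ = M ^ 2 * (ε ^ 2 + K ^ 2 * P.real A) := by
          rw [integral_const_mul, integral_add (integrable_const _)
            ((integrable_const _).indicator hAm), integral_indicator_const _ hAm]
          simp [mul_comm]
      _ ≤ _ := by gcongr; exact hsmall i hi.le
  have key := htr.integral_sum_sq_le (γ := M ^ 2 * (ε ^ 2 + K ^ 2 * ε))
    (m := c * ((t / n : ℝ≥0) : ℝ)) (v := c * ((t / n : ℝ≥0) : ℝ)) n hγ (by positivity)
    (fun i => by rw [h.brownian.integral_step t n i hφ]; exact hm)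
    (fun i => by rw [h.brownian.integral_step t n i (φ := fun x => φ x ^ 2) (hφ.pow_const 2)]
                 exact hv)
  refine key.trans (le_of_eq ?_)
  push_cast
  field_simp

end IsGBMSolution

end Moderate

/-! ### The exponential formula for solutions. -/

section Exponential

namespace IsGBMSolution

variable {Ω : Type*} {mΩ : MeasurableSpace Ω} {P : Measure Ω} [IsProbabilityMeasure P]
  {F : Filtration ℝ≥0 mΩ} {W X : ℝ≥0 → Ω → ℝ} {μ σ S : ℝ}

/-- By telescoping, the deviation equals the final defect times the inverse exponential, plus `A₁ -
A₂`. Each of the three terms is below `η / 3` off a small event; the complement of the moderate set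
accounts for `3 ε` and the three terms for at most `ε` each. -/
theorem measure_deviation_le (h : IsGBMSolution P F W μ σ S X) (t : ℝ≥0) {η ε : ℝ} (hη : 0 < η)
    (hε : 0 < ε) :
    P.real {ω | η < |X t ω * Real.exp (-σ * W t ω - (μ - σ ^ 2 / 2) * t) - S|} ≤ 6 * ε := by
  set ν := μ - σ ^ 2 / 2 with hν
  obtain ⟨N₁, hN₁⟩ := exists_bound_of_continuous_paths h.measurable h.cont t hε
  obtain ⟨N₂, hN₂⟩ := exists_bound_of_continuous_paths h.brownian.measurable
    h.brownian.isBrownian.cont t hε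
  set N : ℝ := max N₁ N₂ with hN
  have hN0 : 0 ≤ N := (Nat.cast_nonneg N₁).trans (le_max_left _ _)
  set a := (|σ| * N) ^ 2 * t with ha
  have ha0 : 0 ≤ a := by positivity
  -- Then `a ≤ ε K₁ ≤ ε K₁²`, since `K₁ ≥ 1`.
  set K₁ := a / ε + 1 with hK₁
  have hK₁1 : 1 ≤ K₁ := by
    have : 0 ≤ a / ε := by positivity
    linarith
  have hK₁a : a / K₁ ^ 2 ≤ ε := by
    rw [div_le_iff₀ (by positivity)]
    have h1 : a ≤ ε * K₁ := by rw [hK₁, mul_add, mul_div_cancel₀ _ hε.ne']; linarith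
    nlinarith
  set K := K₁ + 2 * N + |μ| * N * t with hK
  have hK0 : 0 ≤ K := by positivity
  set M := Real.exp (|σ| * N + |ν| * t) with hM
  have hM0 : 0 < M := Real.exp_pos _
  obtain ⟨c, hc0, hc⟩ := exists_gaussian_step_bounds μ σ
  -- The order of choices matters: `N`, `K`, `M` and `c` are fixed independently of the grid, then
  -- the defect tolerance `e` is taken small relative to them, and only then `n` is taken large.
  have hlim : Filter.Tendsto (fun e : ℝ => 9 / η ^ 2 *
      (2 * (M ^ 2 * (e ^ 2 + K ^ 2 * e)) * (c * t + c ^ 2 * t ^ 2))) (nhdsWithin 0 (Set.Ioi 0))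
      (nhds 0) := by
    have : Continuous fun e : ℝ => 9 / η ^ 2 *
      (2 * (M ^ 2 * (e ^ 2 + K ^ 2 * e)) * (c * t + c ^ 2 * t ^ 2)) := by fun_prop
    have h0 := this.tendsto 0
    simp only [ne_eq, OfNat.ofNat_ne_zero, not_false_eq_true, zero_pow, mul_zero, add_zero,
      zero_mul] at h0
    exact h0.mono_left nhdsWithin_le_nhds
  obtain ⟨e, ⟨heA, heB⟩, heC⟩ := ((hlim.eventually_le_const hε).and
    (Ioo_mem_nhdsGT (lt_min hε (div_pos hη (by positivity : 0 < 3 * M))))).exists.imp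
      fun e he => (⟨⟨he.1, he.2.1⟩, he.2.2⟩ :
        (_ ∧ 0 < e) ∧ e < min ε (η / (3 * M)))
  obtain ⟨n₁, hn₁⟩ := h.eulerDefect_small t heB
  obtain ⟨n₂, hn₂0, hn₂⟩ := exists_mesh_lt (9 / η ^ 2 *
    (2 * (N * M) ^ 2 * (c * t ^ 2 + c ^ 2 * t ^ 4))) ε hε
  obtain ⟨n₃, hn₃⟩ := exists_nat_ge (t : ℝ)
  set n := max n₁ (max n₂ n₃) with hn
  have hnn₁ : n₁ ≤ n := le_max_left _ _
  have hnn₂ : n₂ ≤ n := (le_max_left _ _).trans (le_max_right _ _)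
  have hnn₃ : n₃ ≤ n := (le_max_right _ _).trans (le_max_right _ _)
  have hn0 : 0 < n := hn₂0.trans_le hnn₂
  have hn0' : (0 : ℝ) < n := by exact_mod_cast hn0
  have hstep1 : t / n ≤ 1 := by
    rw [← NNReal.coe_le_coe]
    push_cast
    rw [div_le_one hn0']
    exact hn₃.trans (by exact_mod_cast hnn₃)
  obtain ⟨⟨l1, m1, v1⟩, l2, m2, v2⟩ := hc (t / n) hstep1
  have hsmall : ∀ k ≤ n, P.real {ω | e ≤ |eulerDefect X W μ σ t n k ω|} ≤ e := fun k hk =>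
    ENNReal.toReal_le_of_le_ofReal heB.le (hn₁ n hnn₁ k hk)
  obtain ⟨L1, I1⟩ := h.integral_sq_solution_sum_le (K := K) t hN0 hn0 (by fun_prop) l2 m2 v2 ν
  obtain ⟨L2, I2⟩ := h.integral_sq_defect_sum_le (N := N) t hK0 heB.le hn0 hsmall (by fun_prop)
    l1 m1 v1 ν
  have hB := h.measure_compl_moderateSet_le t (by positivity : 0 < K₁)
    (hN₁ N (le_max_left _ _)) (hN₂ N (le_max_right _ _)) hN0 hK₁a hn0
  set A₁ : Ω → ℝ := fun ω => ∑ k ∈ Finset.range n,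
      (moderateSet X W μ σ t N K n k).indicator (fun ω => X (unifGrid 0 t n k) ω *
          Real.exp (-σ * W (unifGrid 0 t n k) ω - ν * unifGrid 0 t n k)) ω *
      ((1 + μ * (t / n : ℝ≥0) + σ * (W (unifGrid 0 t n (k + 1)) ω - W (unifGrid 0 t n k) ω)) *
          Real.exp (-σ * (W (unifGrid 0 t n (k + 1)) ω - W (unifGrid 0 t n k) ω) -
            ν * (t / n : ℝ≥0)) - 1) with hA₁
  set A₂ : Ω → ℝ := fun ω => ∑ k ∈ Finset.range n,
      (moderateSet X W μ σ t N K n k).indicator (fun ω => eulerDefect X W μ σ t n k ω *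
          Real.exp (-σ * W (unifGrid 0 t n k) ω - ν * unifGrid 0 t n k)) ω *
      (Real.exp (-σ * (W (unifGrid 0 t n (k + 1)) ω - W (unifGrid 0 t n k) ω) -
            ν * (t / n : ℝ≥0)) - 1) with hA₂
  have cheb : ∀ {A : Ω → ℝ}, MemLp A 2 P →
      P.real {ω | (η / 3) ^ 2 ≤ A ω ^ 2} ≤ 9 / η ^ 2 * ∫ ω, A ω ^ 2 ∂P := fun {A} hA => by
    have := mul_meas_ge_le_integral_of_nonneg (ae_of_all P fun ω => sq_nonneg (A ω))
      hA.integrable_sq ((η / 3) ^ 2)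
    have e9 : 9 / η ^ 2 * ((η / 3) ^ 2 * P.real {ω | (η / 3) ^ 2 ≤ A ω ^ 2}) =
        P.real {ω | (η / 3) ^ 2 ≤ A ω ^ 2} := by field_simp; norm_num
    rw [← e9]
    gcongr
  have hP1 : P.real {ω | (η / 3) ^ 2 ≤ A₁ ω ^ 2} ≤ ε := by
    refine (cheb L1).trans (le_trans ?_ (hn₂ n hnn₂).le)
    rw [mul_div_assoc]
    gcongr
  have hP2 : P.real {ω | (η / 3) ^ 2 ≤ A₂ ω ^ 2} ≤ ε := by
    refine (cheb L2).trans (le_trans ?_ heA)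
    gcongr
  have hP3 := hsmall n le_rfl
  have hsub : {ω | η < |X t ω * Real.exp (-σ * W t ω - ν * t) - S|} ≤ᵐ[P]
      ((moderateSet X W μ σ t N K n n)ᶜ ∪ {ω | e ≤ |eulerDefect X W μ σ t n n ω|} ∪
        {ω | (η / 3) ^ 2 ≤ A₁ ω ^ 2} ∪ {ω | (η / 3) ^ 2 ≤ A₂ ω ^ 2} : Set Ω) := by
    filter_upwards [IsGBMSolution.init h, h.brownian.isBrownian.eval_zero_ae_eq_zero] with ω hX0 hW0
      (hω : η < |X t ω * Real.exp (-σ * W t ω - ν * t) - S|)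
    by_contra hcon
    have hcon' : ω ∉ ((moderateSet X W μ σ t N K n n)ᶜ ∪
        {ω | e ≤ |eulerDefect X W μ σ t n n ω|} ∪
        {ω | (η / 3) ^ 2 ≤ A₁ ω ^ 2} ∪ {ω | (η / 3) ^ 2 ≤ A₂ ω ^ 2} : Set Ω) := hcon
    simp only [Set.mem_union, Set.mem_compl_iff, Set.mem_ofPred_eq, not_or, not_not,
      not_le] at hcon'
    obtain ⟨⟨⟨hmod, hdef⟩, h1⟩, h2⟩ := hcon'
    have habs : ∀ {x : ℝ}, x ^ 2 < (η / 3) ^ 2 → |x| < η / 3 := fun hx =>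
      abs_lt_of_sq_lt_sq hx (by positivity)
    have h1 := habs h1
    have h2 := habs h2
    have htel := eulerDefect_telescope X W μ σ t n ω
    rw [hX0, hW0, mul_zero, Real.exp_zero, mul_one, unifGrid_self zero_le hn0, ← hν] at htel
    have hind : ∀ k ∈ Finset.range n, ω ∈ moderateSet X W μ σ t N K n k := fun k hk =>
      ⟨(Finset.mem_range.1 hk).le, fun i hi => hmod.2 i (hi.trans (Finset.mem_range.1 hk).le)⟩
    have hA₁ω : A₁ ω = ∑ k ∈ Finset.range n, X (unifGrid 0 t n k) ω *
        Real.exp (-σ * W (unifGrid 0 t n k) ω - ν * unifGrid 0 t n k) *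
        ((1 + μ * (t / n : ℝ≥0) + σ * (W (unifGrid 0 t n (k + 1)) ω - W (unifGrid 0 t n k) ω)) *
          Real.exp (-σ * (W (unifGrid 0 t n (k + 1)) ω - W (unifGrid 0 t n k) ω) -
            ν * (t / n : ℝ≥0)) - 1) :=
      Finset.sum_congr rfl fun k hk => by rw [Set.indicator_of_mem (hind k hk)]
    have hA₂ω : A₂ ω = ∑ k ∈ Finset.range n, eulerDefect X W μ σ t n k ω *
        Real.exp (-σ * W (unifGrid 0 t n k) ω - ν * unifGrid 0 t n k) *
        (Real.exp (-σ * (W (unifGrid 0 t n (k + 1)) ω - W (unifGrid 0 t n k) ω) -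
            ν * (t / n : ℝ≥0)) - 1) :=
      Finset.sum_congr rfl fun k hk => by rw [Set.indicator_of_mem (hind k hk)]
    rw [← hA₁ω, ← hA₂ω] at htel
    have hYb := abs_exp_le_of_mem_moderateSet hn0 hmod ν
    rw [unifGrid_self zero_le hn0] at hYb
    have hr : |eulerDefect X W μ σ t n n ω * Real.exp (-σ * W t ω - ν * t)| < η / 3 := by
      rw [abs_mul, Real.abs_exp]
      calc _ ≤ |eulerDefect X W μ σ t n n ω| * M := by gcongr
        _ < e * M := by gcongr
        _ ≤ η / (3 * M) * M := by
            gcongr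
            exact heC.le.trans (min_le_right _ _)
        _ = _ := by field_simp
    have hfin : X t ω * Real.exp (-σ * W t ω - ν * t) - S =
        eulerDefect X W μ σ t n n ω * Real.exp (-σ * W t ω - ν * t) + A₁ ω - A₂ ω := by
      linear_combination htel
    rw [hfin] at hω
    rw [abs_lt] at h1 h2 hr
    have : |eulerDefect X W μ σ t n n ω * Real.exp (-σ * W t ω - ν * t) + A₁ ω - A₂ ω| < η := by
      rw [abs_lt]; constructor <;> linarith
    linarith
  calc _ ≤ _ := ENNReal.toReal_mono (measure_ne_top _ _) (measure_mono_ae hsub)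
    _ ≤ 3 * ε + e + ε + ε := (measureReal_union_le _ _).trans (add_le_add
          ((measureReal_union_le _ _).trans (add_le_add
            ((measureReal_union_le _ _).trans (add_le_add hB hP3)) hP1)) hP2)
    _ ≤ _ := by linarith [heC.le.trans (min_le_left _ _)]

/-- Solutions of the geometric Brownian motion equation are given by the exponential formula. -/
theorem ae_eq_exp (h : IsGBMSolution P F W μ σ S X) (t : ℝ≥0) :
    ∀ᵐ ω ∂P, X t ω = S * Real.exp (σ * W t ω + (μ - σ ^ 2 / 2) * t) := by
  set D : Ω → ℝ := fun ω => X t ω * Real.exp (-σ * W t ω - (μ - σ ^ 2 / 2) * t) - S with hD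
  have h0 : ∀ m : ℕ, ∀ᵐ ω ∂P, |D ω| ≤ 1 / ((m : ℝ) + 1) := fun m => by
    rw [ae_iff]
    simp only [not_le]
    have : P.real {ω | 1 / ((m : ℝ) + 1) < |D ω|} ≤ 0 := by
      refine le_of_forall_pos_le_add fun ε hε => ?_
      have := h.measure_deviation_le t (η := 1 / ((m : ℝ) + 1)) (ε := ε / 6) (by positivity)
        (by positivity)
      linarith
    exact (measureReal_eq_zero_iff).1 (le_antisymm this measureReal_nonneg)
  filter_upwards [ae_all_iff.2 h0] with ω hω
  have hD0 : D ω = 0 := by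
    have hle : |D ω| ≤ 0 := ge_of_tendsto' tendsto_one_div_add_atTop_nhds_zero_nat hω
    exact abs_eq_zero.1 (le_antisymm hle (abs_nonneg _))
  have e : Real.exp (-σ * W t ω - (μ - σ ^ 2 / 2) * t) *
      Real.exp (σ * W t ω + (μ - σ ^ 2 / 2) * t) = 1 := by
    rw [← Real.exp_add, ← Real.exp_zero]; ring_nf
  have hS : S = X t ω * Real.exp (-σ * W t ω - (μ - σ ^ 2 / 2) * t) := by
    simp only [hD] at hD0; linarith
  rw [hS, mul_assoc, e, mul_one]

/-- The exponential formula holds simultaneously for all times. -/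
theorem ae_forall_eq_exp (h : IsGBMSolution P F W μ σ S X) :
    ∀ᵐ ω ∂P, ∀ t, X t ω = S * Real.exp (σ * W t ω + (μ - σ ^ 2 / 2) * t) := by
  have hd : ∀ᵐ ω ∂P, ∀ m, X (TopologicalSpace.denseSeq ℝ≥0 m) ω =
      S * Real.exp (σ * W (TopologicalSpace.denseSeq ℝ≥0 m) ω +
        (μ - σ ^ 2 / 2) * TopologicalSpace.denseSeq ℝ≥0 m) :=
    ae_all_iff.2 fun m => h.ae_eq_exp _
  filter_upwards [hd, h.cont, h.brownian.isBrownian.cont] with ω h1 h2 h3 t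
  have := Continuous.ext_on (TopologicalSpace.denseRange_denseSeq ℝ≥0) h2
    (g := fun t => S * Real.exp (σ * W t ω + (μ - σ ^ 2 / 2) * t)) (by fun_prop)
    (by rintro _ ⟨m, rfl⟩; exact h1 m)
  exact congrFun this t

end IsGBMSolution

end Exponential

/-! ### First passages and the abstract reflection inequality. -/

/-- The step at which a process first reaches the level `a`. -/
def firstPassage {Ω : Type*} (U : ℕ → Ω → ℝ) (a : ℝ) (k : ℕ) : Set Ω :=
  {ω | a ≤ U k ω ∧ ∀ j < k, U j ω < a}

theorem disjoint_firstPassage {Ω : Type*} (U : ℕ → Ω → ℝ) (a : ℝ) {i j : ℕ} (hij : i ≠ j) :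
    Disjoint (firstPassage U a i) (firstPassage U a j) := by
  rw [Set.disjoint_left]
  rintro ω ⟨h1, h2⟩ ⟨h3, h4⟩
  rcases lt_or_gt_of_ne hij with h | h
  · exact absurd (h4 i h) (not_lt.2 h1)
  · exact absurd (h2 j h) (not_lt.2 h3)

theorem biUnion_firstPassage {Ω : Type*} (U : ℕ → Ω → ℝ) (a : ℝ) (n : ℕ) :
    ⋃ k ∈ Finset.range (n + 1), firstPassage U a k = {ω | ∃ k ≤ n, a ≤ U k ω} := by
  classical
  ext ω
  simp only [Set.mem_iUnion, Finset.mem_range, Set.mem_ofPred_eq, exists_prop, Nat.lt_succ_iff]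
  constructor
  · rintro ⟨k, hk, h1, _⟩
    exact ⟨k, hk, h1⟩
  · intro h
    have h' : ∃ k, k ≤ n ∧ a ≤ U k ω := h
    refine ⟨Nat.find h', (Nat.find_spec h').1, (Nat.find_spec h').2, fun j hj => ?_⟩
    have := Nat.find_min h' hj
    by_contra hc
    exact this ⟨hj.le.trans (Nat.find_spec h').1, not_lt.1 hc⟩

theorem measurableSet_firstPassage {Ω : Type*} {m : MeasurableSpace Ω} {U : ℕ → Ω → ℝ} {a : ℝ}
    {k : ℕ} (hU : ∀ j ≤ k, Measurable (U j)) : MeasurableSet (firstPassage U a k) := by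
  have : firstPassage U a k = {ω | a ≤ U k ω} ∩ ⋂ j, ⋂ (_ : j < k), {ω | U j ω < a} := by
    ext; simp [firstPassage]
  rw [this]
  exact (measurableSet_le measurable_const (hU k le_rfl)).inter (MeasurableSet.iInter fun j =>
    MeasurableSet.iInter fun hj => measurableSet_lt (hU j hj.le) measurable_const)

/-- If at every first passage the future realises, with conditional probability at least `c`, an
event on which `g` dominates the functional `f` of the past, then `c` times the integral of `f` at
the first passage is at most the integral of `g`. -/
theorem reflection_le {Ω : Type*} {mΩ : MeasurableSpace Ω} {P : Measure Ω}
    {𝓟 𝓠 : ℕ → MeasurableSpace Ω} (n : ℕ) (h𝓟 : ∀ k ≤ n, 𝓟 k ≤ mΩ) (h𝓠 : ∀ k ≤ n, 𝓠 k ≤ mΩ)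
    (hind : ∀ k ≤ n, Indep (𝓟 k) (𝓠 k) P) {U : ℕ → Ω → ℝ}
    (hU : ∀ k ≤ n, ∀ j ≤ k, Measurable[𝓟 k] (U j)) (a : ℝ)
    {f : ℕ → Ω → ℝ≥0∞} (hf : ∀ k ≤ n, Measurable[𝓟 k] (f k)) {H : ℕ → Set Ω}
    (hH : ∀ k ≤ n, MeasurableSet[𝓠 k] (H k)) {c : ℝ≥0∞} (hc : ∀ k ≤ n, c ≤ P (H k))
    {g : Ω → ℝ≥0∞} (hg : ∀ k ≤ n, ∀ ω ∈ firstPassage U a k ∩ H k, f k ω ≤ g ω) :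
    c * ∑ k ∈ Finset.range (n + 1), ∫⁻ ω in firstPassage U a k, f k ω ∂P ≤ ∫⁻ ω, g ω ∂P := by
  have hE : ∀ k ≤ n, MeasurableSet[𝓟 k] (firstPassage U a k) := fun k hk =>
    measurableSet_firstPassage (m := 𝓟 k) (hU k hk)
  have hE' : ∀ k ≤ n, MeasurableSet (firstPassage U a k) := fun k hk => h𝓟 k hk _ (hE k hk)
  have hk' : ∀ k ∈ Finset.range (n + 1), k ≤ n := fun k hk =>
    Nat.lt_succ_iff.1 (Finset.mem_range.1 hk)
  -- First passage at `k` and `f k` belong to the past, `H k` to the future, so the integral of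
  -- their product factorises.
  have step : ∀ k ≤ n, c * ∫⁻ ω in firstPassage U a k, f k ω ∂P ≤
      ∫⁻ ω in firstPassage U a k, g ω ∂P := fun k hk => by
    have hm : Measurable[𝓟 k] ((firstPassage U a k).indicator (f k)) := (hf k hk).indicator (hE k hk)
    have hm2 : Measurable[𝓠 k] ((H k).indicator (fun _ => (1 : ℝ≥0∞))) :=
      measurable_const.indicator (hH k hk)
    calc _ ≤ P (H k) * ∫⁻ ω in firstPassage U a k, f k ω ∂P := by gcongr; exact hc k hk
      _ = (∫⁻ ω, (firstPassage U a k).indicator (f k) ω ∂P) *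
            ∫⁻ ω, (H k).indicator (fun _ => (1 : ℝ≥0∞)) ω ∂P := by
          rw [lintegral_indicator (hE' k hk), lintegral_indicator (h𝓠 k hk _ (hH k hk))]
          simp [mul_comm]
      _ = ∫⁻ ω, (firstPassage U a k).indicator (f k) ω *
            (H k).indicator (fun _ => (1 : ℝ≥0∞)) ω ∂P :=
          (lintegral_mul_eq_lintegral_mul_lintegral_of_independent_measurableSpace
            (h𝓟 k hk) (h𝓠 k hk) (hind k hk) hm hm2).symm
      _ ≤ ∫⁻ ω, (firstPassage U a k).indicator g ω ∂P := by
          refine lintegral_mono fun ω => ?_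
          by_cases h1 : ω ∈ firstPassage U a k
          · by_cases h2 : ω ∈ H k
            · simpa [h1, h2] using hg k hk ω ⟨h1, h2⟩
            · simp [h2]
          · simp [h1]
      _ = _ := lintegral_indicator (hE' k hk) _
  calc _ = ∑ k ∈ Finset.range (n + 1), c * ∫⁻ ω in firstPassage U a k, f k ω ∂P := Finset.mul_sum _ _ _
    _ ≤ ∑ k ∈ Finset.range (n + 1), ∫⁻ ω in firstPassage U a k, g ω ∂P :=
        Finset.sum_le_sum fun k hk => step k (hk' k hk)
    _ = ∫⁻ ω in ⋃ k ∈ Finset.range (n + 1), firstPassage U a k, g ω ∂P := by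
        rw [lintegral_biUnion_finset _ fun k hk => hE' k (hk' k hk)]
        exact fun i _ j _ hij => disjoint_firstPassage U a hij
    _ ≤ _ := setLIntegral_le_lintegral _ _

/-! ### Gaussian tail estimates. -/

/-- Exponential moments of a Gaussian above a level are comparable to the tail probability. -/
theorem lintegral_exp_Ici_gaussianReal_le {u K a : ℝ} (hu : u ≤ K) :
    ∫⁻ x in Set.Ici 0, ENNReal.ofReal (Real.exp (a * x)) ∂gaussianReal u 1 ≤
      ENNReal.ofReal (2 * Real.exp ((2 * a + K) ^ 2 / 6)) * gaussianReal u 1 (Set.Ici 0) := by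
  have hpdf : gaussianReal u 1 = volume.withDensity (gaussianPDF u 1) :=
    gaussianReal_of_var_ne_zero u one_ne_zero
  have hm : Measurable fun x : ℝ => ENNReal.ofReal (Real.exp (a * x)) := by fun_prop
  have e1 : ∫⁻ x in Set.Ici 0, ENNReal.ofReal (Real.exp (a * x)) ∂gaussianReal u 1 =
      ∫⁻ x, (Set.Ici (0 : ℝ)).indicator
        (fun x => gaussianPDF u 1 x * ENNReal.ofReal (Real.exp (a * x))) x := by
    rw [lintegral_indicator measurableSet_Ici, hpdf,
      setLIntegral_withDensity_eq_setLIntegral_mul _ (measurable_gaussianPDF u 1) hm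
        measurableSet_Ici]
    rfl
  have hm2 : Measurable ((Set.Ici (0 : ℝ)).indicator
        (fun x => gaussianPDF u 1 x * ENNReal.ofReal (Real.exp (a * x)))) :=
    ((measurable_gaussianPDF u 1).mul hm).indicator measurableSet_Ici
  -- Substitute `x = 2 r` and compare with the density at `r`: the exponents differ by `-3r²/2 + (2a
  -- + u) r`, which is at most `(2a + K)² / 6` for `r ≥ 0`. The bound is uniform as `u → -∞`, which
  -- is the case of a remote barrier.
  have e2 : ∀ f : ℝ → ℝ≥0∞, Measurable f → ∫⁻ x, f x = ENNReal.ofReal 2 * ∫⁻ r, f (2 * r) :=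
    fun f hf => by
      have h2 := Real.smul_map_volume_mul_left (a := 2) two_ne_zero
      rw [abs_of_pos two_pos] at h2
      conv_lhs => rw [← h2]
      rw [lintegral_smul_measure, lintegral_map hf (by fun_prop), smul_eq_mul]
  rw [e1, e2 _ hm2, ENNReal.ofReal_mul two_pos.le, mul_assoc]
  gcongr
  have e3 : gaussianReal u 1 (Set.Ici 0) =
      ∫⁻ r, (Set.Ici (0 : ℝ)).indicator (gaussianPDF u 1) r := by
    rw [lintegral_indicator measurableSet_Ici, hpdf, withDensity_apply _ measurableSet_Ici]
  rw [e3, ← lintegral_const_mul _ ((measurable_gaussianPDF u 1).indicator measurableSet_Ici)]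
  refine lintegral_mono fun r => ?_
  by_cases hr : 0 ≤ r
  · have h1 : (2 * r) ∈ Set.Ici (0 : ℝ) := by simpa using hr
    have h2 : r ∈ Set.Ici (0 : ℝ) := hr
    rw [Set.indicator_of_mem h1, Set.indicator_of_mem h2, gaussianPDF, gaussianPDF,
      ← ENNReal.ofReal_mul (gaussianPDFReal_nonneg _ _ _), ← ENNReal.ofReal_mul (Real.exp_pos _).le]
    refine ENNReal.ofReal_le_ofReal ?_
    simp only [gaussianPDFReal]
    rw [mul_assoc, ← Real.exp_add, mul_left_comm (Real.exp _), ← Real.exp_add]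
    refine mul_le_mul_of_nonneg_left (Real.exp_le_exp.2 ?_) (by positivity)
    simp only [NNReal.coe_one, mul_one]
    have : u * r ≤ K * r := by gcongr
    nlinarith [sq_nonneg (3 * r - (2 * a + K))]
  · have h1 : (2 * r) ∉ Set.Ici (0 : ℝ) := by simpa using hr
    have h2 : r ∉ Set.Ici (0 : ℝ) := hr
    simp only [Set.indicator_of_notMem h1, Set.indicator_of_notMem h2, mul_zero, le_refl]

theorem gaussianReal_Ici_pos (K : ℝ) : gaussianReal 0 1 (Set.Ici K) ≠ 0 := by
  intro h
  have := (gaussianReal_absolutelyContinuous' 0 (one_ne_zero : (1 : ℝ≥0) ≠ 0)) h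
  simp at this

/-- A Gaussian of variance `v ≤ 1` exceeds `θ v` with probability bounded below. -/
theorem le_gaussianReal_Ici {K θ : ℝ} (hθ : |θ| ≤ K) {v : ℝ≥0} (hv : v ≤ 1) :
    gaussianReal 0 1 (Set.Ici K) ≤ gaussianReal 0 v (Set.Ici (-(θ * v))) := by
  rw [gaussianReal_zero_eq_map_sqrt v, Measure.map_apply (by fun_prop) measurableSet_Ici]
  refine measure_mono fun z (hz : K ≤ z) => ?_
  show -(θ * v) ≤ √(v : ℝ) * z
  have h0 : 0 ≤ √(v : ℝ) := Real.sqrt_nonneg _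
  have h1 : √(v : ℝ) ≤ 1 := Real.sqrt_le_one.2 (by exact_mod_cast hv)
  have h2 : √(v : ℝ) ^ 2 = v := Real.sq_sqrt v.2
  have hK : 0 ≤ K := (abs_nonneg _).trans hθ
  have h3 : -θ ≤ K := (neg_le_abs θ).trans hθ
  have h4 : √(v : ℝ) * K ≤ √(v : ℝ) * z := by gcongr
  have h5 : -θ * v ≤ K * v := by gcongr
  have h6 : (v : ℝ) ≤ √(v : ℝ) := by nlinarith
  nlinarith

theorem measurable_finset_sup {Ω : Type*} {m : MeasurableSpace Ω} (s : Finset ℕ)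
    {f : ℕ → Ω → ℝ≥0∞} (hf : ∀ k ∈ s, Measurable (f k)) :
    Measurable fun ω => s.sup fun k => f k ω := by
  simp_rw [Finset.sup_eq_iSup]
  exact Measurable.iSup fun k => Measurable.iSup fun hk => hf k hk

/-! ### Brownian walks with drift: reflection and maximal exponential moments. -/

/-- The values at the times `k / n` of a process with an added drift. -/
noncomputable def driftWalk {Ω : Type*} (V : ℝ≥0 → Ω → ℝ) (θ : ℝ) (n k : ℕ) (ω : Ω) : ℝ :=
  V ((k : ℝ≥0) / n) ω + θ * ((k : ℝ) / n)

/-- The `σ`-algebra generated by a process up to time `s`. -/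
abbrev pastAlgebra {Ω : Type*} (V : ℝ≥0 → Ω → ℝ) (s : ℝ≥0) : MeasurableSpace Ω :=
  MeasurableSpace.comap (fun ω (t : Set.Iic s) => V t ω) inferInstance

/-- The `σ`-algebra generated by the increments of a process after time `s`. -/
abbrev futureAlgebra {Ω : Type*} (V : ℝ≥0 → Ω → ℝ) (s : ℝ≥0) : MeasurableSpace Ω :=
  MeasurableSpace.comap (fun ω (t : ℝ≥0) => V (s + t) ω - V s ω) inferInstance

section DriftWalk

variable {Ω : Type*} {mΩ : MeasurableSpace Ω} {P : Measure Ω} {V : ℝ≥0 → Ω → ℝ} {θ : ℝ}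

theorem pastAlgebra_le (hVm : ∀ t, Measurable (V t)) (s : ℝ≥0) : pastAlgebra V s ≤ mΩ :=
  (measurable_pi_lambda _ fun t : Set.Iic s => hVm t).comap_le

theorem futureAlgebra_le (hVm : ∀ t, Measurable (V t)) (s : ℝ≥0) : futureAlgebra V s ≤ mΩ :=
  (measurable_pi_lambda _ fun t => (hVm (s + t)).sub (hVm s)).comap_le

theorem indep_pastAlgebra_futureAlgebra (hV : IsPreBrownianReal V P) (s : ℝ≥0) :
    Indep (pastAlgebra V s) (futureAlgebra V s) P :=
  ((IndepFun_iff_Indep _ _ _).1 (hV.indepFun_shift s)).symm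

theorem measurable_driftWalk (hVm : ∀ t, Measurable (V t)) (n k : ℕ) :
    Measurable (driftWalk V θ n k) := (hVm _).add_const _

theorem measurable_driftWalk_past {n j k : ℕ} (hjk : j ≤ k) :
    Measurable[pastAlgebra V ((k : ℝ≥0) / n)] (driftWalk V θ n j) := by
  have hle : (j : ℝ≥0) / n ≤ (k : ℝ≥0) / n := by gcongr
  have h : Measurable[pastAlgebra V ((k : ℝ≥0) / n)]
      (fun ω (t : Set.Iic ((k : ℝ≥0) / n)) => V t ω) := comap_measurable _
  exact ((measurable_pi_apply (⟨(j : ℝ≥0) / n, hle⟩ : Set.Iic ((k : ℝ≥0) / n))).comp h).add_const _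

theorem measurable_driftWalk_future (n j k : ℕ) :
    Measurable[futureAlgebra V ((k : ℝ≥0) / n)]
      (fun ω => driftWalk V θ n (k + j) ω - driftWalk V θ n k ω) := by
  have h : Measurable[futureAlgebra V ((k : ℝ≥0) / n)]
      (fun ω (t : ℝ≥0) => V ((k : ℝ≥0) / n + t) ω - V ((k : ℝ≥0) / n) ω) := comap_measurable _
  have h2 := ((measurable_pi_apply ((j : ℝ≥0) / n)).comp h).add_const (θ * ((j : ℝ) / n))
  convert! h2 using 1
  ext ω
  simp only [driftWalk, Function.comp_apply]
  rw [← add_div]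
  push_cast
  ring

theorem driftWalk_self {n : ℕ} (hn : 0 < n) (ω : Ω) : driftWalk V θ n n ω = V 1 ω + θ := by
  have h1 : (n : ℝ≥0) ≠ 0 := by exact_mod_cast hn.ne'
  have h2 : (n : ℝ) ≠ 0 := by exact_mod_cast hn.ne'
  simp [driftWalk, div_self h1, div_self h2]

theorem driftWalk_neg (n k : ℕ) (ω : Ω) :
    driftWalk (-V) (-θ) n k ω = -driftWalk V θ n k ω := by
  simp [driftWalk]; ring

/-- Stands in for the probability `1/2` of the classical reflection principle. The drift destroys
the symmetry, but a lower bound uniform in the grid, the step and the drift is enough. -/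
theorem le_measure_driftWalk_final_ge {K : ℝ} (hθ : |θ| ≤ K) (hV : IsPreBrownianReal V P)
    {n k : ℕ} (hn : 0 < n) (hk : k ≤ n) :
    gaussianReal 0 1 (Set.Ici K) ≤ P {ω | 0 ≤ driftWalk V θ n n ω - driftWalk V θ n k ω} := by
  have hn' : (0 : ℝ) < n := by exact_mod_cast hn
  have hlaw := hV.hasLaw_sub 1 ((k : ℝ≥0) / n)
  set v := nndist (1 : ℝ≥0).1 ((k : ℝ≥0) / n).1 with hv
  have hk1 : (k : ℝ) / n ≤ 1 := by rw [div_le_one hn']; exact_mod_cast hk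
  have hvr : (v : ℝ) = 1 - (k : ℝ) / n := by
    rw [hv, coe_nndist, Real.dist_eq]
    show |((1 : ℝ≥0) : ℝ) - (((k : ℝ≥0) / n : ℝ≥0) : ℝ)| = _
    push_cast
    exact abs_of_nonneg (by linarith)
  have hv1 : v ≤ 1 := by
    rw [← NNReal.coe_le_coe, hvr]
    have : 0 ≤ (k : ℝ) / n := by positivity
    push_cast; linarith
  refine (le_gaussianReal_Ici hθ hv1).trans (le_of_eq ?_)
  rw [← hlaw.map_eq, Measure.map_apply_of_aemeasurable hlaw.aemeasurable measurableSet_Ici]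
  congr 1
  ext ω
  simp only [Set.mem_preimage, Set.mem_Ici, Pi.sub_apply, Set.mem_ofPred_eq, driftWalk_self hn]
  rw [hvr, driftWalk]
  constructor <;> intro h <;> linarith

/-- The reflection inequality for a Brownian walk with bounded drift. -/
theorem driftWalk_reflection_le {K : ℝ} (hθ : |θ| ≤ K) (hV : IsPreBrownianReal V P)
    (hVm : ∀ t, Measurable (V t)) {n : ℕ} (hn : 0 < n) {φ : ℝ → ℝ} (hφ : Monotone φ) (a : ℝ)
    {f : ℕ → Ω → ℝ≥0∞} (hf : ∀ k ≤ n, Measurable[pastAlgebra V ((k : ℝ≥0) / n)] (f k))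
    (hmono : ∀ k ≤ n, ∀ ω, f k ω ≤ f n ω) :
    gaussianReal 0 1 (Set.Ici K) * ∑ k ∈ Finset.range (n + 1),
        ∫⁻ ω in firstPassage (fun k ω => φ (driftWalk V θ n k ω)) a k, f k ω ∂P ≤
      ∫⁻ ω in {ω | a ≤ φ (driftWalk V θ n n ω)}, f n ω ∂P := by
  have hset : MeasurableSet {ω | a ≤ φ (driftWalk V θ n n ω)} :=
    measurableSet_le measurable_const (hφ.measurable.comp (measurable_driftWalk hVm n n))
  rw [← lintegral_indicator hset]
  refine reflection_le (𝓟 := fun k => pastAlgebra V ((k : ℝ≥0) / n))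
    (𝓠 := fun k => futureAlgebra V ((k : ℝ≥0) / n)) n (fun k _ => pastAlgebra_le hVm _)
    (fun k _ => futureAlgebra_le hVm _) (fun k _ => indep_pastAlgebra_futureAlgebra hV _)
    (fun k _ j hj => hφ.measurable.comp (measurable_driftWalk_past hj)) a hf
    (H := fun k => {ω | 0 ≤ driftWalk V θ n n ω - driftWalk V θ n k ω}) (fun k hk => ?_)
    (fun k hk => le_measure_driftWalk_final_ge hθ hV hn hk) fun k hk ω hω => ?_
  · obtain ⟨j, rfl⟩ := Nat.exists_eq_add_of_le hk
    have := measurable_driftWalk_future (V := V) (θ := θ) (k + j) j k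
    exact this measurableSet_Ici
  · obtain ⟨h1, h2⟩ := hω
    have h3 : a ≤ φ (driftWalk V θ n n ω) := h1.1.trans (hφ (sub_nonneg.1 h2))
    have h4 : ω ∈ {ω | a ≤ φ (driftWalk V θ n n ω)} := h3
    rw [Set.indicator_of_mem h4]
    exact hmono k hk ω

theorem lintegral_exp_driftWalk_final (hV : IsPreBrownianReal V P) {n : ℕ} (hn : 0 < n) (a : ℝ) :
    ∫⁻ ω, ENNReal.ofReal (Real.exp (a * driftWalk V θ n n ω)) ∂P =
      ENNReal.ofReal (Real.exp (a * θ + a ^ 2 / 2)) := by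
  simp_rw [driftWalk_self hn]
  rw [(hV.hasLaw_eval 1).lintegral_comp
    (f := fun x => ENNReal.ofReal (Real.exp (a * (x + θ)))) (by fun_prop)]
  have e : ∀ x : ℝ, Real.exp (a * (x + θ)) = Real.exp (a * θ) * Real.exp (a * x) := fun x => by
    rw [← Real.exp_add]; ring_nf
  rw [← ofReal_integral_eq_lintegral_ofReal]
  · simp_rw [e]
    rw [integral_const_mul, integral_gaussianReal_exp, ← Real.exp_add]
    simp
  · simp_rw [e]
    exact (integrable_exp_mul_gaussianReal a).const_mul _
  · exact ae_of_all _ fun x => (Real.exp_pos _).le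

/-- The reflection inequality with `f = 1` bounds each tail of the maximum by that of the final
value. Integration over the levels turns this into a bound on expectations, and the final value is
Gaussian. -/
theorem lintegral_sup_exp_driftWalk_le {K : ℝ} (hθ : |θ| ≤ K) (hV : IsPreBrownianReal V P)
    (hVm : ∀ t, Measurable (V t)) {n : ℕ} (hn : 0 < n) {a : ℝ} (ha : 0 ≤ a) :
    gaussianReal 0 1 (Set.Ici K) * ∫⁻ ω, (Finset.range (n + 1)).sup
        (fun k => ENNReal.ofReal (Real.exp (a * driftWalk V θ n k ω))) ∂P ≤
      ENNReal.ofReal (Real.exp (a * K + a ^ 2 / 2)) := by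
  set c := gaussianReal 0 1 (Set.Ici K) with hc
  set φ : ℝ → ℝ := fun x => Real.exp (a * x) with hφ
  have hφm : Monotone φ := fun x y hxy => Real.exp_le_exp.2 (mul_le_mul_of_nonneg_left hxy ha)
  have hUm : ∀ k, Measurable fun ω => φ (driftWalk V θ n k ω) := fun k =>
    hφm.measurable.comp (measurable_driftWalk hVm n k)
  set M : Ω → ℝ := fun ω => (Finset.range (n + 1)).sup' Finset.nonempty_range_add_one
    fun k => φ (driftWalk V θ n k ω) with hM
  have hMm : Measurable M := Finset.measurable_range_sup'' fun k _ => hUm k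
  have hle : ∀ ω, (Finset.range (n + 1)).sup
      (fun k => ENNReal.ofReal (φ (driftWalk V θ n k ω))) ≤ ENNReal.ofReal (M ω) := fun ω =>
    Finset.sup_le fun k hk => ENNReal.ofReal_le_ofReal
      (Finset.le_sup' (fun k => φ (driftWalk V θ n k ω)) hk)
  have hM0 : ∀ ω, 0 ≤ M ω := fun ω => (Real.exp_pos _).le.trans
    (Finset.le_sup' (fun k => φ (driftWalk V θ n k ω)) (Finset.mem_range.2 (Nat.succ_pos n)))
  have hlevel : ∀ x, c * P {ω | x ≤ M ω} ≤ P {ω | x ≤ φ (driftWalk V θ n n ω)} := fun x => by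
    have h1 := driftWalk_reflection_le hθ hV hVm hn hφm x (f := fun _ _ => 1)
      (fun _ _ => measurable_const) fun _ _ _ => le_rfl
    have h2 : P {ω | x ≤ M ω} = ∑ k ∈ Finset.range (n + 1),
        ∫⁻ ω in firstPassage (fun k ω => φ (driftWalk V θ n k ω)) x k, 1 ∂P := by
      rw [← lintegral_biUnion_finset (fun i _ j _ hij => disjoint_firstPassage _ x hij)
        fun k _ => measurableSet_firstPassage fun j _ => hUm j, biUnion_firstPassage,
        setLIntegral_one]
      congr 1
      ext ω
      simp only [hM, Set.mem_ofPred_eq, Finset.le_sup'_iff, Finset.mem_range, Nat.lt_succ_iff]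
    rw [h2]
    simpa using h1
  calc _ ≤ c * ∫⁻ ω, ENNReal.ofReal (M ω) ∂P := by
        gcongr with ω
        exact hle ω
    _ = ∫⁻ x in Set.Ioi 0, c * P {ω | x ≤ M ω} := by
        rw [lintegral_eq_lintegral_meas_le P (ae_of_all _ hM0) hMm.aemeasurable,
          lintegral_const_mul']
        exact measure_ne_top _ _
    _ ≤ ∫⁻ x in Set.Ioi 0, P {ω | x ≤ φ (driftWalk V θ n n ω)} :=
        lintegral_mono fun x => hlevel x
    _ = ∫⁻ ω, ENNReal.ofReal (φ (driftWalk V θ n n ω)) ∂P :=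
        (lintegral_eq_lintegral_meas_le P (ae_of_all _ fun ω => (Real.exp_pos _).le)
          (hUm n).aemeasurable).symm
    _ ≤ _ := by
        rw [lintegral_exp_driftWalk_final hV hn]
        gcongr
        exact (le_abs_self θ).trans hθ

/-- The one-sided bound is applied to the walk and to its negative, which is a Brownian walk with
drift `-θ`; this explains the factor `2`. -/
theorem lintegral_sup_exp_abs_driftWalk_le {K : ℝ} (hθ : |θ| ≤ K) (hV : IsPreBrownianReal V P)
    (hVm : ∀ t, Measurable (V t)) {n : ℕ} (hn : 0 < n) {a : ℝ} (ha : 0 ≤ a) :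
    ∫⁻ ω, (Finset.range (n + 1)).sup
        (fun k => ENNReal.ofReal (Real.exp (a * |driftWalk V θ n k ω|))) ∂P ≤
      (gaussianReal 0 1 (Set.Ici K))⁻¹ * (2 * ENNReal.ofReal (Real.exp (a * K + a ^ 2 / 2))) := by
  set c := gaussianReal 0 1 (Set.Ici K) with hc
  have hc0 : c ≠ 0 := gaussianReal_Ici_pos K
  have hct : c ≠ ∞ := measure_ne_top _ _
  have h1 := lintegral_sup_exp_driftWalk_le hθ hV hVm hn ha
  have h2 := lintegral_sup_exp_driftWalk_le (V := -V) (θ := -θ) (K := K) (by rwa [abs_neg]) hV.neg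
    (fun t => (hVm t).neg) hn ha
  simp_rw [driftWalk_neg] at h2
  rw [← ENNReal.mul_le_iff_le_inv hc0 hct, two_mul]
  refine le_trans ?_ (add_le_add h1 h2)
  rw [← mul_add, ← lintegral_add_left]
  · gcongr with ω
    refine Finset.sup_le fun k hk => ?_
    rcases abs_choice (driftWalk V θ n k ω) with h | h <;> rw [h]
    · exact le_add_right (Finset.le_sup
        (f := fun k => ENNReal.ofReal (Real.exp (a * driftWalk V θ n k ω))) hk)
    · exact le_add_left (Finset.le_sup
        (f := fun k => ENNReal.ofReal (Real.exp (a * -driftWalk V θ n k ω))) hk)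
  · exact measurable_finset_sup _ fun k _ => ENNReal.measurable_ofReal.comp
      (Real.measurable_exp.comp ((measurable_driftWalk hVm n k).const_mul a))

end DriftWalk

/-! ### The bridge and the deviation from the line. -/

/-- The Brownian bridge is independent of the final value. -/
theorem ProbabilityTheory.IsPreBrownianReal.indepFun_bridge {Ω : Type*} {mΩ : MeasurableSpace Ω}
    {P : Measure Ω} {V : ℝ≥0 → Ω → ℝ} (hV : IsPreBrownianReal V P) :
    IndepFun (fun ω (s : Set.Iic (1 : ℝ≥0)) => V s ω - (s : ℝ≥0) * V 1 ω)
      (fun ω (_ : Unit) => V 1 ω) P := by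
  have mV t := hV.aemeasurable t
  -- Bridge and final value are jointly Gaussian, being linear in `V`, and their covariance is `s -
  -- s = 0`.
  apply IsGaussianProcess.indepFun_of_covariance_eq_zero
  · apply hV.isGaussianProcess.of_isGaussianProcess
    rintro (⟨s, hs⟩ | u)
    · exact ⟨{s, 1},
        { toFun x := x ⟨s, by simp⟩ - (s : ℝ) * x ⟨1, by simp⟩
          map_add' x y := by simp; ring
          map_smul' c x := by simp; ring }, by simp⟩
    · exact ⟨{1},
        { toFun x := x ⟨1, by simp⟩
          map_add' x y := by simp
          map_smul' c x := by simp }, by simp⟩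
  · exact fun s => (mV _).sub ((mV 1).const_mul _)
  · exact fun _ => mV 1
  · rintro ⟨s, hs : s ≤ 1⟩ u
    have := hV.isGaussianProcess.isProbabilityMeasure
    have h2 : ∀ t, MemLp (V t) 2 P := fun t =>
      (hV.isGaussianProcess.hasGaussianLaw_eval t).memLp_two
    rw [covariance_fun_sub_left (h2 _) ((h2 1).const_mul _) (h2 1), covariance_const_mul_left,
      hV.covariance_eval, hV.covariance_eval, min_eq_left hs]
    simp

section DriftWalk

variable {Ω : Type*} {mΩ : MeasurableSpace Ω} {P : Measure Ω} {V : ℝ≥0 → Ω → ℝ} {θ : ℝ}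

/-- The bound for `𝔼 max_k exp (a |Y_k|)` of a Brownian walk `Y` on `[0, 1]` with drift at
most `K`. -/
noncomputable def maxExpConst (a K : ℝ) : ℝ≥0∞ :=
  (gaussianReal 0 1 (Set.Ici K))⁻¹ * (2 * ENNReal.ofReal (Real.exp (a * K + a ^ 2 / 2)))

theorem maxExpConst_ne_top (a K : ℝ) : maxExpConst a K ≠ ∞ :=
  ENNReal.mul_ne_top (ENNReal.inv_ne_top.2 (gaussianReal_Ici_pos K))
    (ENNReal.mul_ne_top (by simp) ENNReal.ofReal_ne_top)

/-- The largest exponential deviation, up to step `k`, of a walk from the line of slope `y`. -/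
noncomputable def lineDeviation (V : ℝ≥0 → Ω → ℝ) (θ a y : ℝ) (n k : ℕ) (ω : Ω) : ℝ≥0∞ :=
  (Finset.range (k + 1)).sup fun j =>
    ENNReal.ofReal (Real.exp (a * |driftWalk V θ n j ω - y * ((j : ℝ) / n)|))

theorem measurable_lineDeviation_past (a y : ℝ) (n k : ℕ) :
    Measurable[pastAlgebra V ((k : ℝ≥0) / n)] (lineDeviation V θ a y n k) :=
  measurable_finset_sup (m := pastAlgebra V ((k : ℝ≥0) / n)) _ fun _ hj =>
    ENNReal.measurable_ofReal.comp (Real.measurable_exp.comp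
      ((measurable_norm.comp ((measurable_driftWalk_past
        (Nat.lt_succ_iff.1 (Finset.mem_range.1 hj))).sub_const _)).const_mul a))

theorem lineDeviation_mono (a y : ℝ) {n j k : ℕ} (h : j ≤ k) (ω : Ω) :
    lineDeviation V θ a y n j ω ≤ lineDeviation V θ a y n k ω :=
  Finset.sup_mono (Finset.range_mono (Nat.succ_le_succ h))

/-- On the event that the walk ends above the level, its deviation from the line is controlled
through the independence of the bridge and the final value. -/
theorem lintegral_lineDeviation_final_le {K : ℝ} (hθ : |θ| ≤ K) (hV : IsPreBrownianReal V P)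
    (hVm : ∀ t, Measurable (V t)) {n : ℕ} (hn : 0 < n) {a y : ℝ} (ha : 0 ≤ a) (hy : 0 < y) :
    ∫⁻ ω in {ω | y ≤ driftWalk V θ n n ω}, lineDeviation V θ a y n n ω ∂P ≤
      maxExpConst (2 * a) K * (ENNReal.ofReal (2 * Real.exp ((2 * a + K) ^ 2 / 6)) *
        P {ω | y ≤ driftWalk V θ n n ω}) := by
  have hn' : (0 : ℝ) < n := by exact_mod_cast hn
  have hset : MeasurableSet {ω | y ≤ driftWalk V θ n n ω} :=
    measurableSet_le measurable_const (measurable_driftWalk hVm n n)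
  -- At time `s = j / n` the deviation is the bridge `V s - s V 1` plus `s` times the overshoot `V 1
  -- + θ - y`; the drift, being linear in time, does not enter the bridge. `β` carries the bridge
  -- and `ψ` the overshoot, and the two are independent.
  set β : Ω → ℝ≥0∞ := fun ω => (Finset.range (n + 1)).sup fun j =>
    ENNReal.ofReal (Real.exp (a * |V ((j : ℝ≥0) / n) ω - (j : ℝ) / n * V 1 ω|)) with hβ
  set ψ : ℝ → ℝ≥0∞ := fun x => (Set.Ici (0 : ℝ)).indicator
    (fun x => ENNReal.ofReal (Real.exp (a * x))) (x + θ - y) with hψ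
  have hψm : Measurable ψ := by
    have : Measurable ((Set.Ici (0 : ℝ)).indicator
      (fun x => ENNReal.ofReal (Real.exp (a * x)))) :=
      Measurable.indicator (by fun_prop) measurableSet_Ici
    exact this.comp (by fun_prop)
  have hβm : Measurable β := measurable_finset_sup _ fun j _ => by
    have h1 := hVm ((j : ℝ≥0) / n)
    have h2 := hVm 1
    fun_prop
  have hind : IndepFun β (fun ω => ψ (V 1 ω)) P := by
    have hb := hV.indepFun_bridge
    set B : (Set.Iic (1 : ℝ≥0) → ℝ) → ℝ≥0∞ := fun b => (Finset.range (n + 1)).sup fun j =>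
      if hj : (j : ℝ≥0) / n ≤ 1 then
        ENNReal.ofReal (Real.exp (a * |b ⟨(j : ℝ≥0) / n, hj⟩|)) else 0 with hB
    have hBm : Measurable B := measurable_finset_sup _ fun j _ => by
      by_cases hj : (j : ℝ≥0) / n ≤ 1
      · simp only [hj, dite_true]
        fun_prop
      · simp only [hj, dite_false]
        fun_prop
    have hc := hb.comp hBm (hψm.comp (measurable_pi_apply ()))
    convert! hc using 1
    ext ω
    simp only [hβ, hB, Function.comp_apply]
    refine Finset.sup_congr rfl fun j hj => ?_
    have hj1 : (j : ℝ≥0) / n ≤ 1 := by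
      rw [← NNReal.coe_le_coe]; push_cast
      rw [div_le_one hn']
      exact_mod_cast Nat.lt_succ_iff.1 (Finset.mem_range.1 hj)
    simp [hj1]
  have hpt : ∀ ω, {ω | y ≤ driftWalk V θ n n ω}.indicator (lineDeviation V θ a y n n) ω ≤
      β ω * ψ (V 1 ω) := fun ω => by
    by_cases hω : ω ∈ {ω | y ≤ driftWalk V θ n n ω}
    · rw [Set.indicator_of_mem hω]
      have hω' : y ≤ V 1 ω + θ := by
        have : y ≤ driftWalk V θ n n ω := hω
        rwa [driftWalk_self hn] at this
      have hmem : V 1 ω + θ - y ∈ Set.Ici (0 : ℝ) := sub_nonneg.2 hω'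
      simp only [hψ, Set.indicator_of_mem hmem]
      refine Finset.sup_le fun j hj => ?_
      refine le_trans ?_ (mul_le_mul_left (Finset.le_sup (f := fun j : ℕ => ENNReal.ofReal
        (Real.exp (a * |V ((j : ℝ≥0) / n) ω - (j : ℝ) / n * V 1 ω|))) hj) _)
      rw [← ENNReal.ofReal_mul (Real.exp_pos _).le, ← Real.exp_add, ← mul_add]
      refine ENNReal.ofReal_le_ofReal (Real.exp_le_exp.2 (mul_le_mul_of_nonneg_left ?_ ha))
      have hj0 : 0 ≤ (j : ℝ) / n := by positivity
      have hj1 : (j : ℝ) / n ≤ 1 := by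
        rw [div_le_one hn']; exact_mod_cast Nat.lt_succ_iff.1 (Finset.mem_range.1 hj)
      have e : driftWalk V θ n j ω - y * ((j : ℝ) / n) =
          (V ((j : ℝ≥0) / n) ω - (j : ℝ) / n * V 1 ω) + (j : ℝ) / n * (V 1 ω + θ - y) := by
        rw [driftWalk]; ring
      rw [e]
      refine (abs_add_le _ _).trans (add_le_add le_rfl ?_)
      rw [abs_of_nonneg (mul_nonneg hj0 hmem)]
      exact mul_le_of_le_one_left hmem hj1
    · rw [Set.indicator_of_notMem hω]; exact zero_le
  -- The bridge is also the walk minus `j / n` times its final value, hence at most twice the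
  -- largest absolute value of the walk; this doubles `a`.
  have hβint : ∫⁻ ω, β ω ∂P ≤ maxExpConst (2 * a) K := by
    refine le_trans (lintegral_mono fun ω => ?_)
      (lintegral_sup_exp_abs_driftWalk_le hθ hV hVm hn (mul_nonneg two_pos.le ha))
    refine Finset.sup_le fun j hj => ?_
    have hj1 : (j : ℝ) / n ≤ 1 := by
      rw [div_le_one hn']; exact_mod_cast Nat.lt_succ_iff.1 (Finset.mem_range.1 hj)
    have hj0 : 0 ≤ (j : ℝ) / n := by positivity
    have e : V ((j : ℝ≥0) / n) ω - (j : ℝ) / n * V 1 ω =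
        driftWalk V θ n j ω - (j : ℝ) / n * driftWalk V θ n n ω := by
      rw [driftWalk_self hn, driftWalk]; ring
    rw [e]
    have hb : |driftWalk V θ n j ω - (j : ℝ) / n * driftWalk V θ n n ω| ≤
        |driftWalk V θ n j ω| + |driftWalk V θ n n ω| := by
      refine (abs_sub _ _).trans (add_le_add le_rfl ?_)
      rw [abs_mul, abs_of_nonneg hj0]
      exact mul_le_of_le_one_left (abs_nonneg _) hj1
    rcases le_total |driftWalk V θ n j ω| |driftWalk V θ n n ω| with h | h
    · refine le_trans ?_ (Finset.le_sup (f := fun k => ENNReal.ofReal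
        (Real.exp (2 * a * |driftWalk V θ n k ω|))) (Finset.self_mem_range_succ n))
      refine ENNReal.ofReal_le_ofReal (Real.exp_le_exp.2 ?_)
      nlinarith
    · refine le_trans ?_ (Finset.le_sup (f := fun k => ENNReal.ofReal
        (Real.exp (2 * a * |driftWalk V θ n k ω|))) hj)
      refine ENNReal.ofReal_le_ofReal (Real.exp_le_exp.2 ?_)
      nlinarith
  have hlaw : HasLaw (fun ω => V 1 ω + (θ - y)) (gaussianReal (θ - y) 1) P := by
    simpa using gaussianReal_add_const (hV.hasLaw_eval 1) (θ - y)
  have hψint : ∫⁻ ω, ψ (V 1 ω) ∂P ≤ ENNReal.ofReal (2 * Real.exp ((2 * a + K) ^ 2 / 6)) *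
        P {ω | y ≤ driftWalk V θ n n ω} := by
    have h1 : ∫⁻ ω, ψ (V 1 ω) ∂P =
        ∫⁻ x in Set.Ici 0, ENNReal.ofReal (Real.exp (a * x)) ∂gaussianReal (θ - y) 1 := by
      rw [← lintegral_indicator measurableSet_Ici, ← hlaw.lintegral_comp]
      · simp only [hψ, add_sub_assoc]
      · exact (Measurable.indicator (by fun_prop) measurableSet_Ici).aemeasurable
    have h2 : P {ω | y ≤ driftWalk V θ n n ω} = gaussianReal (θ - y) 1 (Set.Ici 0) := by
      rw [← hlaw.map_eq, Measure.map_apply_of_aemeasurable hlaw.aemeasurable measurableSet_Ici]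
      congr 1
      ext ω
      simp only [Set.mem_ofPred_eq, driftWalk_self hn, Set.mem_preimage, Set.mem_Ici]
      constructor <;> intro h <;> linarith
    rw [h1, h2]
    exact lintegral_exp_Ici_gaussianReal_le (by linarith [le_abs_self θ])
  rw [← lintegral_indicator hset]
  calc _ ≤ ∫⁻ ω, β ω * ψ (V 1 ω) ∂P := lintegral_mono hpt
    _ = (∫⁻ ω, β ω ∂P) * ∫⁻ ω, ψ (V 1 ω) ∂P :=
        lintegral_mul_eq_lintegral_mul_lintegral_of_indepFun'' hβm.aemeasurable
          (hψm.comp (hVm 1)).aemeasurable hind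
    _ ≤ _ := mul_le_mul' hβint hψint

/-- The constant in the conditional exponential moment bound. -/
noncomputable def barrierConst (a K : ℝ) : ℝ≥0∞ :=
  maxExpConst (2 * a) K * ((gaussianReal 0 1 (Set.Ici K))⁻¹ *
    (maxExpConst (2 * a) K * ENNReal.ofReal (2 * Real.exp ((2 * a + K) ^ 2 / 6))))

theorem barrierConst_ne_top (a K : ℝ) : barrierConst a K ≠ ∞ :=
  ENNReal.mul_ne_top (maxExpConst_ne_top _ _) (ENNReal.mul_ne_top
    (ENNReal.inv_ne_top.2 (gaussianReal_Ici_pos K))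
    (ENNReal.mul_ne_top (maxExpConst_ne_top _ _) ENNReal.ofReal_ne_top))

/-- On the event that a Brownian walk with drift reaches a level, its largest deviation from the
line to that level has bounded conditional exponential moments. -/
theorem lintegral_lineDeviation_le {K : ℝ} (hθ : |θ| ≤ K) (hV : IsPreBrownianReal V P)
    (hVm : ∀ t, Measurable (V t)) {n : ℕ} (hn : 0 < n) {a y : ℝ} (ha : 0 ≤ a) (hy : 0 < y) :
    ∫⁻ ω in {ω | ∃ k ≤ n, y ≤ driftWalk V θ n k ω}, lineDeviation V θ a y n n ω ∂P ≤
      barrierConst a K * P {ω | ∃ k ≤ n, y ≤ driftWalk V θ n k ω} := by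
  have hn' : (0 : ℝ) < n := by exact_mod_cast hn
  set c := gaussianReal 0 1 (Set.Ici K) with hc
  have hc0 : c ≠ 0 := gaussianReal_Ici_pos K
  have hct : c ≠ ∞ := measure_ne_top _ _
  set E : ℕ → Set Ω := fun k => firstPassage (driftWalk V θ n) y k with hE
  have hEm : ∀ k : ℕ, MeasurableSet[pastAlgebra V ((k : ℝ≥0) / n)] (E k) := fun k =>
    measurableSet_firstPassage (m := pastAlgebra V ((k : ℝ≥0) / n)) fun j hj =>
      measurable_driftWalk_past hj
  have hEm' : ∀ k, MeasurableSet (E k) := fun k => pastAlgebra_le hVm _ _ (hEm k)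
  have hk' : ∀ k ∈ Finset.range (n + 1), k ≤ n := fun k hk =>
    Nat.lt_succ_iff.1 (Finset.mem_range.1 hk)
  -- The exponential displacement after step `k`. It depends on the future only.
  set R : ℕ → Ω → ℝ≥0∞ := fun k ω => (Finset.range (n - k + 1)).sup fun j =>
    ENNReal.ofReal (Real.exp (a * |driftWalk V θ n (k + j) ω - driftWalk V θ n k ω|)) with hR
  have hRm : ∀ k : ℕ, Measurable[futureAlgebra V ((k : ℝ≥0) / n)] (R k) := fun k =>
    measurable_finset_sup (m := futureAlgebra V ((k : ℝ≥0) / n)) _ fun j _ =>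
      ENNReal.measurable_ofReal.comp (Real.measurable_exp.comp
        ((measurable_norm.comp (measurable_driftWalk_future n j k)).const_mul a))
  have hRint : ∀ k ≤ n, ∫⁻ ω, R k ω ∂P ≤ maxExpConst (2 * a) K := fun k hk => by
    refine le_trans (lintegral_mono fun ω => ?_)
      (lintegral_sup_exp_abs_driftWalk_le hθ hV hVm hn (mul_nonneg two_pos.le ha))
    refine Finset.sup_le fun j hj => ?_
    have hj' := Finset.mem_range.1 hj
    have hb := abs_sub (driftWalk V θ n (k + j) ω) (driftWalk V θ n k ω)
    rcases le_total |driftWalk V θ n (k + j) ω| |driftWalk V θ n k ω| with h | h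
    · refine le_trans ?_ (Finset.le_sup (f := fun k => ENNReal.ofReal
        (Real.exp (2 * a * |driftWalk V θ n k ω|))) (Finset.mem_range.2 (by omega : k < n + 1)))
      refine ENNReal.ofReal_le_ofReal (Real.exp_le_exp.2 ?_)
      nlinarith
    · refine le_trans ?_ (Finset.le_sup (f := fun k => ENNReal.ofReal
        (Real.exp (2 * a * |driftWalk V θ n k ω|)))
          (Finset.mem_range.2 (by omega : k + j < n + 1)))
      refine ENNReal.ofReal_le_ofReal (Real.exp_le_exp.2 ?_)
      nlinarith
  -- After step `k` the line has risen but is still at most `y`, which the walk has reached at `k`.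
  -- So the value at `k` exceeds the later line by a nonnegative amount no larger than the deviation
  -- at `k`, and only the displacement since `k` is added.
  have hpt : ∀ k ≤ n, ∀ ω ∈ E k,
      lineDeviation V θ a y n n ω ≤ lineDeviation V θ a y n k ω * R k ω := fun k hk ω hω => by
    refine Finset.sup_le fun i hi => ?_
    have hi := Finset.mem_range.1 hi
    have hR0 : (1 : ℝ≥0∞) ≤ R k ω := by
      refine le_trans ?_ (Finset.le_sup (f := fun j => ENNReal.ofReal
        (Real.exp (a * |driftWalk V θ n (k + j) ω - driftWalk V θ n k ω|)))
        (Finset.mem_range.2 (Nat.succ_pos _) : 0 ∈ Finset.range (n - k + 1)))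
      simp
    rcases le_total i k with hik | hik
    · refine le_trans ?_ (le_mul_of_one_le_right zero_le hR0)
      exact Finset.le_sup (f := fun j => ENNReal.ofReal (Real.exp (a *
        |driftWalk V θ n j ω - y * ((j : ℝ) / n)|))) (Finset.mem_range.2 (by omega))
    · obtain ⟨j, rfl⟩ := Nat.exists_eq_add_of_le hik
      refine le_trans ?_ (mul_le_mul'
        (Finset.le_sup (f := fun j => ENNReal.ofReal (Real.exp (a *
          |driftWalk V θ n j ω - y * ((j : ℝ) / n)|))) (Finset.self_mem_range_succ k))
        (Finset.le_sup (f := fun j => ENNReal.ofReal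
          (Real.exp (a * |driftWalk V θ n (k + j) ω - driftWalk V θ n k ω|)))
          (Finset.mem_range.2 (by omega : j < n - k + 1))))
      rw [← ENNReal.ofReal_mul (Real.exp_pos _).le, ← Real.exp_add, ← mul_add]
      refine ENNReal.ofReal_le_ofReal (Real.exp_le_exp.2 (mul_le_mul_of_nonneg_left ?_ ha))
      have h1 : y ≤ driftWalk V θ n k ω := hω.1
      have h2 : ((k + j : ℕ) : ℝ) / n ≤ 1 := by
        rw [div_le_one hn']; exact_mod_cast Nat.lt_succ_iff.1 hi
      have h3 : (k : ℝ) / n ≤ ((k + j : ℕ) : ℝ) / n := by gcongr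
      have h4 : y * ((k + j : ℕ) / n : ℝ) ≤ y := mul_le_of_le_one_right hy.le h2
      have h5 : y * ((k : ℝ) / n) ≤ y * (((k + j : ℕ) : ℝ) / n) := by gcongr
      rw [abs_of_nonneg (by linarith : 0 ≤ driftWalk V θ n k ω - y * ((k : ℝ) / n))]
      have h6 := abs_le.1 (le_refl |driftWalk V θ n (k + j) ω - driftWalk V θ n k ω|)
      rw [abs_le]
      constructor <;> linarith
  have hstep : ∀ k ≤ n, ∫⁻ ω in E k, lineDeviation V θ a y n n ω ∂P ≤
      maxExpConst (2 * a) K * ∫⁻ ω in E k, lineDeviation V θ a y n k ω ∂P := fun k hk => by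
    calc _ = ∫⁻ ω, (E k).indicator (lineDeviation V θ a y n n) ω ∂P :=
          (lintegral_indicator (hEm' k) _).symm
      _ ≤ ∫⁻ ω, (E k).indicator (lineDeviation V θ a y n k) ω * R k ω ∂P := by
          refine lintegral_mono fun ω => ?_
          by_cases hω : ω ∈ E k
          · simpa [hω] using hpt k hk ω hω
          · simp [hω]
      _ = (∫⁻ ω, (E k).indicator (lineDeviation V θ a y n k) ω ∂P) * ∫⁻ ω, R k ω ∂P :=
          lintegral_mul_eq_lintegral_mul_lintegral_of_independent_measurableSpace
            (pastAlgebra_le hVm _) (futureAlgebra_le hVm _) (indep_pastAlgebra_futureAlgebra hV _)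
            ((measurable_lineDeviation_past a y n k).indicator (hEm k)) (hRm k)
      _ ≤ _ := by
          rw [lintegral_indicator (hEm' k), mul_comm]
          gcongr
          exact hRint k hk
  -- The deviation up to step `k` depends on the past and grows with `k`, so reflection moves its
  -- integral over the first passages to the event that the walk ends above `y`.
  have hrefl := driftWalk_reflection_le hθ hV hVm hn monotone_id y
    (f := fun k => lineDeviation V θ a y n k) (fun k _ => measurable_lineDeviation_past a y n k)
    fun k hk ω => lineDeviation_mono a y hk ω
  simp only [id] at hrefl
  rw [ENNReal.mul_le_iff_le_inv hc0 hct] at hrefl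
  calc _ = ∑ k ∈ Finset.range (n + 1), ∫⁻ ω in E k, lineDeviation V θ a y n n ω ∂P := by
        rw [← biUnion_firstPassage, lintegral_biUnion_finset
          (fun i _ j _ hij => disjoint_firstPassage _ y hij) fun k _ => hEm' k]
    _ ≤ ∑ k ∈ Finset.range (n + 1),
          maxExpConst (2 * a) K * ∫⁻ ω in E k, lineDeviation V θ a y n k ω ∂P :=
        Finset.sum_le_sum fun k hk => hstep k (hk' k hk)
    _ = maxExpConst (2 * a) K * ∑ k ∈ Finset.range (n + 1),
          ∫⁻ ω in E k, lineDeviation V θ a y n k ω ∂P := (Finset.mul_sum _ _ _).symm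
    _ ≤ maxExpConst (2 * a) K * (c⁻¹ * (maxExpConst (2 * a) K *
          (ENNReal.ofReal (2 * Real.exp ((2 * a + K) ^ 2 / 6)) *
            P {ω | ∃ k ≤ n, y ≤ driftWalk V θ n k ω}))) := by
        gcongr
        refine hrefl.trans ?_
        gcongr
        refine (lintegral_lineDeviation_final_le hθ hV hVm hn ha hy).trans ?_
        gcongr
        exact fun h => ⟨n, le_rfl, h⟩
    _ = _ := by rw [barrierConst]; ring

end DriftWalk

/-! ### Passage to continuous time. -/

theorem exists_le_of_forall_exists_le {x : ℝ≥0 → ℝ} (hx : Continuous x) (t : ℝ≥0) {b : ℕ → ℝ}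
    {c : ℝ} (hb : Filter.Tendsto b Filter.atTop (nhds c)) (h : ∀ m, ∃ s ≤ t, b m ≤ x s) :
    ∃ s ≤ t, c ≤ x s := by
  obtain ⟨s, hs, hmax⟩ := (isCompact_Icc (a := (0 : ℝ≥0)) (b := t)).exists_isMaxOn
    ⟨0, by simp⟩ hx.continuousOn
  refine ⟨s, hs.2, le_of_tendsto' hb fun m => ?_⟩
  obtain ⟨u, hu, hle⟩ := h m
  exact hle.trans (hmax ⟨zero_le, hu⟩)

theorem measurableSet_exists_le {Ω : Type*} {mΩ : MeasurableSpace Ω} {X : ℝ≥0 → Ω → ℝ}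
    (hX : ∀ t, Measurable (X t)) (hc : ∀ ω, Continuous fun t => X t ω) (t : ℝ≥0) (a : ℝ) :
    MeasurableSet {ω | ∃ s ≤ t, a ≤ X s ω} := by
  have hlim : Filter.Tendsto (fun j : ℕ => a - 1 / ((j : ℝ) + 1)) Filter.atTop (nhds a) := by
    simpa using tendsto_one_div_add_atTop_nhds_zero_nat.const_sub a
  have : {ω | ∃ s ≤ t, a ≤ X s ω} = ⋂ j : ℕ, {ω | ∃ s ≤ t, a - 1 / ((j : ℝ) + 1) < X s ω} := by
    ext ω
    simp only [Set.mem_ofPred_eq, Set.mem_iInter]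
    constructor
    · rintro ⟨s, hs, hle⟩ j
      have : (0 : ℝ) < 1 / ((j : ℝ) + 1) := by positivity
      exact ⟨s, hs, by linarith⟩
    · exact fun h => exists_le_of_forall_exists_le (hc ω) t hlim fun m =>
        (h m).imp fun s hs => ⟨hs.1, hs.2.le⟩
  rw [this]
  exact MeasurableSet.iInter fun j => measurableSet_exists_lt hX hc t _

section Continuous

variable {Ω : Type*} {mΩ : MeasurableSpace Ω} {P : Measure Ω} {V : ℝ≥0 → Ω → ℝ} {θ : ℝ}

/-- The largest exponential deviation on `[0, 1]` of a process with drift from the line of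
slope `y`. -/
noncomputable def lineDeviationSup (V : ℝ≥0 → Ω → ℝ) (θ a y : ℝ) (ω : Ω) : ℝ≥0∞ :=
  ⨆ t : Set.Icc (0 : ℝ≥0) 1,
    ENNReal.ofReal (Real.exp (a * |V t ω + θ * (t : ℝ≥0) - y * (t : ℝ≥0)|))

theorem exists_grid_tendsto {x : ℝ≥0 → ℝ} (hx : Continuous x) {t : ℝ≥0} (ht : t ≤ 1) :
    ∃ k : ℕ → ℕ, (∀ n, k n ≤ n + 1) ∧
      Filter.Tendsto (fun n => x ((k n : ℝ≥0) / ((n + 1 : ℕ) : ℝ≥0))) Filter.atTop (nhds (x t)) := by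
  refine ⟨fun n => ⌊t * ((n + 1 : ℕ) : ℝ≥0)⌋₊, fun n => ?_, ?_⟩
  · refine Nat.floor_le_of_le ?_
    exact mul_le_of_le_one_left zero_le ht
  · refine (hx.tendsto t).comp ?_
    have h := tendsto_nat_floor_mul_div_atTop (R := ℝ) (a := t) t.2
    have h2 : Filter.Tendsto (fun n : ℕ => ((n + 1 : ℕ) : ℝ)) Filter.atTop Filter.atTop :=
      tendsto_natCast_atTop_atTop.comp (Filter.tendsto_add_atTop_nat 1)
    have h3 := h.comp h2
    rw [← NNReal.tendsto_coe]
    convert! h3 using 1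

/-- Fatou's lemma along refining grids. Two levels are needed: a path may reach `y` without doing so
at any grid point, but it then exceeds the lower level `z` on all sufficiently fine grids. -/
theorem lintegral_lineDeviationSup_le_of_lt {K : ℝ} (hθ : |θ| ≤ K) (hV : IsPreBrownianReal V P)
    (hVm : ∀ t, Measurable (V t)) (hVc : ∀ ω, Continuous fun t => V t ω) {a y z : ℝ}
    (ha : 0 ≤ a) (hz : 0 < z) (hzy : z < y) :
    ∫⁻ ω in {ω | ∃ t ≤ (1 : ℝ≥0), y ≤ V t ω + θ * t}, lineDeviationSup V θ a z ω ∂P ≤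
      barrierConst a K * P {ω | ∃ t ≤ (1 : ℝ≥0), z ≤ V t ω + θ * t} := by
  have hYm : ∀ t : ℝ≥0, Measurable fun ω => V t ω + θ * t := fun t => (hVm t).add_const _
  have hYc : ∀ ω, Continuous fun t : ℝ≥0 => V t ω + θ * t := fun ω =>
    (hVc ω).add (by fun_prop)
  have hA := measurableSet_exists_le hYm hYc 1 y
  set A := {ω | ∃ t ≤ (1 : ℝ≥0), y ≤ V t ω + θ * t} with hAdef
  set A' : ℕ → Set Ω := fun n => {ω | ∃ k ≤ n + 1, z ≤ driftWalk V θ (n + 1) k ω} with hA'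
  have hA'm : ∀ n, MeasurableSet (A' n) := fun n => by
    simp only [hA']
    rw [← biUnion_firstPassage]
    exact Finset.measurableSet_biUnion _ fun k _ =>
      measurableSet_firstPassage fun j _ => measurable_driftWalk hVm _ j
  set g : ℕ → Ω → ℝ≥0∞ := fun n => (A' n).indicator (lineDeviation V θ a z (n + 1) (n + 1)) with hg
  have hgm : ∀ n, Measurable (g n) := fun n =>
    ((measurable_lineDeviation_past a z (n + 1) (n + 1)).mono (pastAlgebra_le hVm _)
      le_rfl).indicator (hA'm n)
  have hwalk : ∀ (n k : ℕ) (ω : Ω), driftWalk V θ (n + 1) k ω =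
      V ((k : ℝ≥0) / ((n + 1 : ℕ) : ℝ≥0)) ω +
        θ * (((k : ℝ≥0) / ((n + 1 : ℕ) : ℝ≥0) : ℝ≥0) : ℝ) := fun n k ω => by
    simp [driftWalk]
  have hpt : ∀ ω, A.indicator (lineDeviationSup V θ a z) ω ≤
      Filter.liminf (fun n => g n ω) Filter.atTop := fun ω => by
    by_cases hω : ω ∈ A
    · rw [Set.indicator_of_mem hω]
      obtain ⟨t₀, ht₀, hle⟩ := hω
      obtain ⟨k₀, hk₀, hlim₀⟩ := exists_grid_tendsto (hYc ω) ht₀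
      have hev : ∀ᶠ n in Filter.atTop, ω ∈ A' n := by
        filter_upwards [hlim₀.eventually_const_lt (hzy.trans_le hle)] with n hn
        exact ⟨k₀ n, hk₀ n, by rw [hwalk]; exact hn.le⟩
      refine iSup_le fun t => ?_
      have hDc : Continuous fun s : ℝ≥0 => Real.exp (a * |V s ω + θ * s - z * s|) := by
        have := hVc ω
        fun_prop
      obtain ⟨k, hk, hlim⟩ := exists_grid_tendsto hDc t.2.2
      have hlim' := (ENNReal.continuous_ofReal.tendsto _).comp hlim
      refine le_trans (le_of_eq hlim'.liminf_eq.symm) (Filter.liminf_le_liminf ?_)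
      filter_upwards [hev] with n hn
      simp only [hg, Set.indicator_of_mem hn, Function.comp_apply]
      refine le_trans (le_of_eq ?_) (Finset.le_sup (f := fun j => ENNReal.ofReal (Real.exp (a *
        |driftWalk V θ (n + 1) j ω - z * ((j : ℝ) / (n + 1 : ℕ))|)))
        (Finset.mem_range.2 (Nat.lt_succ_of_le (hk n))))
      simp only [hwalk]
      push_cast
      rfl
    · rw [Set.indicator_of_notMem hω]; exact zero_le
  have hbound : ∀ n, ∫⁻ ω, g n ω ∂P ≤
      barrierConst a K * P {ω | ∃ t ≤ (1 : ℝ≥0), z ≤ V t ω + θ * t} := fun n => by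
    rw [hg, lintegral_indicator (hA'm n)]
    refine (lintegral_lineDeviation_le hθ hV hVm (Nat.succ_pos n) ha hz).trans ?_
    gcongr
    rintro ⟨k, hk, hle⟩
    refine ⟨(k : ℝ≥0) / ((n + 1 : ℕ) : ℝ≥0), ?_, by rwa [← hwalk]⟩
    have : ((n + 1 : ℕ) : ℝ≥0) ≠ 0 := by exact_mod_cast (Nat.succ_ne_zero n)
    exact div_le_one_of_le₀ (by exact_mod_cast hk) zero_le
  rw [← lintegral_indicator hA]
  calc _ ≤ ∫⁻ ω, Filter.liminf (fun n => g n ω) Filter.atTop ∂P := lintegral_mono hpt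
    _ ≤ Filter.liminf (fun n => ∫⁻ ω, g n ω ∂P) Filter.atTop := lintegral_liminf_le hgm
    _ ≤ _ := by
        refine (Filter.liminf_le_liminf (Filter.Eventually.of_forall hbound)).trans ?_
        simp

/-- On the event that a Brownian motion with drift reaches a level before time `1`, its largest
deviation from the line to that level has bounded conditional exponential moments. -/
theorem lintegral_lineDeviationSup_le {K : ℝ} (hθ : |θ| ≤ K) (hV : IsPreBrownianReal V P)
    (hVm : ∀ t, Measurable (V t)) (hVc : ∀ ω, Continuous fun t => V t ω) {a y : ℝ}
    (ha : 0 ≤ a) (hy : 0 < y) :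
    ∫⁻ ω in {ω | ∃ t ≤ (1 : ℝ≥0), y ≤ V t ω + θ * t}, lineDeviationSup V θ a y ω ∂P ≤
      barrierConst a K * P {ω | ∃ t ≤ (1 : ℝ≥0), y ≤ V t ω + θ * t} := by
  have hprob : IsProbabilityMeasure P := hV.isGaussianProcess.isProbabilityMeasure
  have hYm : ∀ t : ℝ≥0, Measurable fun ω => V t ω + θ * t := fun t => (hVm t).add_const _
  have hYc : ∀ ω, Continuous fun t : ℝ≥0 => V t ω + θ * t := fun ω =>
    (hVc ω).add (by fun_prop)
  set A : ℝ → Set Ω := fun z => {ω | ∃ t ≤ (1 : ℝ≥0), z ≤ V t ω + θ * t} with hA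
  have hAm : ∀ z, MeasurableSet (A z) := fun z => measurableSet_exists_le hYm hYc 1 z
  -- The levels `y - d m` are positive and increase to `y`. By compactness the hitting events
  -- decrease to that of `y`, and replacing the slope `y - d m` by `y` costs a factor `exp (a d m)`,
  -- which tends to `1`.
  set d : ℕ → ℝ := fun m => y / 2 * (1 / ((m : ℝ) + 1)) with hd
  have hd0 : ∀ m, 0 < d m := fun m => by positivity
  have hdy : ∀ m, d m < y := fun m => by
    have : 1 / ((m : ℝ) + 1) ≤ 1 := by
      rw [div_le_one (by positivity)]; linarith [(Nat.cast_nonneg m : (0 : ℝ) ≤ m)]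
    simp only [hd]; nlinarith
  have hdlim : Filter.Tendsto d Filter.atTop (nhds 0) := by
    have := (tendsto_one_div_add_atTop_nhds_zero_nat (𝕜 := ℝ)).const_mul (y / 2)
    rwa [mul_zero] at this
  have hdanti : Antitone d := fun i j hij => by
    simp only [hd]
    gcongr
  have hylim : Filter.Tendsto (fun m => y - d m) Filter.atTop (nhds y) := by
    simpa using hdlim.const_sub y
  have hanti : Antitone fun m => A (y - d m) := fun i j hij ω ⟨t, ht, hle⟩ =>
    ⟨t, ht, le_trans (by linarith [hdanti hij]) hle⟩
  have hinter : ⋂ m, A (y - d m) = A y := by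
    ext ω
    simp only [Set.mem_iInter]
    constructor
    · exact fun h => exists_le_of_forall_exists_le (hYc ω) 1 hylim h
    · rintro ⟨t, ht, hle⟩ m
      exact ⟨t, ht, by linarith [hd0 m]⟩
  have hPlim := tendsto_measure_iInter_atTop (μ := P) (fun m => (hAm (y - d m)).nullMeasurableSet)
    hanti ⟨0, measure_ne_top _ _⟩
  rw [hinter] at hPlim
  have hexp : Filter.Tendsto (fun m => ENNReal.ofReal (Real.exp (a * d m))) Filter.atTop
      (nhds 1) := by
    have : Filter.Tendsto (fun m => Real.exp (a * d m)) Filter.atTop (nhds (Real.exp (a * 0))) :=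
      (Real.continuous_exp.tendsto _).comp (hdlim.const_mul a)
    have h2 := (ENNReal.continuous_ofReal.tendsto _).comp this
    rw [mul_zero, Real.exp_zero, ENNReal.ofReal_one] at h2
    exact h2
  have hlim : Filter.Tendsto (fun m => ENNReal.ofReal (Real.exp (a * d m)) *
      (barrierConst a K * P (A (y - d m)))) Filter.atTop
      (nhds (1 * (barrierConst a K * P (A y)))) := by
    refine ENNReal.Tendsto.mul hexp (Or.inl one_ne_zero)
      (ENNReal.Tendsto.const_mul hPlim (Or.inr (barrierConst_ne_top a K))) (Or.inr ENNReal.one_ne_top)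
  rw [one_mul] at hlim
  refine ge_of_tendsto' hlim fun m => ?_
  have hdev : ∀ ω, lineDeviationSup V θ a y ω ≤
      ENNReal.ofReal (Real.exp (a * d m)) * lineDeviationSup V θ a (y - d m) ω := fun ω => by
    refine iSup_le fun t => ?_
    refine le_trans ?_ (mul_le_mul_right (le_iSup (fun t : Set.Icc (0 : ℝ≥0) 1 =>
      ENNReal.ofReal (Real.exp (a * |V t ω + θ * (t : ℝ≥0) - (y - d m) * (t : ℝ≥0)|))) t) _)
    rw [← ENNReal.ofReal_mul (Real.exp_pos _).le, ← Real.exp_add, ← mul_add]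
    refine ENNReal.ofReal_le_ofReal (Real.exp_le_exp.2 (mul_le_mul_of_nonneg_left ?_ ha))
    have ht1 : ((t : ℝ≥0) : ℝ) ≤ 1 := by exact_mod_cast t.2.2
    have ht0 : (0 : ℝ) ≤ (t : ℝ≥0) := NNReal.coe_nonneg _
    have e : V t ω + θ * (t : ℝ≥0) - y * (t : ℝ≥0) =
        -(d m * (t : ℝ≥0)) + (V t ω + θ * (t : ℝ≥0) - (y - d m) * (t : ℝ≥0)) := by ring
    rw [e]
    refine (abs_add_le _ _).trans (add_le_add ?_ le_rfl)
    rw [abs_neg, abs_of_nonneg (mul_nonneg (hd0 m).le ht0)]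
    exact mul_le_of_le_one_right (hd0 m).le ht1
  calc _ ≤ ∫⁻ ω in A y, ENNReal.ofReal (Real.exp (a * d m)) *
          lineDeviationSup V θ a (y - d m) ω ∂P := lintegral_mono hdev
    _ = ENNReal.ofReal (Real.exp (a * d m)) *
          ∫⁻ ω in A y, lineDeviationSup V θ a (y - d m) ω ∂P :=
        lintegral_const_mul' _ _ ENNReal.ofReal_ne_top
    _ ≤ _ := by
        gcongr
        exact lintegral_lineDeviationSup_le_of_lt hθ hV hVm hVc ha (by linarith [hdy m])
          (by linarith [hd0 m])

end Continuous

/-! ### Measurability of Lipschitz path functionals. -/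

/-- The supremum distance between continuous functions is determined on a dense sequence of points.
-/
theorem measurable_dist_continuousMap {Ω : Type*} {mΩ : MeasurableSpace Ω} {K : Type*}
    [TopologicalSpace K] [CompactSpace K] [TopologicalSpace.SeparableSpace K] [Nonempty K]
    {p : Ω → C(K, ℝ)} (hp : ∀ k, Measurable fun ω => p ω k) (f : C(K, ℝ)) :
    Measurable fun ω => dist (p ω) f := by
  refine measurable_of_Iic fun r => ?_
  rcases lt_or_ge r 0 with hr | hr
  · have : (fun ω => dist (p ω) f) ⁻¹' Set.Iic r = ∅ := by
      ext ω
      simp only [Set.mem_preimage, Set.mem_Iic, Set.mem_empty_iff_false, iff_false, not_le]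
      exact hr.trans_le dist_nonneg
    rw [this]; exact MeasurableSet.empty
  · have : (fun ω => dist (p ω) f) ⁻¹' Set.Iic r =
        ⋂ m, {ω | dist (p ω (TopologicalSpace.denseSeq K m)) (f (TopologicalSpace.denseSeq K m))
          ≤ r} := by
      ext ω
      simp only [Set.mem_preimage, Set.mem_Iic, Set.mem_iInter, Set.mem_ofPred_eq]
      rw [ContinuousMap.dist_le hr]
      refine ⟨fun h m => h _, fun h k => ?_⟩
      have hcl : IsClosed {k | dist (p ω k) (f k) ≤ r} :=
        isClosed_le (by fun_prop) continuous_const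
      exact (TopologicalSpace.denseRange_denseSeq K).induction_on
        (p := fun k => dist (p ω k) (f k) ≤ r) k hcl h
    rw [this]
    exact MeasurableSet.iInter fun m =>
      measurableSet_le ((hp _).dist measurable_const) measurable_const

/-- A Lipschitz functional of a measurable family of continuous functions is measurable. -/
theorem LipschitzWith.measurable_comp_continuousMap {Ω : Type*} {mΩ : MeasurableSpace Ω}
    {K : Type*} [TopologicalSpace K] [CompactSpace K] [TopologicalSpace.SeparableSpace K]
    [Nonempty K] [TopologicalSpace.SeparableSpace C(K, ℝ)] {L : ℝ≥0} {Ψ : C(K, ℝ) → ℝ}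
    (hΨ : LipschitzWith L Ψ) {p : Ω → C(K, ℝ)} (hp : ∀ k, Measurable fun ω => p ω k) :
    Measurable fun ω => Ψ (p ω) := by
  refine measurable_of_Iio fun c => ?_
  set d := TopologicalSpace.denseSeq C(K, ℝ)
  -- A Lipschitz `Ψ` is the infimum of `Ψ (d m) + L * dist · (d m)` over a dense sequence. Only the
  -- distances need to be measurable; no σ-algebra on the function space enters.
  have : (fun ω => Ψ (p ω)) ⁻¹' Set.Iio c = ⋃ m, {ω | Ψ (d m) + L * dist (p ω) (d m) < c} := by
    ext ω
    simp only [Set.mem_preimage, Set.mem_Iio, Set.mem_iUnion, Set.mem_ofPred_eq]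
    constructor
    · intro h
      have ho : IsOpen {f : C(K, ℝ) | Ψ f + L * dist (p ω) f < c} :=
        isOpen_lt (hΨ.continuous.add (by fun_prop)) continuous_const
      exact (TopologicalSpace.denseRange_denseSeq C(K, ℝ)).exists_mem_open ho
        ⟨p ω, by simpa using h⟩
    · rintro ⟨m, hm⟩
      have h1 := hΨ.dist_le_mul (p ω) (d m)
      rw [Real.dist_eq] at h1
      linarith [le_abs_self (Ψ (p ω) - Ψ (d m))]
  rw [this]
  exact MeasurableSet.iUnion fun m => measurableSet_lt
    (((measurable_dist_continuousMap hp (d m)).const_mul _).const_add _) measurable_const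

/-! ### Scaling of geometric Brownian motion and the conclusion. -/

theorem pathOn_apply {T : ℝ≥0} {x : ℝ≥0 → ℝ} (hx : Continuous x) (t : Set.Icc (0 : ℝ≥0) T) :
    pathOn T x t = x t := by
  have h : Continuous (fun t : Set.Icc (0 : ℝ≥0) T => x t) := hx.comp continuous_subtype_val
  simp [pathOn, h]

theorem mem_barrierEvent_iff {Ω : Type*} {X : ℝ≥0 → Ω → ℝ} {B : ℝ} {T : ℝ≥0} {ω : Ω}
    (hc : Continuous fun t => X t ω) :
    ω ∈ barrierEvent X B T ↔ ∃ t ≤ T, B ≤ X t ω := by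
  have hne : Nonempty (Set.Icc (0 : ℝ≥0) T) := ⟨⟨0, by simp⟩⟩
  have hcont : Continuous fun t : Set.Icc (0 : ℝ≥0) T => X t ω := hc.comp continuous_subtype_val
  have hbdd : BddAbove (Set.range fun t : Set.Icc (0 : ℝ≥0) T => X t ω) :=
    (isCompact_range hcont).bddAbove
  constructor
  · intro h
    obtain ⟨t, ht⟩ := (isCompact_range hcont).sSup_mem (Set.range_nonempty _)
    refine ⟨t, t.2.2, ?_⟩
    have h' : B ≤ ⨆ t : Set.Icc (0 : ℝ≥0) T, X t ω := h
    rw [iSup, ← ht] at h'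
    exact h'
  · rintro ⟨t, ht, hB⟩
    exact hB.trans (le_ciSup hbdd (⟨t, zero_le, ht⟩ : Set.Icc (0 : ℝ≥0) T))

/-- The distance of an exponential of a path from the exponential of a line. -/
theorem abs_exp_sub_exp_line_le {S B σ τ x y s : ℝ} (hS : 0 < S) (hσ : 0 < σ) (hτ0 : 0 ≤ τ)
    (hτ : τ ≤ 1) (hy : S * Real.exp (σ * τ * y) = B) (hy0 : 0 ≤ y) (hs : s ≤ 1) :
    |S * Real.exp (σ * τ * x) - S * Real.exp (σ * τ * (y * s))| ≤
      B * τ * Real.exp (2 * σ * |x - y * s|) := by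
  set q := |x - y * s| with hq
  have hq0 : 0 ≤ q := abs_nonneg _
  have e : S * Real.exp (σ * τ * x) - S * Real.exp (σ * τ * (y * s)) =
      S * Real.exp (σ * τ * (y * s)) * (Real.exp (σ * τ * (x - y * s)) - 1) := by
    have : Real.exp (σ * τ * x) =
        Real.exp (σ * τ * (y * s)) * Real.exp (σ * τ * (x - y * s)) := by
      rw [← Real.exp_add]; ring_nf
    rw [this]; ring
  have h1 : S * Real.exp (σ * τ * (y * s)) ≤ B := by
    rw [← hy]
    gcongr
    exact mul_le_of_le_one_right hy0 hs
  -- One factor `τ` is kept, and this becomes the rate `√T`. The remaining `σ q exp (σ τ q)` is at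
  -- most `exp (2 σ q)`, hence the exponent `2 σ` used below.
  have h2 : |Real.exp (σ * τ * (x - y * s)) - 1| ≤ τ * Real.exp (2 * σ * q) := by
    refine (Real.abs_exp_sub_one_le_abs_mul_exp_abs _).trans ?_
    rw [abs_mul, abs_of_nonneg (by positivity : 0 ≤ σ * τ), ← hq]
    calc σ * τ * q * Real.exp (σ * τ * q) ≤ τ * (Real.exp (σ * q) * Real.exp (σ * q)) := by
          have h3 : σ * q ≤ Real.exp (σ * q) := by linarith [Real.add_one_le_exp (σ * q)]
          have h4 : Real.exp (σ * τ * q) ≤ Real.exp (σ * q) := by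
            gcongr
            exact mul_le_of_le_one_right hσ.le hτ
          calc _ = τ * ((σ * q) * Real.exp (σ * τ * q)) := by ring
            _ ≤ _ := by gcongr
      _ = _ := by rw [← Real.exp_add]; ring_nf
  rw [e, abs_mul, abs_of_nonneg (by positivity), mul_assoc B]
  have : 0 ≤ B := by rw [← hy]; positivity
  gcongr

/-- On the event that a geometric Brownian motion reaches the barrier, its mean distance from the
exponential curve is of order `√T` relative to the probability of that event. -/
theorem IsGBMSolution.lintegral_norm_path_sub_curve_le {Ω : Type*} {mΩ : MeasurableSpace Ω}
    {P : Measure Ω} [IsProbabilityMeasure P] {F : Filtration ℝ≥0 mΩ} {W X : ℝ≥0 → Ω → ℝ}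
    {μ σ S B : ℝ} (h : IsGBMSolution P F W μ σ S X) (hσ : 0 < σ) (hS : 0 < S) (hSB : S < B)
    {T : ℝ≥0} (hT : 0 < T) (hT1 : T ≤ 1) :
    NullMeasurableSet (barrierEvent X B T) P ∧
    ∫⁻ ω in barrierEvent X B T, ENNReal.ofReal ‖pathOn T (fun t => X t ω) -
        exponentialCurve S B hS (hS.trans hSB) T‖ ∂P ≤
      ENNReal.ofReal (B * √(T : ℝ)) * (barrierConst (2 * σ) (|μ - σ ^ 2 / 2| / σ) *
        P (barrierEvent X B T)) := by
  set ν := μ - σ ^ 2 / 2 with hν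
  have hB : 0 < B := hS.trans hSB
  have hT' : (0 : ℝ) < T := by exact_mod_cast hT
  set τ := √(T : ℝ) with hτ
  have hτ0 : 0 < τ := Real.sqrt_pos.2 hT'
  have hττ : τ * τ = T := Real.mul_self_sqrt hT'.le
  have hτ1 : τ ≤ 1 := Real.sqrt_le_one.2 (by exact_mod_cast hT1)
  obtain ⟨W', hW'm, hW'c, hWW'⟩ := exists_continuous_modification h.brownian.measurable
    h.brownian.isBrownian.cont
  have hW' : IsPreBrownianReal W' P := h.brownian.isBrownian.toIsPreBrownianReal.congr fun t => by
    filter_upwards [hWW'] with ω hω using hω t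
  -- Brownian scaling carries `[0, T]` to `[0, 1]`.
  set V : ℝ≥0 → Ω → ℝ := fun s ω => τ⁻¹ * W' (T * s) ω with hVdef
  have hV : IsPreBrownianReal V P := hW'.smul hT.ne'
  have hVm : ∀ s, Measurable (V s) := fun s => (hW'm _).const_mul _
  have hVc : ∀ ω, Continuous fun s => V s ω := fun ω => by
    have := hW'c ω
    simp only [hVdef]
    fun_prop
  -- The rescaled drift is bounded independently of `T` because `τ ≤ 1`; this is where `T ≤ 1` makes
  -- the constant uniform.
  set θ := ν / σ * τ with hθdef
  have hθ : |θ| ≤ |ν| / σ := by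
    rw [hθdef, abs_mul, abs_div, abs_of_pos hσ, abs_of_pos hτ0]
    exact mul_le_of_le_one_right (by positivity) hτ1
  -- The barrier in the rescaled coordinate. It tends to infinity as `T → 0` and depends on `S`, so
  -- the moment bound has to be uniform in it.
  set y := Real.log (B / S) / (σ * τ) with hydef
  have hστ : 0 < σ * τ := by positivity
  have hy : 0 < y := div_pos (Real.log_pos ((one_lt_div hS).2 hSB)) hστ
  have hyB : S * Real.exp (σ * τ * y) = B := by
    rw [hydef, mul_div_cancel₀ _ hστ.ne', Real.exp_log (by positivity)]
    field_simp
  have hX : ∀ᵐ ω ∂P, ∀ s : ℝ≥0, X (T * s) ω = S * Real.exp (σ * τ * (V s ω + θ * s)) := by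
    filter_upwards [h.ae_forall_eq_exp, hWW'] with ω h1 h2 s
    rw [h1, h2]
    congr 2
    simp only [hVdef, hθdef]
    push_cast
    rw [← hττ]
    field_simp
    rw [hν]
    ring
  have hdiv : ∀ t : ℝ≥0, T * (t / T) = t := fun t => mul_div_cancel₀ t hT.ne'
  set A := {ω | ∃ s ≤ (1 : ℝ≥0), y ≤ V s ω + θ * s} with hA
  have hAm : MeasurableSet A := measurableSet_exists_le (X := fun (s : ℝ≥0) ω => V s ω + θ * s)
    (fun s => (hVm s).add_const _) (fun ω => (hVc ω).add (by fun_prop)) 1 y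
  have hlevel : ∀ x : ℝ, B ≤ S * Real.exp (σ * τ * x) ↔ y ≤ x := fun x => by
    rw [← hyB, mul_le_mul_iff_right₀ hS, Real.exp_le_exp, mul_le_mul_iff_right₀ hστ]
  have hAE : barrierEvent X B T =ᵐ[P] A := by
    filter_upwards [hX, h.cont] with ω h1 h2
    refine propext ?_
    show ω ∈ barrierEvent X B T ↔ ω ∈ A
    rw [mem_barrierEvent_iff h2]
    constructor
    · rintro ⟨t, ht, hle⟩
      refine ⟨t / T, div_le_one_of_le₀ ht zero_le, ?_⟩
      rwa [← hlevel, ← h1, hdiv]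
    · rintro ⟨s, hs, hle⟩
      refine ⟨T * s, mul_le_of_le_one_right zero_le hs, ?_⟩
      rwa [h1, hlevel]
  have hpt : ∀ᵐ ω ∂P, ENNReal.ofReal ‖pathOn T (fun t => X t ω) -
      exponentialCurve S B hS (hS.trans hSB) T‖ ≤
      ENNReal.ofReal (B * τ) * lineDeviationSup V θ (2 * σ) y ω := by
    filter_upwards [hX, h.cont] with ω h1 h2
    have hBτ : 0 < B * τ := by positivity
    by_cases htop : lineDeviationSup V θ (2 * σ) y ω = ∞
    · rw [htop, ENNReal.mul_top (by simpa using hBτ)]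
      exact le_top
    rw [← ENNReal.ofReal_toReal htop, ← ENNReal.ofReal_mul hBτ.le]
    refine ENNReal.ofReal_le_ofReal ?_
    rw [ContinuousMap.norm_le _ (by positivity)]
    intro t
    have hs : (t : ℝ≥0) / T ≤ 1 := div_le_one_of_le₀ t.2.2 zero_le
    set s : ℝ≥0 := (t : ℝ≥0) / T with hsdef
    have hsr : (s : ℝ) = ((t : ℝ≥0) : ℝ) / T := by rw [hsdef]; push_cast; rfl
    have hcurve : exponentialCurve S B hS (hS.trans hSB) T t =
        S * Real.exp (σ * τ * (y * s)) := by
      show S * (B / S) ^ (((t : ℝ≥0) : ℝ) / (T : ℝ)) = _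
      rw [← hsr, Real.rpow_def_of_pos (by positivity)]
      congr 2
      rw [hydef]
      field_simp
    rw [ContinuousMap.sub_apply, pathOn_apply h2, hcurve, ← hdiv t, h1 s, Real.norm_eq_abs]
    refine (abs_exp_sub_exp_line_le hS hσ hτ0.le hτ1 hyB hy.le (by exact_mod_cast hs)).trans ?_
    gcongr
    rw [← ENNReal.ofReal_le_iff_le_toReal htop]
    exact le_iSup (fun s : Set.Icc (0 : ℝ≥0) 1 => ENNReal.ofReal
      (Real.exp (2 * σ * |V s ω + θ * (s : ℝ≥0) - y * (s : ℝ≥0)|))) ⟨s, zero_le, hs⟩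
  refine ⟨⟨A, hAm, hAE⟩, ?_⟩
  rw [setLIntegral_congr hAE, measure_congr hAE]
  calc _ ≤ ∫⁻ ω in A, ENNReal.ofReal (B * τ) * lineDeviationSup V θ (2 * σ) y ω ∂P :=
        lintegral_mono_ae (ae_restrict_of_ae hpt)
    _ = ENNReal.ofReal (B * τ) * ∫⁻ ω in A, lineDeviationSup V θ (2 * σ) y ω ∂P :=
        lintegral_const_mul' _ _ ENNReal.ofReal_ne_top
    _ ≤ _ := by
        gcongr
        exact lintegral_lineDeviationSup_le hθ hV hVm hVc (by positivity) hy

/-- A Lipschitz functional of the path is almost everywhere measurable. -/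
theorem IsGBMSolution.aestronglyMeasurable_payoff {Ω : Type*} {mΩ : MeasurableSpace Ω}
    {P : Measure Ω} {F : Filtration ℝ≥0 mΩ} {W X : ℝ≥0 → Ω → ℝ}
    {μ σ S : ℝ} (h : IsGBMSolution P F W μ σ S X) {T : ℝ≥0} {L : ℝ≥0}
    {Ψ : C(Set.Icc (0 : ℝ≥0) T, ℝ) → ℝ} (hΨ : LipschitzWith L Ψ) :
    AEStronglyMeasurable (fun ω => Ψ (pathOn T (fun t => X t ω))) P := by
  have hne : Nonempty (Set.Icc (0 : ℝ≥0) T) := ⟨⟨0, by simp⟩⟩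
  obtain ⟨X', hX'm, hX'c, hXX'⟩ := exists_continuous_modification h.measurable h.cont
  have hm : Measurable fun ω => Ψ (pathOn T (fun t => X' t ω)) :=
    hΨ.measurable_comp_continuousMap fun t => by
      simp_rw [pathOn_apply (hX'c _)]
      exact hX'm _
  refine ⟨_, hm.stronglyMeasurable, ?_⟩
  filter_upwards [hXX'] with ω hω
  simp_rw [hω]

theorem theorem6 (μ σ B : ℝ) (hσ : 0 < σ) :
    ∃ (C : ℝ) (T₀ : ℝ≥0), 0 < C ∧ 0 < T₀ ∧
      ∀ (S : ℝ) (hS : 0 < S) (hSB : S < B)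
        (Ω : Type*) (mΩ : MeasurableSpace Ω) (P : Measure Ω) (_ : IsProbabilityMeasure P)
        (F : Filtration ℝ≥0 mΩ) (W X : ℝ≥0 → Ω → ℝ),
        IsGBMSolution P F W μ σ S X →
        ∀ (T : ℝ≥0), 0 < T → T ≤ T₀ →
          ∀ (L : ℝ≥0) (Ψ : C(Set.Icc (0 : ℝ≥0) T, ℝ) → ℝ), LipschitzWith L Ψ →
            Integrable (barrierPayoff X B T Ψ) P ∧
            ∃ r : ℝ, |r| ≤ C * L * √(T : ℝ) ∧
              ∫ ω, barrierPayoff X B T Ψ ω ∂P =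
                P.real (barrierEvent X B T) *
                  (Ψ (exponentialCurve S B hS (hS.trans hSB) T) + r) := by
  set κ := barrierConst (2 * σ) (|μ - σ ^ 2 / 2| / σ) with hκ
  have hκt : κ ≠ ∞ := barrierConst_ne_top _ _
  -- The sign of `B` is known only once `S` is given, hence the absolute value; adding `1` makes the
  -- constant positive.
  refine ⟨|B| * κ.toReal + 1, 1, by positivity, one_pos, ?_⟩
  intro S hS hSB Ω mΩ P hP F W X h T hT hT1 L Ψ hΨ
  have hB : 0 < B := hS.trans hSB
  obtain ⟨hnull, hint⟩ := h.lintegral_norm_path_sub_curve_le hσ hS hSB hT hT1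
  set E := barrierEvent X B T with hE
  set ψ := Ψ (exponentialCurve S B hS (hS.trans hSB) T) with hψ
  set f : Ω → ℝ := fun ω => Ψ (pathOn T (fun t => X t ω)) - ψ with hf
  have hfm : AEStronglyMeasurable f P :=
    (h.aestronglyMeasurable_payoff hΨ).sub aestronglyMeasurable_const
  have hfle : ∫⁻ ω in E, ‖f ω‖ₑ ∂P ≤
      L * (ENNReal.ofReal (B * √(T : ℝ)) * (κ * P E)) := by
    calc _ ≤ ∫⁻ ω in E, L * ENNReal.ofReal ‖pathOn T (fun t => X t ω) -
          exponentialCurve S B hS (hS.trans hSB) T‖ ∂P := by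
          refine lintegral_mono fun ω => ?_
          have := hΨ.dist_le_mul (pathOn T (fun t => X t ω))
            (exponentialCurve S B hS (hS.trans hSB) T)
          rw [dist_eq_norm, dist_eq_norm] at this
          rw [← ofReal_norm, ← ENNReal.ofReal_coe_nnreal,
            ← ENNReal.ofReal_mul (NNReal.coe_nonneg L)]
          exact ENNReal.ofReal_le_ofReal this
      _ = L * ∫⁻ ω in E, ENNReal.ofReal ‖pathOn T (fun t => X t ω) -
          exponentialCurve S B hS (hS.trans hSB) T‖ ∂P :=
          lintegral_const_mul' _ _ ENNReal.coe_ne_top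
      _ ≤ _ := by gcongr
  have hfin : L * (ENNReal.ofReal (B * √(T : ℝ)) * (κ * P E)) ≠ ∞ :=
    ENNReal.mul_ne_top ENNReal.coe_ne_top (ENNReal.mul_ne_top ENNReal.ofReal_ne_top
      (ENNReal.mul_ne_top hκt (measure_ne_top _ _)))
  have hfi : IntegrableOn f E P :=
    ⟨hfm.restrict, lt_of_le_of_lt hfle (lt_top_iff_ne_top.2 hfin)⟩
  have hpay : barrierPayoff X B T Ψ = E.indicator fun ω => f ω + ψ := by
    rw [barrierPayoff]
    congr 1
    ext ω
    simp [hf]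
  have hgi : IntegrableOn (fun ω => f ω + ψ) E P := hfi.add (integrableOn_const (by simp))
  have hbound : |∫ ω in E, f ω ∂P| ≤ |B| * κ.toReal * L * √(T : ℝ) * P.real E := by
    have h1 : ‖∫ ω in E, f ω ∂P‖ₑ ≤ L * (ENNReal.ofReal (B * √(T : ℝ)) * (κ * P E)) :=
      (enorm_integral_le_lintegral_enorm _).trans hfle
    have h2 := ENNReal.toReal_mono hfin h1
    rw [toReal_enorm, Real.norm_eq_abs] at h2
    refine h2.trans (le_of_eq ?_)
    rw [ENNReal.toReal_mul, ENNReal.toReal_mul, ENNReal.toReal_mul,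
      ENNReal.toReal_ofReal (by positivity), abs_of_pos hB, Measure.real]
    simp only [ENNReal.coe_toReal]
    ring
  -- `r` is the conditional mean of `Ψ` on the path minus `Ψ` on the curve. If the event has
  -- probability zero, the quotient is `0` by convention, and `hbound` makes the integral vanish
  -- too.
  refine ⟨?_, (∫ ω in E, f ω ∂P) / P.real E, ?_, ?_⟩
  · rw [hpay]
    exact hgi.integrable_indicator₀ hnull
  · have hLT : 0 ≤ (L : ℝ) * √(T : ℝ) := by positivity
    rw [abs_div, abs_of_nonneg (measureReal_nonneg : 0 ≤ P.real E)]
    refine div_le_of_le_mul₀ measureReal_nonneg (by positivity) (hbound.trans ?_)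
    gcongr
    linarith
  · rw [hpay, integral_indicator₀ hnull, integral_add hfi (integrableOn_const (by simp)),
      setIntegral_const, smul_eq_mul]
    rcases eq_or_ne (P.real E) 0 with h0 | h0
    · rw [h0, mul_zero] at hbound
      rw [h0, abs_nonpos_iff.1 hbound]
      simp
    · field_simp
      ring
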